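/- Let $L>0$, $\omega>0$ and let $\alpha>0$ be an even integer. Write $L^2_{per}$, $H^s_{per}$ for the Lebesgue and Sobolev spaces of $L$-periodic functions. For $\upsilon>0$ let $\mathcal X_\upsilon$ be the set of all odd complex-valued $u\in H^1_{per}$ with $\int_0^L|u|^{\alpha+2}\,dx=\upsilon$, and let $\mathcal B_\omega(u)=\frac12\int_0^L(|u_x|^2+\omega|u|^2)\,dx$. Let $\varphi$ be an odd real $L$-periodic function such that, for some $\upsilon>0$ and $\theta\in\mathbb R$, the function $\Psi=e^{i\theta}\varphi$ lies in $\mathcal X_\upsilon$, minimizes $\mathcal B_\omega$ on $\mathcal X_\upsilon$, and lies in $H^2_{per}$ and satisfies $$-\Psi''+\omega\Psi-|\Psi|^\alpha\Psi=0 .$$ Let $$\mathcal L=\begin{pmatrix}\mathcal L_1&0\\0&\mathcal L_2\end{pmatrix},\qquad \mathcal L_1=-\partial_x^2+\omega-(\alpha+1)|\varphi|^\alpha,\qquad \mathcal L_2=-\partial_x^2+\omega-|\varphi|^\alpha,$$ in $L^2_{per}\times L^2_{per}$ with domain $H^2_{per}\times H^2_{per}$, and let $\mathcal L_{odd}$ be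 its restriction to pairs of odd functions, an operator in $L^2_{per,odd}\times L^2_{per,odd}$ with domain $H^2_{per,odd}\times H^2_{per,odd}$. Then $\mathcal L_{odd}$ has exactly one negative eigenvalue, and it is simple; zero is a simple eigenvalue with eigenfunction $(0,\varphi)$; and the remainder of the spectrum consists of positive eigenvalues of finite multiplicity. The spectrum is discrete: every bounded set contains only finitely many of its points. This holds for the spaces of real-valued functions, with real spectrum, as well as for their complexifications, with complex spectrum. -/

import Mathlib

open MeasureTheory

noncomputable section

namespace PeriodicNLS

/-! ## Weak derivatives and Sobolev classes on the circle of length `L`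

Functions on `AddCircle L` are the `L`-periodic functions; `volume` on `AddCircle L` is Lebesgue
measure of a period (total mass `L`).  `𝕜` is `ℝ` or `ℂ`. -/

section Sobolev

variable {𝕜 : Type*} [RCLike 𝕜] {L : ℝ} [Fact (0 < L)]

/-- `ψ` is a smooth `L`-periodic real function and `ψ'` is its derivative. -/
def IsTestPair (ψ ψ' : AddCircle L → ℝ) : Prop :=
  ContDiff ℝ (⊤ : ℕ∞) (fun x : ℝ => ψ (x : AddCircle L)) ∧
    ∀ x : ℝ, HasDerivAt (fun y : ℝ => ψ (y : AddCircle L)) (ψ' (x : AddCircle L)) x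

/-- `g` is a weak derivative of `f` on the circle: `∫ ψ' f = - ∫ ψ g` for all smooth periodic
`ψ`. -/
def HasWeakDeriv (f g : AddCircle L → 𝕜) : Prop :=
  ∀ ψ ψ' : AddCircle L → ℝ, IsTestPair ψ ψ' → ∫ x, (ψ' x : 𝕜) * f x = - ∫ x, (ψ x : 𝕜) * g x

/-- The (class of the) function `f` lies in `H¹_per`: it is square integrable and has a square
integrable weak derivative. -/
def MemH1 (f : AddCircle L → 𝕜) : Prop :=
  MemLp f 2 volume ∧ ∃ g : AddCircle L → 𝕜, MemLp g 2 volume ∧ HasWeakDeriv f g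

open Classical in
/-- The weak derivative in `L²` of a function in `H¹_per` (and `0` for other functions); it is
unique up to equality almost everywhere, see `weakDeriv_unique`. -/
def weakDeriv (f : AddCircle L → 𝕜) : AddCircle L → 𝕜 :=
  if h : ∃ g : AddCircle L → 𝕜, MemLp g 2 volume ∧ HasWeakDeriv f g then h.choose else 0

/-- The function `f` lies in `H²_per`. -/
def MemH2 (f : AddCircle L → 𝕜) : Prop :=
  MemH1 f ∧ MemH1 (weakDeriv f)

/-- `f` is odd (as a class of functions modulo equality almost everywhere). -/
def IsOdd (f : AddCircle L → 𝕜) : Prop :=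
  ∀ᵐ x : AddCircle L, f (-x) = - f x

theorem IsTestPair.continuous {ψ ψ' : AddCircle L → ℝ} (h : IsTestPair ψ ψ') :
    Continuous ψ ∧ Continuous ψ' := by
  have hq : Topology.IsQuotientMap (fun x : ℝ => (x : AddCircle L)) := isQuotientMap_quot_mk
  refine ⟨hq.continuous_iff.2 h.1.continuous, hq.continuous_iff.2 ?_⟩
  have : (fun x : ℝ => ψ' (x : AddCircle L)) = deriv (fun y : ℝ => ψ (y : AddCircle L)) := by
    funext x
    exact (h.2 x).deriv.symm
  change Continuous (fun x : ℝ => ψ' (x : AddCircle L))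
  rw [this]
  exact h.1.continuous_deriv (by simp)

theorem integrable_mul {ψ : AddCircle L → ℝ} (hψ : Continuous ψ) {f : AddCircle L → 𝕜}
    (hf : MemLp f 2 volume) : Integrable (fun x => (ψ x : 𝕜) * f x) volume := by
  have hc : Continuous (fun x => (ψ x : 𝕜)) := RCLike.continuous_ofReal.comp hψ
  obtain ⟨C, hC⟩ := isCompact_univ.exists_bound_of_continuousOn hc.continuousOn
  exact (hf.integrable (by norm_num)).bdd_mul hc.aestronglyMeasurable
    (Filter.Eventually.of_forall fun x => hC x (Set.mem_univ x))

theorem HasWeakDeriv.add {f g f' g' : AddCircle L → 𝕜} (hf : MemLp f 2 volume)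
    (hg : MemLp g 2 volume) (hf' : MemLp f' 2 volume) (hg' : MemLp g' 2 volume)
    (h1 : HasWeakDeriv f f') (h2 : HasWeakDeriv g g') :
    HasWeakDeriv (f + g) (f' + g') := by
  intro ψ ψ' h
  have hc := h.continuous
  simp only [Pi.add_apply, mul_add]
  rw [integral_add (integrable_mul hc.2 hf) (integrable_mul hc.2 hg),
    integral_add (integrable_mul hc.1 hf') (integrable_mul hc.1 hg'), h1 ψ ψ' h, h2 ψ ψ' h]
  ring

theorem HasWeakDeriv.const_smul (c : 𝕜) {f f' : AddCircle L → 𝕜} (h1 : HasWeakDeriv f f') :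
    HasWeakDeriv (c • f) (c • f') := by
  intro ψ ψ' h
  have e : ∀ (p : AddCircle L → ℝ) (u : AddCircle L → 𝕜),
      (fun x => (p x : 𝕜) * (c • u) x) = fun x => c * ((p x : 𝕜) * u x) := by
    intro p u
    funext x
    simp only [Pi.smul_apply, smul_eq_mul]
    ring
  rw [e, e, integral_const_mul, integral_const_mul, h1 ψ ψ' h]
  ring

theorem HasWeakDeriv.congr {f g f' g' : AddCircle L → 𝕜} (h : HasWeakDeriv f f')
    (h1 : f =ᵐ[volume] g) (h2 : f' =ᵐ[volume] g') : HasWeakDeriv g g' := by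
  intro ψ ψ' hψ
  rw [← integral_congr_ae (h1.mono fun x hx => by simp only [hx] :
      (fun x => (ψ' x : 𝕜) * f x) =ᵐ[volume] fun x => (ψ' x : 𝕜) * g x),
    ← integral_congr_ae (h2.mono fun x hx => by simp only [hx] :
      (fun x => (ψ x : 𝕜) * f' x) =ᵐ[volume] fun x => (ψ x : 𝕜) * g' x)]
  exact h ψ ψ' hψ

theorem isTestPair_re_fourier (n : ℤ) : ∃ ψ' : AddCircle L → ℝ,
    IsTestPair (fun x : AddCircle L => (fourier n x).re) ψ' := by
  refine ⟨fun x => (2 * Real.pi * Complex.I * n / L * fourier n x).re, ?_, fun x => ?_⟩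
  · have : ContDiff ℝ (⊤ : ℕ∞) (fun x : ℝ => (fourier n (x : AddCircle L) : ℂ)) := by
      simp only [fourier_coe_apply]
      have : ContDiff ℝ (⊤ : ℕ∞) (fun x : ℝ => (x : ℂ)) := Complex.ofRealCLM.contDiff
      fun_prop
    exact Complex.reCLM.contDiff.comp this
  · have := Complex.reCLM.hasFDerivAt.comp_hasDerivAt x (hasDerivAt_fourier L n x)
    exact this

theorem isTestPair_im_fourier (n : ℤ) : ∃ ψ' : AddCircle L → ℝ,
    IsTestPair (fun x : AddCircle L => (fourier n x).im) ψ' := by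
  refine ⟨fun x => (2 * Real.pi * Complex.I * n / L * fourier n x).im, ?_, fun x => ?_⟩
  · have : ContDiff ℝ (⊤ : ℕ∞) (fun x : ℝ => (fourier n (x : AddCircle L) : ℂ)) := by
      simp only [fourier_coe_apply]
      have : ContDiff ℝ (⊤ : ℕ∞) (fun x : ℝ => (x : ℂ)) := Complex.ofRealCLM.contDiff
      fun_prop
    exact Complex.imCLM.contDiff.comp this
  · have := Complex.imCLM.hasFDerivAt.comp_hasDerivAt x (hasDerivAt_fourier L n x)
    exact this

/-- A real square integrable function orthogonal to all test functions vanishes. -/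
theorem ae_eq_zero_of_test {d : AddCircle L → ℝ} (hd : MemLp d 2 volume)
    (h : ∀ ψ ψ' : AddCircle L → ℝ, IsTestPair ψ ψ' → ∫ x, ψ x * d x = 0) :
    d =ᵐ[volume] 0 := by
  have hL : 0 < L := Fact.out
  set F : AddCircle L → ℂ := fun x => (d x : ℂ) with hF
  have hFm : MemLp F 2 volume := hd.ofReal
  have hFh : MemLp F 2 AddCircle.haarAddCircle := memLp_haarAddCircle_iff.2 hFm
  have hz : hFh.toLp F = 0 := by
    apply (fourierBasis (T := L)).repr.injective
    rw [map_zero]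
    ext n
    rw [fourierBasis_repr, fourierCoeff_congr_ae hFh.coeFn_toLp]
    have hi : Integrable (fun x => fourier (-n) x * F x) (volume : Measure (AddCircle L)) :=
      ((hFm.integrable (by norm_num)).bdd_mul
        (map_continuous (fourier (-n))).aestronglyMeasurable (c := 1)
        (Filter.Eventually.of_forall fun x => by rw [fourier_apply, Circle.norm_coe]))
    have hv : ∫ x : AddCircle L, fourier (-n) x * F x = 0 := by
      obtain ⟨p, hp⟩ := isTestPair_re_fourier (L := L) (-n)
      obtain ⟨q, hq⟩ := isTestPair_im_fourier (L := L) (-n)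
      have h1 := h _ _ hp
      have h2 := h _ _ hq
      apply Complex.ext
      · have := Complex.reCLM.integral_comp_comm hi
        simp only [Complex.reCLM_apply] at this
        rw [← this, Complex.zero_re, ← h1]
        exact integral_congr_ae (Filter.Eventually.of_forall fun x => by simp [hF])
      · have := Complex.imCLM.integral_comp_comm hi
        simp only [Complex.imCLM_apply] at this
        rw [← this, Complex.zero_im, ← h2]
        exact integral_congr_ae (Filter.Eventually.of_forall fun x => by simp [hF])
    rw [fourierCoeff, AddCircle.integral_haarAddCircle]
    simp only [smul_eq_mul, hv]
    simp
  have hz' : F =ᵐ[AddCircle.haarAddCircle] 0 := by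
    have e := hFh.coeFn_toLp
    rw [hz] at e
    exact e.symm.trans (Lp.coeFn_zero _ _ _)
  have hz2 : F =ᵐ[volume] 0 := by
    rw [AddCircle.volume_eq_smul_haarAddCircle]
    exact Measure.ae_smul_measure hz' _
  filter_upwards [hz2] with x hx
  simpa [hF] using hx

/-- Weak derivatives are unique. -/
theorem weakDeriv_unique {f g g' : AddCircle L → 𝕜} (hg : MemLp g 2 volume)
    (hg' : MemLp g' 2 volume) (h1 : HasWeakDeriv f g) (h2 : HasWeakDeriv f g') :
    g =ᵐ[volume] g' := by
  have hd : MemLp (fun x => g x - g' x) 2 volume := hg.sub hg'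
  have h0 : ∀ ψ ψ' : AddCircle L → ℝ, IsTestPair ψ ψ' →
      ∫ x, (ψ x : 𝕜) * (g x - g' x) = 0 := by
    intro ψ ψ' h
    have e := (h1 ψ ψ' h).symm.trans (h2 ψ ψ' h)
    simp only [mul_sub]
    rw [integral_sub (integrable_mul h.continuous.1 hg) (integrable_mul h.continuous.1 hg'),
      neg_injective e, sub_self]
  have hre : (fun x => RCLike.re (g x - g' x)) =ᵐ[volume] 0 := by
    refine ae_eq_zero_of_test hd.re fun ψ ψ' h => ?_
    have := integral_re (𝕜 := 𝕜) (integrable_mul (𝕜 := 𝕜) h.continuous.1 hd)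
    rw [h0 ψ ψ' h] at this
    simpa using this
  have him : (fun x => RCLike.im (g x - g' x)) =ᵐ[volume] 0 := by
    refine ae_eq_zero_of_test hd.im fun ψ ψ' h => ?_
    have := integral_im (𝕜 := 𝕜) (integrable_mul (𝕜 := 𝕜) h.continuous.1 hd)
    rw [h0 ψ ψ' h] at this
    simpa using this
  filter_upwards [hre, him] with x h1 h2
  refine sub_eq_zero.1 (RCLike.ext ?_ ?_)
  · simpa using h1
  · simpa using h2

theorem MemH1.memLp {f : AddCircle L → 𝕜} (h : MemH1 f) : MemLp f 2 volume := h.1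

theorem MemH1.memLp_weakDeriv {f : AddCircle L → 𝕜} (h : MemH1 f) :
    MemLp (weakDeriv f) 2 volume := by
  rw [weakDeriv, dif_pos h.2]
  exact h.2.choose_spec.1

theorem MemH1.hasWeakDeriv {f : AddCircle L → 𝕜} (h : MemH1 f) :
    HasWeakDeriv f (weakDeriv f) := by
  rw [weakDeriv, dif_pos h.2]
  exact h.2.choose_spec.2

theorem weakDeriv_eq {f g : AddCircle L → 𝕜} (hf : MemLp f 2 volume) (hg : MemLp g 2 volume)
    (h : HasWeakDeriv f g) : MemH1 f ∧ weakDeriv f =ᵐ[volume] g := by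
  have hm : MemH1 f := ⟨hf, g, hg, h⟩
  exact ⟨hm, weakDeriv_unique hm.memLp_weakDeriv hg hm.hasWeakDeriv h⟩

theorem MemH1.congr {f g : AddCircle L → 𝕜} (h : MemH1 f) (e : f =ᵐ[volume] g) :
    MemH1 g ∧ weakDeriv g =ᵐ[volume] weakDeriv f :=
  weakDeriv_eq ((memLp_congr_ae e).1 h.1) h.memLp_weakDeriv
    (h.hasWeakDeriv.congr e Filter.EventuallyEq.rfl)

theorem MemH1.add {f g : AddCircle L → 𝕜} (hf : MemH1 f) (hg : MemH1 g) :
    MemH1 (f + g) ∧ weakDeriv (f + g) =ᵐ[volume] weakDeriv f + weakDeriv g :=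
  weakDeriv_eq (hf.1.add hg.1) (hf.memLp_weakDeriv.add hg.memLp_weakDeriv)
    (hf.hasWeakDeriv.add hf.1 hg.1 hf.memLp_weakDeriv hg.memLp_weakDeriv hg.hasWeakDeriv)

theorem MemH1.const_smul (c : 𝕜) {f : AddCircle L → 𝕜} (hf : MemH1 f) :
    MemH1 (c • f) ∧ weakDeriv (c • f) =ᵐ[volume] c • weakDeriv f :=
  weakDeriv_eq (hf.1.const_smul c) (hf.memLp_weakDeriv.const_smul c)
    (hf.hasWeakDeriv.const_smul c)

theorem MemH2.congr {f g : AddCircle L → 𝕜} (h : MemH2 f) (e : f =ᵐ[volume] g) :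
    MemH2 g ∧ weakDeriv (weakDeriv g) =ᵐ[volume] weakDeriv (weakDeriv f) := by
  obtain ⟨h1, e1⟩ := h.1.congr e
  obtain ⟨h2, e2⟩ := h.2.congr e1.symm
  exact ⟨⟨h1, h2⟩, e2⟩

theorem MemH2.add {f g : AddCircle L → 𝕜} (hf : MemH2 f) (hg : MemH2 g) :
    MemH2 (f + g) ∧ weakDeriv (weakDeriv (f + g)) =ᵐ[volume]
      weakDeriv (weakDeriv f) + weakDeriv (weakDeriv g) := by
  obtain ⟨h1, e1⟩ := hf.1.add hg.1
  obtain ⟨h2, e2⟩ := hf.2.add hg.2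
  obtain ⟨h3, e3⟩ := h2.congr e1.symm
  exact ⟨⟨h1, h3⟩, e3.trans e2⟩

theorem MemH2.const_smul (c : 𝕜) {f : AddCircle L → 𝕜} (hf : MemH2 f) :
    MemH2 (c • f) ∧ weakDeriv (weakDeriv (c • f)) =ᵐ[volume]
      c • weakDeriv (weakDeriv f) := by
  obtain ⟨h1, e1⟩ := hf.1.const_smul c
  obtain ⟨h2, e2⟩ := hf.2.const_smul c
  obtain ⟨h3, e3⟩ := h2.congr e1.symm
  exact ⟨⟨h1, h3⟩, e3.trans e2⟩

theorem memH2_zero : MemH2 (0 : AddCircle L → 𝕜) := by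
  have h : HasWeakDeriv (0 : AddCircle L → 𝕜) 0 := by
    intro ψ ψ' _
    simp
  have h0 : MemLp (0 : AddCircle L → 𝕜) 2 volume := MemLp.zero
  obtain ⟨h1, e1⟩ := weakDeriv_eq h0 h0 h
  exact ⟨h1, (h1.congr e1.symm).1⟩

end Sobolev

/-! ## The constrained minimization problem in the odd sector -/

section Minimization

variable {L : ℝ} [Fact (0 < L)]

/-- `𝓑_ω(u) = ½ ∫₀ᴸ (|u_x|² + ω |u|²) dx`. -/
def energyB (ω : ℝ) (u : AddCircle L → ℂ) : ℝ :=
  (1 / 2) * ∫ x, (‖weakDeriv u x‖ ^ 2 + ω * ‖u x‖ ^ 2)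

/-- The constraint set: complex odd functions `u` in `H¹_per` with `∫₀ᴸ |u|^(α+2) dx = υ`. -/
def oddConstraint (L : ℝ) [Fact (0 < L)] (α : ℕ) (υ : ℝ) : Set (AddCircle L → ℂ) :=
  {u | MemH1 u ∧ IsOdd u ∧ ∫ x, ‖u x‖ ^ (α + 2) = υ}

/-- `Ψ` solves `-Ψ'' + ω Ψ - |Ψ|^α Ψ = 0` (as an identity in `L²_per`). -/
def SolvesStationary {𝕜 : Type*} [RCLike 𝕜] (ω : ℝ) (α : ℕ) (Ψ : AddCircle L → 𝕜) : Prop :=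
  MemH2 Ψ ∧ ∀ᵐ x : AddCircle L,
    - weakDeriv (weakDeriv Ψ) x + (ω : 𝕜) * Ψ x - ((‖Ψ x‖ ^ α : ℝ) : 𝕜) * Ψ x = 0

/-- `φ` is an odd real periodic wave obtained from the minimization problem: for some `υ > 0`
there is a minimizer `Ψ` of `𝓑_ω` on the constraint set, solving
`-Ψ'' + ω Ψ - |Ψ|^α Ψ = 0`, with `Ψ = e^{iθ} φ` for some real `θ` and `φ` odd. -/
def IsOddMinimizingWave (L : ℝ) [Fact (0 < L)] (ω : ℝ) (α : ℕ) (φ : AddCircle L → ℝ) : Prop :=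
  IsOdd φ ∧ ∃ υ : ℝ, 0 < υ ∧ ∃ Ψ ∈ oddConstraint L α υ,
    IsMinOn (energyB ω) (oddConstraint L α υ) Ψ ∧ SolvesStationary ω α Ψ ∧
    ∃ θ : ℝ, ∀ᵐ x : AddCircle L, Ψ x = Complex.exp (θ * Complex.I) * (φ x : ℂ)

end Minimization

/-! ## Unbounded operators: eigenspaces, spectrum, parts, diagonal operators -/

section Operators

variable {𝕜 : Type*} [RCLike 𝕜] {H : Type*} [NormedAddCommGroup H] [InnerProductSpace 𝕜 H]

/-- `ker (A - z)`; the number `z` is an eigenvalue if this is not `0`, and it is simple if this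
has dimension one. -/
def eigenspace (A : H →ₗ.[𝕜] H) (z : 𝕜) : Submodule 𝕜 H where
  carrier := {u | ∃ h : u ∈ A.domain, A ⟨u, h⟩ = z • u}
  zero_mem' := ⟨A.domain.zero_mem, by
    have : (⟨0, A.domain.zero_mem⟩ : A.domain) = 0 := rfl
    rw [this, LinearPMap.map_zero, smul_zero]⟩
  add_mem' := by
    rintro a b ⟨ha, ea⟩ ⟨hb, eb⟩
    refine ⟨A.domain.add_mem ha hb, ?_⟩
    have : (⟨a + b, A.domain.add_mem ha hb⟩ : A.domain) = ⟨a, ha⟩ + ⟨b, hb⟩ := rfl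
    rw [this, LinearPMap.map_add, ea, eb, smul_add]
  smul_mem' := by
    rintro c a ⟨ha, ea⟩
    refine ⟨A.domain.smul_mem c ha, ?_⟩
    have : (⟨c • a, A.domain.smul_mem c ha⟩ : A.domain) = c • ⟨a, ha⟩ := rfl
    rw [this, LinearPMap.map_smul, ea, smul_comm]

/-- `z` is an eigenvalue of `A`. -/
def IsEigenvalue (A : H →ₗ.[𝕜] H) (z : 𝕜) : Prop := eigenspace A z ≠ ⊥

/-- The spectrum of `A`: the set of `z` such that `A - z : D(A) → H` has no bounded everywhere
defined two-sided inverse. -/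
def opSpectrum (A : H →ₗ.[𝕜] H) : Set 𝕜 :=
  {z | ¬ ∃ R : H →L[𝕜] H,
    (∀ y : H, ∃ h : R y ∈ A.domain, A ⟨R y, h⟩ - z • R y = y) ∧
    ∀ x : A.domain, R (A x - z • (x : H)) = x}

/-- The restriction (part) of `A` in a subspace `S`: it is defined on the `u ∈ S ∩ D(A)` with
`A u ∈ S`, and it is regarded as an operator in `S`.  If `A` maps `S ∩ D(A)` to `S`, this is the
restriction of `A` to `S ∩ D(A)`. -/
def part (A : H →ₗ.[𝕜] H) (S : Submodule 𝕜 H) : S →ₗ.[𝕜] S where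
  domain :=
    { carrier := {u | ∃ h : (u : H) ∈ A.domain, A ⟨u, h⟩ ∈ S}
      zero_mem' := ⟨A.domain.zero_mem, by
        have : (⟨((0 : S) : H), A.domain.zero_mem⟩ : A.domain) = 0 := rfl
        rw [this, LinearPMap.map_zero]
        exact S.zero_mem⟩
      add_mem' := by
        rintro a b ⟨ha, ea⟩ ⟨hb, eb⟩
        refine ⟨A.domain.add_mem ha hb, ?_⟩
        have : (⟨((a + b : S) : H), A.domain.add_mem ha hb⟩ : A.domain) =
          ⟨a, ha⟩ + ⟨b, hb⟩ := rfl
        rw [this, LinearPMap.map_add]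
        exact S.add_mem ea eb
      smul_mem' := by
        rintro c a ⟨ha, ea⟩
        refine ⟨A.domain.smul_mem c ha, ?_⟩
        have : (⟨((c • a : S) : H), A.domain.smul_mem c ha⟩ : A.domain) = c • ⟨a, ha⟩ := rfl
        rw [this, LinearPMap.map_smul]
        exact S.smul_mem c ea }
  toFun :=
    { toFun := fun u => ⟨A ⟨((u : S) : H), u.2.1⟩, u.2.2⟩
      map_add' := fun a b => Subtype.ext
        (LinearPMap.map_add A ⟨((a : S) : H), a.2.1⟩ ⟨((b : S) : H), b.2.1⟩)
      map_smul' := fun c a => Subtype.ext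
        (LinearPMap.map_smul A c ⟨((a : S) : H), a.2.1⟩) }

/-- The diagonal operator `(u, v) ↦ (A u, B v)` with domain `D(A) × D(B)` in `H × H` (with the
Hilbert norm). -/
def diagOp (A B : H →ₗ.[𝕜] H) : WithLp 2 (H × H) →ₗ.[𝕜] WithLp 2 (H × H) where
  domain :=
    { carrier := {u | u.fst ∈ A.domain ∧ u.snd ∈ B.domain}
      zero_mem' := ⟨A.domain.zero_mem, B.domain.zero_mem⟩
      add_mem' := fun ha hb => ⟨A.domain.add_mem ha.1 hb.1, B.domain.add_mem ha.2 hb.2⟩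
      smul_mem' := fun c _ ha => ⟨A.domain.smul_mem c ha.1, B.domain.smul_mem c ha.2⟩ }
  toFun :=
    { toFun := fun u => WithLp.toLp 2 (A ⟨u.1.fst, u.2.1⟩, B ⟨u.1.snd, u.2.2⟩)
      map_add' := fun a b => congrArg (WithLp.toLp 2) (Prod.ext
        (LinearPMap.map_add A ⟨a.1.fst, a.2.1⟩ ⟨b.1.fst, b.2.1⟩)
        (LinearPMap.map_add B ⟨a.1.snd, a.2.2⟩ ⟨b.1.snd, b.2.2⟩))
      map_smul' := fun c a => congrArg (WithLp.toLp 2) (Prod.ext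
        (LinearPMap.map_smul A c ⟨a.1.fst, a.2.1⟩)
        (LinearPMap.map_smul B c ⟨a.1.snd, a.2.2⟩)) }

end Operators

/-! ## The linearized operators -/

section Linearized

variable (𝕜 : Type*) [RCLike 𝕜] {L : ℝ} [Fact (0 < L)]

/-- `L²_per`; for `𝕜 = ℝ` the real space, for `𝕜 = ℂ` its complexification. -/
abbrev L2per (L : ℝ) [Fact (0 < L)] : Type _ := Lp 𝕜 2 (volume : Measure (AddCircle L))

/-- `L²_per × L²_per`, with the Hilbert norm. -/
abbrev L2pair (L : ℝ) [Fact (0 < L)] : Type _ := WithLp 2 (L2per 𝕜 L × L2per 𝕜 L)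

/-- The domain of `-∂ₓ² + V` in `L²_per`: the functions `f` in `H²_per` with `V f` square
integrable.  For bounded measurable `V`, as below, this is `H²_per`. -/
def hillDomain (V : AddCircle L → ℝ) : Submodule 𝕜 (L2per 𝕜 L) where
  carrier := {f | MemH2 (f : AddCircle L → 𝕜) ∧
    MemLp (fun x => (V x : 𝕜) * f x) 2 (volume : Measure (AddCircle L))}
  zero_mem' := by
    have e := (Lp.coeFn_zero 𝕜 2 (volume : Measure (AddCircle L)))
    refine ⟨(memH2_zero.congr e.symm).1, ?_⟩
    refine (memLp_congr_ae ?_).2 (MemLp.zero' (p := 2))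
    filter_upwards [e] with x hx
    simp [hx]
  add_mem' := by
    rintro f g ⟨hf, hf'⟩ ⟨hg, hg'⟩
    have e := Lp.coeFn_add f g
    refine ⟨((hf.add hg).1.congr e.symm).1, (memLp_congr_ae ?_).2 (hf'.add hg')⟩
    filter_upwards [e] with x hx
    simp only [Pi.add_apply] at hx ⊢
    rw [hx, mul_add]
  smul_mem' := by
    rintro c f ⟨hf, hf'⟩
    have e := Lp.coeFn_smul c f
    refine ⟨((hf.const_smul c).1.congr e.symm).1, (memLp_congr_ae ?_).2 (hf'.const_smul c)⟩
    filter_upwards [e] with x hx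
    simp only [hx, Pi.smul_apply, smul_eq_mul]
    ring

theorem hillOp_memLp (V : AddCircle L → ℝ) (f : hillDomain 𝕜 V) :
    MemLp (fun x => - weakDeriv (weakDeriv (f : L2per 𝕜 L)) x + (V x : 𝕜) * (f : L2per 𝕜 L) x)
      2 (volume : Measure (AddCircle L)) :=
  (f.2.1.2.memLp_weakDeriv.neg).add f.2.2

/-- The Hill operator `-∂ₓ² + V` in `L²_per`. -/
def hillOp (V : AddCircle L → ℝ) : L2per 𝕜 L →ₗ.[𝕜] L2per 𝕜 L where
  domain := hillDomain 𝕜 V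
  toFun :=
    { toFun := fun f => (hillOp_memLp 𝕜 V f).toLp _
      map_add' := by
        intro f g
        rw [← MemLp.toLp_add, MemLp.toLp_eq_toLp_iff]
        have e := Lp.coeFn_add (f : L2per 𝕜 L) (g : L2per 𝕜 L)
        have e1 := (f.2.1.add g.2.1).2
        have e2 := ((f.2.1.add g.2.1).1.congr e.symm).2
        filter_upwards [e, e1, e2] with x hx h1 h2
        simp only [Submodule.coe_add, Pi.add_apply] at hx h1 h2 ⊢
        rw [h2, h1, hx]
        ring
      map_smul' := by
        intro c f
        rw [RingHom.id_apply, ← MemLp.toLp_const_smul, MemLp.toLp_eq_toLp_iff]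
        have e := Lp.coeFn_smul c (f : L2per 𝕜 L)
        have e1 := (f.2.1.const_smul c).2
        have e2 := ((f.2.1.const_smul c).1.congr e.symm).2
        filter_upwards [e, e1, e2] with x hx h1 h2
        simp only [Submodule.coe_smul, Pi.smul_apply, smul_eq_mul] at hx h1 h2 ⊢
        rw [h2, h1, hx]
        ring }

/-- `𝓛₁ = -∂ₓ² + ω - (α+1) |φ|^α`. -/
def opL1 (ω : ℝ) (α : ℕ) (φ : AddCircle L → ℝ) : L2per 𝕜 L →ₗ.[𝕜] L2per 𝕜 L :=
  hillOp 𝕜 (fun x => ω - (α + 1) * |φ x| ^ α)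

/-- `𝓛₂ = -∂ₓ² + ω - |φ|^α`. -/
def opL2 (ω : ℝ) (α : ℕ) (φ : AddCircle L → ℝ) : L2per 𝕜 L →ₗ.[𝕜] L2per 𝕜 L :=
  hillOp 𝕜 (fun x => ω - |φ x| ^ α)

/-- `𝓛 = diag(𝓛₁, 𝓛₂)`. -/
def opL (ω : ℝ) (α : ℕ) (φ : AddCircle L → ℝ) : L2pair 𝕜 L →ₗ.[𝕜] L2pair 𝕜 L :=
  diagOp (opL1 𝕜 ω α φ) (opL2 𝕜 ω α φ)

/-- The odd sector of `L²_per × L²_per`: pairs of odd functions. -/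
def oddSector (L : ℝ) [Fact (0 < L)] : Submodule 𝕜 (L2pair 𝕜 L) where
  carrier := {u | IsOdd (u.fst : AddCircle L → 𝕜) ∧ IsOdd (u.snd : AddCircle L → 𝕜)}
  zero_mem' := by
    have e := Lp.coeFn_zero 𝕜 2 (volume : Measure (AddCircle L))
    have h : IsOdd ((0 : L2per 𝕜 L) : AddCircle L → 𝕜) := by
      filter_upwards [e, (Measure.measurePreserving_neg volume).quasiMeasurePreserving.ae e]
        with x h1 h2
      simp [h1, h2]
    exact ⟨h, h⟩
  add_mem' := by
    have key : ∀ f g : L2per 𝕜 L, IsOdd (f : AddCircle L → 𝕜) → IsOdd (g : AddCircle L → 𝕜) →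
        IsOdd ((f + g : L2per 𝕜 L) : AddCircle L → 𝕜) := by
      intro f g hf hg
      have e := Lp.coeFn_add f g
      filter_upwards [e, (Measure.measurePreserving_neg volume).quasiMeasurePreserving.ae e,
        hf, hg] with x h1 h2 h3 h4
      simp only [h1, h2, h3, h4, Pi.add_apply]
      ring
    rintro a b ⟨ha, ha'⟩ ⟨hb, hb'⟩
    exact ⟨key _ _ ha hb, key _ _ ha' hb'⟩
  smul_mem' := by
    have key : ∀ (c : 𝕜) (f : L2per 𝕜 L), IsOdd (f : AddCircle L → 𝕜) →
        IsOdd ((c • f : L2per 𝕜 L) : AddCircle L → 𝕜) := by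
      intro c f hf
      have e := Lp.coeFn_smul c f
      filter_upwards [e, (Measure.measurePreserving_neg volume).quasiMeasurePreserving.ae e,
        hf] with x h1 h2 h3
      simp only [h1, h2, h3, Pi.smul_apply, smul_neg]
    rintro c a ⟨ha, ha'⟩
    exact ⟨key c _ ha, key c _ ha'⟩

/-- `𝓛_odd`: the restriction of `𝓛` to the odd sector, as an operator in the odd sector.
Since the potentials are even for odd `φ`, its domain is `H²_per,odd × H²_per,odd` whenever `φ` is
bounded. -/
def opLodd (ω : ℝ) (α : ℕ) (φ : AddCircle L → ℝ) :
    oddSector 𝕜 L →ₗ.[𝕜] oddSector 𝕜 L :=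
  part (opL 𝕜 ω α φ) (oddSector 𝕜 L)

end Linearized

end PeriodicNLS

end

/-!
Write `α = 2 k - 2`. A minimizing wave agrees, up to a phase, with a classical odd solution `p` of
`p'' = (ω - p ^ (2 k - 2)) p` (`IsOddMinimizingWave.exists_profile`). By rescaling to the
constraint set, minimality becomes the homogeneous inequality
`(∫ |u|^(2k)) (∫ p^(2k))^k ≤ (∫ (|u'|² + ω |u|²))^k ∫ p^(2k)` for all odd `u`. Its second variation
at `p`, in imaginary and in real directions, says that on odd functions `𝓛₂ ≥ 0` and that `𝓛₁ ≥ 0`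
on the functions orthogonal to `p^(2k-1)` (`nonneg_form₂`, `nonneg_form₁`).

Spectral theory. On odd functions `-∂ₓ²` has a compact inverse, the double integration
`invLaplacian`, and the potentials are bounded symmetric perturbations. So the spectrum of the
operator in the odd sector is real and discrete, and consists of eigenvalues of finite multiplicity
(`IsPerturbationOfCompactInverse` and the lemmas about it). The form is negative at `(p, 0)`, since
`⟨𝓛₁ p, p⟩ = -(2k-2) ∫ p^(2k)`, and nonnegative on the kernel of one linear functional. This gives
exactly one negative eigenvalue, and it is simple.

The kernel. An odd solution of a second order equation is determined by its derivative at `0`, so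
the kernel of `𝓛₂` is spanned by `p`. The kernel of `𝓛₁` is trivial, by a Sturm type argument whose
tool is that a null vector of a semidefinite form lies in its radical, tested against functions
which see the corners of a truncated solution. First, `p` has no zero in `(0, L/2)`, as otherwise
the truncation of `p` at a zero would be a null vector of the form of `𝓛₂` with a corner. Now let
`v` be an odd solution of `𝓛₁ v = 0`. Then `v` is orthogonal to `p^(2k-1)`, because
`𝓛₁ p = -(2k-2) p^(2k-1)`; and its Wronskian with `p'`, which solves the same equation, shows that
`v'` has opposite signs at `0` and at `L/2`, unless `v = 0`. So `v` has the same sign near both ends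
of `(0, L/2)`. If it kept this sign, it would not be orthogonal to `p^(2k-1)`. Otherwise it has two
zeros `a < b` in `(0, L/2)`, and a combination of its truncations to `[0, a]` and to `[b, L/2]` is a
null vector orthogonal to `p^(2k-1)`; testing against `sin (2 π x / L)` and `sin (4 π x / L)`, which
distinguish the corners at `a` and at `b`, shows that the combination is trivial (`not_two_zeros`).

All functions are handled on `AddCircle L`, a derivative of a function on the circle being meant
along the covering `ℝ → AddCircle L`. Operators on the complex space reduce to real functions by
taking real and imaginary parts.
-/

noncomputable section

namespace PeriodicNLS

set_option linter.unusedSectionVars false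

/-! ### Symmetric operators that are bounded perturbations of an operator with compact inverse -/

section Abstract

variable {𝕜 : Type*} [RCLike 𝕜] {H : Type*} [NormedAddCommGroup H] [InnerProductSpace 𝕜 H]

/-- `A = D + B` with `B` bounded and `D` invertible with compact inverse `K`, written without
reference to `D`. -/
structure IsPerturbationOfCompactInverse (A : H →ₗ.[𝕜] H) (K B : H →L[𝕜] H) : Prop where
  compact : IsCompactOperator K
  right_inv : ∀ y : H, ∃ h : K y ∈ A.domain, A ⟨K y, h⟩ = y + B (K y)
  left_inv : ∀ x : A.domain, K (A x - B x) = x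

/-- The (unbounded) operator `A` is symmetric on its domain. -/
def IsSymm (A : H →ₗ.[𝕜] H) : Prop :=
  ∀ x y : A.domain, inner 𝕜 (A x) (y : H) = inner 𝕜 (x : H) (A y)

variable {A : H →ₗ.[𝕜] H} {K B : H →L[𝕜] H}

theorem IsEigenvalue.exists_unit {z : 𝕜} (h : IsEigenvalue A z) :
    ∃ x : A.domain, ‖(x : H)‖ = 1 ∧ A x = z • (x : H) := by
  obtain ⟨u, hu, hu0⟩ := (Submodule.ne_bot_iff _).1 h
  have hn : ‖((‖u‖⁻¹ : ℝ) : 𝕜) • u‖ = 1 := by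
    rw [norm_smul, RCLike.norm_ofReal, abs_of_nonneg (by positivity),
      inv_mul_cancel₀ (norm_ne_zero_iff.2 hu0)]
  obtain ⟨h1, h2⟩ := (eigenspace A z).smul_mem ((‖u‖⁻¹ : ℝ) : 𝕜) hu
  exact ⟨⟨_, h1⟩, hn, h2⟩

/-- The equation `A u = z u` implies the fixed point equation `u = K (z - B) u`. -/
theorem eigenspace_le_eigenspace_comp (hA : IsPerturbationOfCompactInverse A K B) (z : 𝕜) :
    eigenspace A z ≤
      Module.End.eigenspace (K.comp (z • ContinuousLinearMap.id 𝕜 H - B) : H →L[𝕜] H).toLinearMap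
        1 := by
  rintro u ⟨hu, e⟩
  have := hA.left_inv ⟨u, hu⟩
  rw [e] at this
  rw [Module.End.mem_eigenspace_iff]
  simpa using this

theorem finiteDimensional_eigenspace [CompleteSpace H]
    (hA : IsPerturbationOfCompactInverse A K B) (z : 𝕜) :
    FiniteDimensional 𝕜 (eigenspace A z) := by
  have hc : IsCompactOperator (K.comp (z • ContinuousLinearMap.id 𝕜 H - B) : H →L[𝕜] H) :=
    hA.compact.comp_clm _
  have := ContinuousLinearMap.finite_dimensional_eigenspace hc 1 one_ne_zero
  exact Submodule.finiteDimensional_of_le (eigenspace_le_eigenspace_comp hA z)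

/-- Fredholm alternative: a point which is not an eigenvalue is in the resolvent set. -/
theorem isEigenvalue_of_mem_opSpectrum [CompleteSpace H]
    (hA : IsPerturbationOfCompactInverse A K B) {z : 𝕜} (hz : z ∈ opSpectrum A) :
    IsEigenvalue A z := by
  by_contra hne
  have hbot : eigenspace A z = ⊥ := not_not.1 hne
  apply hz
  -- `A - z = (1 + (B - z) K) D`, and `(B - z) K` is compact
  set T : H →L[𝕜] H := (z • ContinuousLinearMap.id 𝕜 H - B).comp K with hT
  have hTc : IsCompactOperator T :=
    hA.compact.clm_comp (z • ContinuousLinearMap.id 𝕜 H - B)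
  have hTa : ∀ y, T y = z • K y - B (K y) := fun y => by simp [hT]
  rcases hTc.hasEigenvalue_or_mem_resolventSet (one_ne_zero (α := 𝕜)) with h1 | h1
  · exfalso
    obtain ⟨y, hy⟩ := h1.exists_hasEigenvector
    have hy1 : T y = y := by simpa using hy.apply_eq_smul
    obtain ⟨hd, e⟩ := hA.right_inv y
    have hmem : K y ∈ eigenspace A z := by
      refine ⟨hd, ?_⟩
      rw [e]
      nth_rewrite 1 [← hy1]
      rw [hTa, sub_add_cancel]
    rw [hbot, Submodule.mem_bot] at hmem
    apply hy.2
    rw [← hy1, hTa, hmem]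
    simp
  · rw [spectrum.mem_resolventSet_iff, map_one] at h1
    obtain ⟨U, hU⟩ := h1
    set S : H →L[𝕜] H := ((U⁻¹ : (H →L[𝕜] H)ˣ) : H →L[𝕜] H) with hS
    have h2 : ∀ y, S y - T (S y) = y := by
      intro y
      have := congrArg (fun W : H →L[𝕜] H => W y) U.mul_inv
      simpa [hU] using this
    have h3 : ∀ y, S (y - T y) = y := by
      intro y
      have := congrArg (fun W : H →L[𝕜] H => W y) U.inv_mul
      simpa [hU] using this
    refine ⟨K.comp S, fun y => ?_, fun x => ?_⟩
    · obtain ⟨hd, e⟩ := hA.right_inv (S y)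
      refine ⟨hd, ?_⟩
      change A ⟨K (S y), hd⟩ - z • K (S y) = y
      have h4 := h2 y
      rw [hTa] at h4
      rw [e]
      refine Eq.trans ?_ h4
      abel
    · have hx := hA.left_inv x
      set w := A x - B x with hw
      have : A x - z • (x : H) = w - T w := by
        rw [hTa, hx, hw]
        abel
      rw [this, ContinuousLinearMap.comp_apply, h3, hx]

/-- The eigenvalues of a symmetric operator are real. -/
theorem IsSymm.eigenvalue_eq_re (hs : IsSymm A) {z : 𝕜} (hz : IsEigenvalue A z) :
    z = (RCLike.re z : 𝕜) := by
  obtain ⟨x, hx, e⟩ := hz.exists_unit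
  have h := hs x x
  rw [e, inner_smul_left, inner_smul_right, inner_self_eq_norm_sq_to_K, hx] at h
  simp only [map_one, one_pow, mul_one] at h
  exact (RCLike.conj_eq_iff_re.1 h).symm

theorem IsSymm.inner_eq_zero (hs : IsSymm A) {r s : ℝ} (hrs : r ≠ s) {x y : A.domain}
    (hx : A x = (r : 𝕜) • (x : H)) (hy : A y = (s : 𝕜) • (y : H)) :
    inner 𝕜 (x : H) (y : H) = 0 := by
  have h := hs x y
  rw [hx, hy, inner_smul_left, inner_smul_right, RCLike.conj_ofReal, ← sub_eq_zero, ← sub_mul]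
    at h
  refine (mul_eq_zero.1 h).resolve_left ?_
  rw [← RCLike.ofReal_sub]
  exact RCLike.ofReal_ne_zero.2 (sub_ne_zero.2 hrs)

/-- The spectrum has no finite accumulation point: eigenvectors `u = K ((z - B) u)` with bounded
eigenvalues `z` lie in a compact set, which contains no infinite orthonormal family. -/
theorem finite_opSpectrum_inter_closedBall [CompleteSpace H]
    (hA : IsPerturbationOfCompactInverse A K B) (hs : IsSymm A) (R : ℝ) :
    (opSpectrum A ∩ Metric.closedBall 0 R).Finite := by
  by_contra hinf
  set f := Set.Infinite.natEmbedding _ hinf with hf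
  have hev : ∀ n, IsEigenvalue A (f n : 𝕜) := fun n =>
    isEigenvalue_of_mem_opSpectrum hA (f n).2.1
  choose u hu1 hu2 using fun n => (hev n).exists_unit
  have hre : ∀ n, (f n : 𝕜) = (RCLike.re (f n : 𝕜) : 𝕜) := fun n => hs.eigenvalue_eq_re (hev n)
  have horth : ∀ m n, m ≠ n → inner 𝕜 (u m : H) (u n : H) = 0 := by
    intro m n hmn
    refine hs.inner_eq_zero (r := RCLike.re (f m : 𝕜)) (s := RCLike.re (f n : 𝕜)) ?_
      ((hre m) ▸ hu2 m) ((hre n) ▸ hu2 n)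
    intro h
    apply hmn
    apply f.injective
    apply Subtype.ext
    rw [hre m, hre n, h]
  have hdist : ∀ m n, m ≠ n → 1 ≤ ‖(u m : H) - u n‖ := by
    intro m n hmn
    have h := norm_sub_sq (𝕜 := 𝕜) (u m : H) (u n)
    rw [horth m n hmn, hu1, hu1] at h
    simp only [map_zero, mul_zero, sub_zero] at h
    nlinarith [norm_nonneg ((u m : H) - u n)]
  obtain ⟨C, hC, hCs⟩ := hA.compact.image_closedBall_subset_compact
    (f := K.toLinearMap) (R + ‖B‖)
  have hmem : ∀ n, (u n : H) ∈ C := by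
    intro n
    apply hCs
    refine ⟨A (u n) - B (u n), ?_, hA.left_inv (u n)⟩
    rw [mem_closedBall_zero_iff]
    refine (norm_sub_le _ _).trans (add_le_add ?_ ?_)
    · rw [hu2, norm_smul, hu1, mul_one]
      exact mem_closedBall_zero_iff.1 (f n).2.2
    · have := B.le_opNorm (u n : H)
      rwa [hu1, mul_one] at this
  obtain ⟨a, -, ψ, hψ, hlim⟩ := hC.tendsto_subseq hmem
  have hcau := hlim.cauchySeq
  rw [Metric.cauchySeq_iff'] at hcau
  obtain ⟨N, hN⟩ := hcau 1 one_pos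
  have h1 := hN (N + 1) (Nat.le_succ N)
  rw [dist_eq_norm] at h1
  exact absurd h1 (not_lt.2 (hdist _ _ (hψ.injective.ne (Nat.succ_ne_self N))))

/-- If the quadratic form of a symmetric operator is bounded below and negative somewhere, then
there is a negative eigenvalue: the infimum of the Rayleigh quotient is in the spectrum. -/
theorem exists_neg_eigenvalue [CompleteSpace H]
    (hA : IsPerturbationOfCompactInverse A K B) (hs : IsSymm A) {M : ℝ}
    (hM : ∀ x : A.domain, M * ‖(x : H)‖ ^ 2 ≤ RCLike.re (inner 𝕜 (A x) (x : H)))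
    {x₀ : A.domain} (hx₀ : RCLike.re (inner 𝕜 (A x₀) (x₀ : H)) < 0) :
    ∃ lam : ℝ, lam < 0 ∧ IsEigenvalue A (lam : 𝕜) := by
  have hne : (x₀ : H) ≠ 0 := by
    intro h
    rw [h, inner_zero_right, map_zero] at hx₀
    exact lt_irrefl _ hx₀
  -- `lam` is the largest lower bound of the Rayleigh quotient
  set S : Set ℝ := {c | ∀ x : A.domain, c * ‖(x : H)‖ ^ 2 ≤ RCLike.re (inner 𝕜 (A x) (x : H))}
    with hS
  have hpos : 0 < ‖(x₀ : H)‖ ^ 2 := by positivity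
  have hub : ∀ c ∈ S, c ≤ RCLike.re (inner 𝕜 (A x₀) (x₀ : H)) / ‖(x₀ : H)‖ ^ 2 := by
    intro c hc
    rw [le_div_iff₀ hpos]
    exact hc x₀
  have hbdd : BddAbove S := ⟨_, hub⟩
  have hSne : S.Nonempty := ⟨M, hM⟩
  set lam := sSup S with hlam
  have hlamS : lam ∈ S := by
    intro x
    by_cases hx : (x : H) = 0
    · simp [hx]
    · have hp : 0 < ‖(x : H)‖ ^ 2 := by positivity
      rw [← le_div_iff₀ hp]
      refine csSup_le hSne fun c hc => ?_
      rw [le_div_iff₀ hp]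
      exact hc x
  refine ⟨lam, (hub _ hlamS).trans_lt (div_neg_of_neg_of_pos hx₀ hpos), ?_⟩
  apply isEigenvalue_of_mem_opSpectrum hA
  rintro ⟨R, hR1, hR2⟩
  -- a bounded inverse of `A - lam` would make `lam + 1 / (‖R‖ + 1)` a lower bound
  have hR0 : 0 < ‖R‖ + 1 := by positivity
  set t : ℝ := (‖R‖ + 1)⁻¹ with ht
  have ht0 : 0 < t := inv_pos.2 hR0
  -- this follows from the lower bound `lam` at the vector `x - t R x`
  have key : lam + t ∈ S := by
    intro x
    obtain ⟨hd, e⟩ := hR1 (x : H)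
    set w : A.domain := ⟨R (x : H), hd⟩ with hw
    have e' : A w = (x : H) + (lam : 𝕜) • R (x : H) := sub_eq_iff_eq_add.1 e
    have h1 := hlamS (x - (t : 𝕜) • w)
    have hc : ((x - (t : 𝕜) • w : A.domain) : H) = (x : H) - (t : 𝕜) • R (x : H) := rfl
    have hAx : A (x - (t : 𝕜) • w) = A x - (t : 𝕜) • A w := by
      rw [LinearPMap.map_sub, LinearPMap.map_smul]
    have hsym := hs x w
    rw [e'] at hsym
    change inner 𝕜 (A x) (R (x : H)) = _ at hsym
    have hRx : ‖inner 𝕜 (x : H) (R (x : H))‖ ≤ ‖R‖ * ‖(x : H)‖ ^ 2 := by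
      refine (norm_inner_le_norm _ _).trans ?_
      have := R.le_opNorm (x : H)
      nlinarith [norm_nonneg (x : H)]
    have hre : RCLike.re (inner 𝕜 (x : H) (R (x : H))) ≤ ‖R‖ * ‖(x : H)‖ ^ 2 :=
      (RCLike.re_le_norm _).trans hRx
    have hnorm := norm_sub_sq (𝕜 := 𝕜) (x : H) ((t : 𝕜) • R (x : H))
    have hcross : RCLike.re (inner 𝕜 (R (x : H)) (x : H)) =
        RCLike.re (inner 𝕜 (x : H) (R (x : H))) := inner_re_symm _ _
    have hxx : RCLike.re (inner 𝕜 (x : H) (x : H)) = ‖(x : H)‖ ^ 2 := inner_self_eq_norm_sq _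
    have hRR : RCLike.re (inner 𝕜 (R (x : H)) (R (x : H))) = ‖R (x : H)‖ ^ 2 :=
      inner_self_eq_norm_sq _
    rw [hc, hAx, e', hnorm] at h1
    simp only [inner_sub_left, inner_sub_right, inner_add_left, inner_add_right, inner_smul_left,
      inner_smul_right, norm_smul, map_sub, map_add, RCLike.conj_ofReal, RCLike.re_ofReal_mul,
      RCLike.norm_ofReal, hsym, hcross, hxx, hRR, mul_pow, sq_abs] at h1
    have ht1 : t * (‖R‖ + 1) = 1 := inv_mul_cancel₀ hR0.ne'
    have h5 : t ^ 2 * (‖R‖ * ‖(x : H)‖ ^ 2) = t * ‖(x : H)‖ ^ 2 - t ^ 2 * ‖(x : H)‖ ^ 2 := by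
      linear_combination (t * ‖(x : H)‖ ^ 2) * ht1
    nlinarith [mul_le_mul_of_nonneg_left hre (sq_nonneg t), sq_nonneg (t * ‖(x : H)‖)]
  have := le_csSup hbdd key
  linarith

/-- If the quadratic form is nonnegative on the kernel of one functional, then a negative
eigenvalue is simple and the only one. -/
theorem finrank_eq_one_and_unique_of_nonneg_on_ker
    (hs : IsSymm A) (ℓ : H →ₗ[𝕜] 𝕜)
    (hℓ : ∀ x : A.domain, ℓ x = 0 → 0 ≤ RCLike.re (inner 𝕜 (A x) (x : H)))
    {r : ℝ} (hr : r < 0) (hev : IsEigenvalue A (r : 𝕜)) :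
    Module.finrank 𝕜 (eigenspace A (r : 𝕜)) = 1 ∧
      ∀ s : ℝ, s < 0 → IsEigenvalue A (s : 𝕜) → s = r := by
  have hker : ∀ t : ℝ, t < 0 → ∀ x : A.domain, A x = (t : 𝕜) • (x : H) → ℓ x = 0 →
      (x : H) = 0 := by
    intro t ht x hx h0
    have h := hℓ x h0
    rw [hx, inner_smul_left, RCLike.conj_ofReal, RCLike.re_ofReal_mul,
      inner_self_eq_norm_sq] at h
    by_contra hne
    have : 0 < ‖(x : H)‖ ^ 2 := by positivity
    nlinarith
  obtain ⟨u, hu1, hu2⟩ := hev.exists_unit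
  have hu0 : (u : H) ≠ 0 := by
    intro h
    rw [h, norm_zero] at hu1
    exact zero_ne_one hu1
  have hℓu : ℓ u ≠ 0 := fun h => hu0 (hker r hr u hu2 h)
  refine ⟨?_, fun s hs0 hsev => ?_⟩
  · refine finrank_eq_one (⟨u, u.2, hu2⟩ : eigenspace A (r : 𝕜))
      (fun h => hu0 (congrArg Subtype.val h)) ?_
    rintro ⟨w, hw⟩
    refine ⟨ℓ w / ℓ u, Subtype.ext ?_⟩
    change (ℓ w / ℓ u) • (u : H) = w
    have hmem : w - (ℓ w / ℓ u) • (u : H) ∈ eigenspace A (r : 𝕜) :=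
      sub_mem hw (Submodule.smul_mem _ _ ⟨u.2, hu2⟩)
    obtain ⟨h1, h2⟩ := hmem
    have := hker r hr ⟨_, h1⟩ h2 (by simp [div_mul_cancel₀ _ hℓu])
    exact (sub_eq_zero.1 this).symm
  · by_contra hsr
    obtain ⟨v, hv1, hv2⟩ := hsev.exists_unit
    have horth := hs.inner_eq_zero hsr hv2 hu2
    have horth' : inner 𝕜 (u : H) (v : H) = 0 := inner_eq_zero_symm.1 horth
    -- the combination of the two eigenvectors which lies in the kernel of the functional
    set x : A.domain := v - (ℓ v / ℓ u) • u with hx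
    have hxH : (x : H) = (v : H) - (ℓ v / ℓ u) • (u : H) := rfl
    have h := hℓ x (by rw [hxH]; simp [div_mul_cancel₀ _ hℓu])
    have hAx : A x = (s : 𝕜) • (v : H) - (ℓ v / ℓ u) • (r : 𝕜) • (u : H) := by
      rw [hx, LinearPMap.map_sub, LinearPMap.map_smul, hv2, hu2]
    have e : RCLike.re (inner 𝕜 (A x) (x : H)) = s + r * ‖ℓ v / ℓ u‖ ^ 2 := by
      rw [hAx, hxH]
      generalize ℓ v / ℓ u = c
      have huu : RCLike.re (inner 𝕜 (u : H) (u : H)) = 1 := by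
        rw [inner_self_eq_norm_sq, hu1, one_pow]
      have hvv : RCLike.re (inner 𝕜 (v : H) (v : H)) = 1 := by
        rw [inner_self_eq_norm_sq, hv1, one_pow]
      have h1 : inner 𝕜 ((s : 𝕜) • (v : H) - c • (r : 𝕜) • (u : H)) ((v : H) - c • (u : H)) =
          ((s : ℝ) : 𝕜) * inner 𝕜 (v : H) (v : H) +
            ((r * ‖c‖ ^ 2 : ℝ) : 𝕜) * inner 𝕜 (u : H) (u : H) := by
        simp only [inner_sub_left, inner_sub_right, inner_smul_left, inner_smul_right, horth,
          horth', RCLike.conj_ofReal]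
        push_cast
        rw [← RCLike.mul_conj]
        ring
      rw [h1, map_add, RCLike.re_ofReal_mul, RCLike.re_ofReal_mul, huu, hvv, mul_one, mul_one]
    nlinarith [sq_nonneg ‖ℓ v / ℓ u‖]

end Abstract

/-! ### Primitives and weak derivatives on the circle -/

section Primitives

variable {𝕜 : Type*} [RCLike 𝕜] {L : ℝ} [Fact (0 < L)]

theorem intervalIntegrable_coe {g : AddCircle L → 𝕜} (hg : Integrable g volume) (a b : ℝ) :
    IntervalIntegrable (fun t : ℝ => g t) volume a b := by
  have hL : 0 < L := Fact.out
  have hp : Function.Periodic (fun t : ℝ => g t) L := fun t => by simp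
  refine hp.intervalIntegrable (t := 0) hL.ne' ?_ a b
  rw [intervalIntegrable_iff_integrableOn_Ioc_of_le (by linarith)]
  exact (AddCircle.measurePreserving_mk L 0).integrable_comp_of_integrable hg

theorem ae_coe_real {p : AddCircle L → Prop} (h : ∀ᵐ x : AddCircle L, p x) :
    ∀ᵐ t : ℝ, p t := by
  have hL : 0 < L := Fact.out
  have h1 : ∀ n : ℤ, ∀ᵐ t : ℝ, t ∈ Set.Ioc (n • L) (n • L + L) → p t := fun n =>
    (ae_restrict_iff' measurableSet_Ioc).1
      ((AddCircle.measurePreserving_mk L (n • L)).quasiMeasurePreserving.ae h)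
  filter_upwards [ae_all_iff.2 h1] with t ht
  have hu := iUnion_Ioc_zsmul hL
  have : t ∈ ⋃ n : ℤ, Set.Ioc (n • L) ((n + 1) • L) := by rw [hu]; trivial
  obtain ⟨n, hn⟩ := Set.mem_iUnion.1 this
  refine ht n ?_
  rwa [add_smul, one_smul] at hn

/-- `f` is a primitive of `g` on the circle: the increments of `f` along the covering
`ℝ → AddCircle L` are the integrals of `g`. -/
def IsPrimitive (f g : AddCircle L → 𝕜) : Prop :=
  ∀ x y : ℝ, f y - f x = ∫ t in x..y, g t

theorem IsPrimitive.congr {f g g' : AddCircle L → 𝕜} (h : IsPrimitive f g)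
    (e : g =ᵐ[volume] g') : IsPrimitive f g' := by
  intro x y
  rw [h x y]
  refine intervalIntegral.integral_congr_ae ?_
  filter_upwards [ae_coe_real e] with t ht _ using ht

theorem IsPrimitive.eq_add_integral {f g : AddCircle L → 𝕜} (h : IsPrimitive f g) :
    (fun x : ℝ => f x) = fun x : ℝ => f (0 : ℝ) + ∫ t in 0..x, g t := by
  funext x
  rw [← h 0 x]
  simp

theorem IsPrimitive.continuous {f g : AddCircle L → 𝕜} (h : IsPrimitive f g)
    (hg : Integrable g volume) : Continuous f := by
  have hq : Topology.IsQuotientMap (fun x : ℝ => (x : AddCircle L)) := isQuotientMap_quot_mk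
  refine hq.continuous_iff.2 ?_
  change Continuous (fun x : ℝ => f x)
  rw [h.eq_add_integral]
  exact continuous_const.add
    (intervalIntegral.continuous_primitive (fun a b => intervalIntegrable_coe hg a b) 0)

theorem IsPrimitive.hasDerivAt {f g : AddCircle L → 𝕜} (h : IsPrimitive f g)
    (hg : Continuous g) (x : ℝ) : HasDerivAt (fun y : ℝ => f y) (g x) x := by
  have hc : Continuous (fun t : ℝ => g t) := hg.comp (AddCircle.continuous_mk' L)
  rw [h.eq_add_integral]
  exact (intervalIntegral.integral_hasDerivAt_right (hc.intervalIntegrable _ _)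
    (hc.stronglyMeasurableAtFilter _ _) hc.continuousAt).const_add _

theorem isPrimitive_of_hasDerivAt {f g : AddCircle L → 𝕜} (hg : Continuous g)
    (h : ∀ x : ℝ, HasDerivAt (fun y : ℝ => f y) (g x) x) : IsPrimitive f g := by
  intro x y
  have hc : Continuous (fun t : ℝ => g t) := hg.comp (AddCircle.continuous_mk' L)
  exact (intervalIntegral.integral_eq_sub_of_hasDerivAt (fun t _ => h t)
    (hc.intervalIntegrable _ _)).symm

/-- The increments of a primitive of `g` are dominated by those of a primitive of `‖g‖`, for which
absolute continuity is known. -/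
theorem absolutelyContinuousOnInterval_integral {g : ℝ → 𝕜}
    (hg : ∀ a b, IntervalIntegrable g volume a b) (c a b : ℝ) :
    AbsolutelyContinuousOnInterval (fun x => ∫ t in c..x, g t) a b := by
  have hr := (hg a b).norm.absolutelyContinuousOnInterval_intervalIntegral
    (c := a) Set.left_mem_uIcc
  unfold AbsolutelyContinuousOnInterval at hr ⊢
  refine squeeze_zero (fun t => Finset.sum_nonneg fun i _ => dist_nonneg) (fun t => ?_) hr
  refine Finset.sum_le_sum fun i _ => ?_
  rw [dist_comm, dist_eq_norm, dist_comm, dist_eq_norm,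
    intervalIntegral.integral_interval_sub_left (hg _ _).norm (hg _ _).norm,
    intervalIntegral.integral_interval_sub_left (hg _ _) (hg _ _), Real.norm_eq_abs]
  exact intervalIntegral.norm_integral_le_abs_integral_norm

theorem IsPrimitive.absolutelyContinuousOnInterval {f g : AddCircle L → 𝕜} (h : IsPrimitive f g)
    (hg : Integrable g volume) (a b : ℝ) :
    AbsolutelyContinuousOnInterval (fun x : ℝ => f x) a b := by
  have h0 : AbsolutelyContinuousOnInterval (fun _ : ℝ => f (0 : ℝ)) a b :=
    (contDiff_const.contDiffOn (n := 1)).absolutelyContinuousOnInterval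
  rw [h.eq_add_integral]
  exact h0.add (absolutelyContinuousOnInterval_integral
    (fun a b => intervalIntegrable_coe hg a b) 0 a b)

/-- Integration by parts on the circle. -/
theorem IsPrimitive.integral_mul_add_mul {f f' g g' : AddCircle L → 𝕜} (hf : IsPrimitive f f')
    (hg : IsPrimitive g g') (hf' : Integrable f' volume) (hg' : Integrable g' volume) :
    ∫ x, (f' x * g x + f x * g' x) = 0 := by
  have hL : 0 < L := Fact.out
  have hcf := hf.continuous hf'
  have hcg := hg.continuous hg'
  have hi : Integrable (fun x => f' x * g x + f x * g' x) volume := by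
    obtain ⟨C, hC⟩ := isCompact_univ.exists_bound_of_continuousOn hcf.continuousOn
    obtain ⟨D, hD⟩ := isCompact_univ.exists_bound_of_continuousOn hcg.continuousOn
    exact (hf'.mul_bdd hcg.aestronglyMeasurable
      (Filter.Eventually.of_forall fun x => hD x trivial)).add
      (hg'.bdd_mul hcf.aestronglyMeasurable
      (Filter.Eventually.of_forall fun x => hC x trivial))
  set I : ℝ → 𝕜 := fun x => ∫ t in 0..x, (f' t * g t + f t * g' t) with hI
  -- the integrand is almost everywhere the derivative of the absolutely continuous `f g`
  have hIac : AbsolutelyContinuousOnInterval I 0 L :=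
    absolutelyContinuousOnInterval_integral (fun a b => intervalIntegrable_coe hi a b) 0 0 L
  have hac : AbsolutelyContinuousOnInterval (fun x : ℝ => f x * g x - I x) 0 L :=
    ((hf.absolutelyContinuousOnInterval hf' 0 L).smul
      (hg.absolutelyContinuousOnInterval hg' 0 L)).sub hIac
  have hder : ∀ {u u' : AddCircle L → 𝕜}, IsPrimitive u u' → Integrable u' volume →
      ∀ᵐ x : ℝ, x ∈ Set.uIcc 0 L → HasDerivAt (fun y : ℝ => u y) (u' x) x := by
    intro u u' hu hu'
    filter_upwards [(intervalIntegrable_coe hu' 0 L).ae_hasDerivAt_integral] with x hx hx'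
    rw [hu.eq_add_integral]
    exact (hx hx' 0 Set.left_mem_uIcc).const_add _
  obtain ⟨C, hC⟩ := hac.const_of_ae_hasDerivAt_zero (by
    filter_upwards [hder hf hf', hder hg hg',
      (intervalIntegrable_coe hi 0 L).ae_hasDerivAt_integral] with x h1 h2 h3 hx
    have := ((h1 hx).mul (h2 hx)).sub (h3 hx 0 Set.left_mem_uIcc)
    rw [sub_self] at this
    exact this)
  have h0 := hC 0 Set.left_mem_uIcc
  have h1 := hC L Set.right_mem_uIcc
  have hIL : I L = ∫ x, (f' x * g x + f x * g' x) := by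
    have := AddCircle.intervalIntegral_preimage L 0 (fun x => f' x * g x + f x * g' x)
    rwa [zero_add] at this
  have hI0 : I 0 = 0 := intervalIntegral.integral_same
  have hfL : ((L : ℝ) : AddCircle L) = ((0 : ℝ) : AddCircle L) := by simp
  simp only [hfL] at h1
  rw [← hIL]
  linear_combination (-1 : 𝕜) * h1 + h0 + hI0

theorem IsTestPair.isPrimitive {ψ ψ' : AddCircle L → ℝ} (h : IsTestPair ψ ψ') :
    IsPrimitive (fun x => (ψ x : 𝕜)) (fun x => (ψ' x : 𝕜)) :=
  isPrimitive_of_hasDerivAt (RCLike.continuous_ofReal.comp h.continuous.2)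
    fun x => by
      have := ((RCLike.ofRealCLM (K := 𝕜)).hasFDerivAt (x := ψ x)).comp_hasDerivAt x (h.2 x)
      exact this

theorem IsPrimitive.add {f f' g g' : AddCircle L → 𝕜} (hf : IsPrimitive f f')
    (hg : IsPrimitive g g') (hf' : Integrable f' volume) (hg' : Integrable g' volume) :
    IsPrimitive (f + g) (f' + g') := by
  intro x y
  simp only [Pi.add_apply]
  rw [intervalIntegral.integral_add (intervalIntegrable_coe hf' _ _)
    (intervalIntegrable_coe hg' _ _), ← hf, ← hg]
  ring

theorem IsPrimitive.const_smul {f f' : AddCircle L → 𝕜} (c : 𝕜) (hf : IsPrimitive f f') :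
    IsPrimitive (c • f) (c • f') := by
  intro x y
  simp only [Pi.smul_apply]
  rw [intervalIntegral.integral_smul, ← hf, smul_sub]

theorem IsPrimitive.add_const {f f' : AddCircle L → 𝕜} (c : 𝕜) (hf : IsPrimitive f f') :
    IsPrimitive (fun x => f x + c) f' := by
  intro x y
  rw [← hf x y]
  ring

theorem IsPrimitive.eq_of_apply_zero {f g f' : AddCircle L → 𝕜} (hf : IsPrimitive f f')
    (hg : IsPrimitive g f') (h0 : f 0 = g 0) : f = g := by
  funext x
  induction x using QuotientAddGroup.induction_on with
  | H x =>
    have h := (hf 0 x).trans (hg 0 x).symm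
    have hz : ((0 : ℝ) : AddCircle L) = 0 := rfl
    rw [hz, h0] at h
    exact sub_left_injective h

theorem exists_isPrimitive {g : AddCircle L → 𝕜} (hg : Integrable g volume)
    (h0 : ∫ x, g x = 0) : ∃ f : AddCircle L → 𝕜, IsPrimitive f g ∧ f 0 = 0 := by
  have hi := fun a b => intervalIntegrable_coe hg a b
  have hp : Function.Periodic (fun x : ℝ => ∫ t in 0..x, g t) L := by
    intro x
    have := AddCircle.intervalIntegral_preimage L x g
    rw [h0] at this
    change ∫ t in 0..x + L, g t = ∫ t in 0..x, g t
    rw [← intervalIntegral.integral_add_adjacent_intervals (hi 0 x) (hi x (x + L)), this, add_zero]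
  refine ⟨hp.lift, fun x y => ?_, ?_⟩
  · rw [Function.Periodic.lift_coe, Function.Periodic.lift_coe,
      intervalIntegral.integral_interval_sub_left (hi _ _) (hi _ _)]
  · exact (hp.lift_coe 0).trans intervalIntegral.integral_same

theorem memLp_of_continuous {f : AddCircle L → 𝕜} (hf : Continuous f) (p : ENNReal) :
    MemLp f p volume := by
  obtain ⟨C, hC⟩ := isCompact_univ.exists_bound_of_continuousOn hf.continuousOn
  exact MemLp.of_bound hf.aestronglyMeasurable C (Filter.Eventually.of_forall fun x => hC x trivial)

theorem integrable_of_memLp_two {f : AddCircle L → 𝕜} (hf : MemLp f 2 volume) :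
    Integrable f volume :=
  hf.integrable (by norm_num)

theorem integrable_mul_of_memLp_two {f g : AddCircle L → 𝕜} (hf : MemLp f 2 volume)
    (hg : MemLp g 2 volume) : Integrable (fun x => f x * g x) volume :=
  hf.integrable_mul hg

theorem IsPrimitive.hasWeakDeriv {f g : AddCircle L → 𝕜} (h : IsPrimitive f g)
    (hg : MemLp g 2 volume) : HasWeakDeriv f g := by
  intro ψ ψ' hψ
  have hi := integrable_of_memLp_two hg
  have hf := memLp_of_continuous (h.continuous hi) 2
  have hc := hψ.continuous
  have hψ' : Integrable (fun x => (ψ' x : 𝕜)) volume := integrable_of_memLp_two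
    (memLp_of_continuous (RCLike.continuous_ofReal.comp hc.2) 2)
  have := (hψ.isPrimitive (𝕜 := 𝕜)).integral_mul_add_mul h hψ' hi
  rw [integral_add (integrable_mul hc.2 hf) (integrable_mul hc.1 hg)] at this
  exact eq_neg_of_add_eq_zero_left this

theorem volume_real_univ_circle : (volume : Measure (AddCircle L)).real Set.univ = L := by
  have hL : 0 < L := Fact.out
  rw [measureReal_def, AddCircle.measure_univ, ENNReal.toReal_ofReal hL.le]

theorem integral_const_circle (c : 𝕜) : ∫ _ : AddCircle L, c = (L : 𝕜) * c := by
  rw [integral_const, volume_real_univ_circle, RCLike.real_smul_eq_coe_mul]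

theorem HasWeakDeriv.integral_eq_zero {f g : AddCircle L → 𝕜} (h : HasWeakDeriv f g) :
    ∫ x, g x = 0 := by
  have ht : IsTestPair (L := L) (fun _ => 1) (fun _ => 0) :=
    ⟨contDiff_const, fun x => hasDerivAt_const _ _⟩
  have := h _ _ ht
  simpa using this.symm

/-- A function with vanishing weak derivative is constant: every test function is, up to its mean,
the derivative of a test function. -/
theorem HasWeakDeriv.ae_eq_const {f : AddCircle L → 𝕜} (hf : MemLp f 2 volume)
    (h : HasWeakDeriv f 0) : ∃ c : 𝕜, f =ᵐ[volume] fun _ => c := by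
  have hL : 0 < L := Fact.out
  have hL' : (L : 𝕜) ≠ 0 := RCLike.ofReal_ne_zero.2 hL.ne'
  set m : 𝕜 := (L : 𝕜)⁻¹ * ∫ x, f x with hm
  refine ⟨m, ?_⟩
  have hd : MemLp (fun x => f x - m) 2 volume := hf.sub (memLp_const m)
  have key : HasWeakDeriv (0 : AddCircle L → 𝕜) (fun x => f x - m) := by
    intro ψ ψ' hψ
    have hc := hψ.continuous.1
    set μ : ℝ := L⁻¹ * ∫ x, ψ x with hμ
    have hψi : Integrable ψ volume := integrable_of_memLp_two (memLp_of_continuous hc 2)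
    obtain ⟨χ, hχ, -⟩ := exists_isPrimitive (g := fun x => ψ x - μ)
      (hψi.sub (integrable_const μ)) (by
        rw [integral_sub hψi (integrable_const μ), integral_const, volume_real_univ_circle,
          smul_eq_mul, hμ, mul_inv_cancel_left₀ hL.ne', sub_self])
    have hχd := hχ.hasDerivAt (hc.sub continuous_const)
    have ht : IsTestPair χ (fun x => ψ x - μ) := by
      refine ⟨?_, hχd⟩
      rw [contDiff_infty_iff_deriv]
      refine ⟨fun x => (hχd x).differentiableAt, ?_⟩
      rw [show deriv (fun x : ℝ => χ x) = fun x : ℝ => ψ x - μ from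
        funext fun x => (hχd x).deriv]
      exact hψ.1.sub contDiff_const
    have h1 := h χ _ ht
    have hψf := integrable_mul (𝕜 := 𝕜) hc hf
    have hψ1 : Integrable (fun x => (ψ x : 𝕜)) volume := hψi.ofReal
    simp only [Pi.zero_apply, mul_zero, integral_zero, neg_zero, RCLike.ofReal_sub, sub_mul]
      at h1 ⊢
    rw [integral_sub hψf ((integrable_of_memLp_two hf).const_mul _), integral_const_mul] at h1
    simp only [mul_sub]
    rw [integral_sub hψf (hψ1.mul_const m), integral_mul_const, integral_ofReal]
    have h2 : (μ : 𝕜) * ∫ x, f x = ((∫ x, ψ x : ℝ) : 𝕜) * m := by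
      rw [hμ, hm]
      push_cast
      ring
    rw [← h2, h1, neg_zero]
  have hz : HasWeakDeriv (0 : AddCircle L → 𝕜) (0 : AddCircle L → 𝕜) := by
    intro ψ ψ' _
    simp
  filter_upwards [weakDeriv_unique hd MemLp.zero key hz] with x hx
  exact sub_eq_zero.1 hx

/-- A function with square integrable weak derivative agrees almost everywhere with a primitive of
its weak derivative. -/
theorem HasWeakDeriv.exists_isPrimitive {f g : AddCircle L → 𝕜} (hf : MemLp f 2 volume)
    (hg : MemLp g 2 volume) (h : HasWeakDeriv f g) :
    ∃ f₀ : AddCircle L → 𝕜, IsPrimitive f₀ g ∧ f =ᵐ[volume] f₀ := by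
  have hi := integrable_of_memLp_two hg
  obtain ⟨F, hF, -⟩ := PeriodicNLS.exists_isPrimitive hi h.integral_eq_zero
  have hFm := memLp_of_continuous (hF.continuous hi) 2
  have hd : HasWeakDeriv (f + (-1 : 𝕜) • F) 0 := by
    have := HasWeakDeriv.add hf (hFm.const_smul (-1 : 𝕜)) hg (hg.const_smul (-1 : 𝕜)) h
      ((hF.hasWeakDeriv hg).const_smul (-1 : 𝕜))
    rwa [neg_one_smul 𝕜 g, add_neg_cancel] at this
  obtain ⟨c, hc⟩ := hd.ae_eq_const (hf.add (hFm.const_smul (-1 : 𝕜)))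
  refine ⟨fun x => F x + c, hF.add_const c, ?_⟩
  filter_upwards [hc] with x hx
  rw [← hx]
  simp

/-- Integration by parts for square integrable functions with square integrable weak
derivatives. -/
theorem HasWeakDeriv.integral_mul_add_mul {f f' g g' : AddCircle L → 𝕜} (hf : HasWeakDeriv f f')
    (hg : HasWeakDeriv g g') (hf1 : MemLp f 2 volume) (hf' : MemLp f' 2 volume)
    (hg1 : MemLp g 2 volume) (hg' : MemLp g' 2 volume) :
    (∫ x, f' x * g x) + ∫ x, f x * g' x = 0 := by
  obtain ⟨F, hF, eF⟩ := hf.exists_isPrimitive hf1 hf'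
  obtain ⟨G, hG, eG⟩ := hg.exists_isPrimitive hg1 hg'
  rw [← integral_add (integrable_mul_of_memLp_two hf' hg1) (integrable_mul_of_memLp_two hf1 hg'),
    ← hF.integral_mul_add_mul hG (integrable_of_memLp_two hf') (integrable_of_memLp_two hg')]
  refine integral_congr_ae ?_
  filter_upwards [eF, eG] with x h1 h2
  rw [h1, h2]

theorem HasWeakDeriv.unique_congr {f g f' g' : AddCircle L → 𝕜} (hf : HasWeakDeriv f f')
    (hg : HasWeakDeriv g g') (hf' : MemLp f' 2 volume) (hg' : MemLp g' 2 volume)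
    (e : f =ᵐ[volume] g) : f' =ᵐ[volume] g' :=
  weakDeriv_unique hf' hg' (hf.congr e Filter.EventuallyEq.rfl) hg

/-! ### Real and imaginary parts, reflections -/

theorem HasWeakDeriv.comp_clm {𝕜' : Type*} [RCLike 𝕜'] {f g : AddCircle L → 𝕜}
    (h : HasWeakDeriv f g) (hf : MemLp f 2 volume) (hg : MemLp g 2 volume) (T : 𝕜 →L[ℝ] 𝕜') :
    HasWeakDeriv (fun x => T (f x)) (fun x => T (g x)) := by
  intro ψ ψ' hψ
  have e : ∀ {p : AddCircle L → ℝ} {u : AddCircle L → 𝕜}, Continuous p → MemLp u 2 volume →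
      ∫ x, (p x : 𝕜') * T (u x) = T (∫ x, (p x : 𝕜) * u x) := by
    intro p u hp hu
    rw [← T.integral_comp_comm (integrable_mul hp hu)]
    refine integral_congr_ae (Filter.Eventually.of_forall fun x => ?_)
    simp only [← RCLike.real_smul_eq_coe_mul, map_smul]
  rw [e hψ.continuous.2 hf, e hψ.continuous.1 hg, h ψ ψ' hψ, map_neg]

theorem IsTestPair.comp_neg {ψ ψ' : AddCircle L → ℝ} (h : IsTestPair ψ ψ') :
    IsTestPair (fun x => ψ (-x)) (fun x => -ψ' (-x)) := by
  refine ⟨?_, fun x => ?_⟩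
  · exact h.1.comp contDiff_neg
  · have := HasDerivAt.scomp x (h.2 (-x)) (hasDerivAt_neg x)
    simpa using! this

theorem HasWeakDeriv.comp_neg {f g : AddCircle L → 𝕜} (h : HasWeakDeriv f g) :
    HasWeakDeriv (fun x => f (-x)) (fun x => -g (-x)) := by
  intro ψ ψ' hψ
  have h1 := h _ _ hψ.comp_neg
  have e1 := integral_neg_eq_self (fun x => (ψ' x : 𝕜) * f (-x)) volume
  have e2 := integral_neg_eq_self (fun x => (ψ x : 𝕜) * -g (-x)) volume
  simp only [neg_neg] at e1 e2
  rw [← e1, ← e2]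
  simp only [RCLike.ofReal_neg, neg_mul, mul_neg, integral_neg, neg_neg] at h1 ⊢
  exact neg_injective h1

end Primitives

/-! ### The compact integration operator -/

section Antiderivative

variable {𝕜 : Type*} [RCLike 𝕜] {L : ℝ} [Fact (0 < L)]

/-- Every point of the circle has a representative whose absolute value is its norm. -/
theorem exists_coe_eq_abs_eq_norm (z : AddCircle L) :
    ∃ t : ℝ, (t : AddCircle L) = z ∧ |t| = ‖z‖ := by
  have hL : 0 < L := Fact.out
  obtain ⟨⟨t, ht1, ht2⟩, rfl⟩ := (AddCircle.equivIoc L (-(L / 2))).symm.surjective z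
  refine ⟨t, rfl, ?_⟩
  change |t| = ‖(t : AddCircle L)‖
  refine ((AddCircle.norm_coe_eq_abs_iff (p := L) hL.ne').2 ?_).symm
  rw [abs_of_pos hL, abs_le]
  exact ⟨ht1.le, by linarith⟩

/-- The mean value of a function on the circle. -/
def mean (g : AddCircle L → 𝕜) : 𝕜 := (L : 𝕜)⁻¹ * ∫ x, g x

theorem integral_sub_mean {g : AddCircle L → 𝕜} (hg : Integrable g volume) :
    ∫ x, (g x - mean g) = 0 := by
  have hL : 0 < L := Fact.out
  have hL' : (L : 𝕜) ≠ 0 := RCLike.ofReal_ne_zero.2 hL.ne'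
  rw [integral_sub hg (integrable_const _), integral_const_circle, mean, mul_inv_cancel_left₀ hL',
    sub_self]

theorem integrable_Lp (g : L2per 𝕜 L) : Integrable g volume :=
  integrable_of_memLp_two (Lp.memLp g)

theorem exists_antideriv (g : L2per 𝕜 L) :
    ∃ f : AddCircle L → 𝕜, IsPrimitive f (fun x => g x - mean g) ∧ f 0 = 0 :=
  exists_isPrimitive ((integrable_Lp g).sub (integrable_const _))
    (integral_sub_mean (integrable_Lp g))

/-- The primitive of `g - mean g` which vanishes at `0`. -/
def antideriv (g : L2per 𝕜 L) : AddCircle L → 𝕜 := (exists_antideriv g).choose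

theorem isPrimitive_antideriv (g : L2per 𝕜 L) :
    IsPrimitive (antideriv g) (fun x => g x - mean g) := (exists_antideriv g).choose_spec.1

theorem antideriv_zero (g : L2per 𝕜 L) : antideriv g 0 = 0 := (exists_antideriv g).choose_spec.2

theorem memLp_sub_mean (g : L2per 𝕜 L) : MemLp (fun x => g x - mean g) 2 volume :=
  (Lp.memLp g).sub (memLp_const _)

theorem continuous_antideriv (g : L2per 𝕜 L) : Continuous (antideriv g) :=
  (isPrimitive_antideriv g).continuous (integrable_of_memLp_two (memLp_sub_mean g))

theorem mean_congr {f g : AddCircle L → 𝕜} (h : f =ᵐ[volume] g) : mean f = mean g := by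
  rw [mean, mean, integral_congr_ae h]

theorem antideriv_eq {g : L2per 𝕜 L} {f g' : AddCircle L → 𝕜} (hf : IsPrimitive f g')
    (e : (fun x => g x - mean g) =ᵐ[volume] g') (h0 : f 0 = 0) : antideriv g = f :=
  ((isPrimitive_antideriv g).congr e).eq_of_apply_zero hf ((antideriv_zero g).trans h0.symm)

theorem antideriv_add (g h : L2per 𝕜 L) : antideriv (g + h) = antideriv g + antideriv h := by
  refine antideriv_eq ((isPrimitive_antideriv g).add (isPrimitive_antideriv h)
    (integrable_of_memLp_two (memLp_sub_mean g)) (integrable_of_memLp_two (memLp_sub_mean h))) ?_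
    (by simp [antideriv_zero])
  have hm : mean (g + h : L2per 𝕜 L) = mean g + mean h := by
    rw [mean_congr (Lp.coeFn_add g h), mean, mean, mean, ← mul_add,
      ← integral_add (integrable_Lp g) (integrable_Lp h)]
    rfl
  filter_upwards [Lp.coeFn_add g h] with x hx
  rw [hx, hm]
  simp only [Pi.add_apply]
  ring

theorem antideriv_smul (c : 𝕜) (g : L2per 𝕜 L) : antideriv (c • g) = c • antideriv g := by
  refine antideriv_eq ((isPrimitive_antideriv g).const_smul c) ?_ (by simp [antideriv_zero])
  have hm : mean (c • g : L2per 𝕜 L) = c * mean g := by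
    rw [mean_congr (Lp.coeFn_smul c g), mean, mean]
    simp only [Pi.smul_apply, smul_eq_mul]
    rw [integral_const_mul]
    ring
  filter_upwards [Lp.coeFn_smul c g] with x hx
  rw [hx, hm]
  simp only [Pi.smul_apply, smul_eq_mul]
  ring

/-- A primitive of a square integrable function is Hölder continuous of exponent `1 / 2`. The
constant comes from `‖h‖ ≤ s ‖h‖² / 2 + 1 / (2 s)` with `s² = dist x y`. -/
theorem IsPrimitive.norm_sub_le {f h : AddCircle L → 𝕜} (hf : IsPrimitive f h)
    (hh : MemLp h 2 volume) {C : ℝ} (hC : ∫ x, ‖h x‖ ^ 2 ≤ C) (x y : AddCircle L) :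
    ‖f x - f y‖ ≤ (C + 1) / 2 * Real.sqrt (dist x y) := by
  have hL : 0 < L := Fact.out
  have key : ∀ a t : ℝ, 0 < t → t ≤ L → ‖f ((a + t : ℝ) : AddCircle L) - f (a : AddCircle L)‖ ≤
      (C + 1) / 2 * Real.sqrt t := by
    intro a t ht htL
    set s := Real.sqrt t with hs
    have hs0 : 0 < s := Real.sqrt_pos.2 ht
    have hss : s ^ 2 = t := Real.sq_sqrt ht.le
    have hsq : Integrable (fun x => ‖h x‖ ^ 2) volume := hh.integrable_norm_pow (by norm_num)
    have hi := intervalIntegrable_coe hsq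
    rw [hf]
    calc ‖∫ u in a..a + t, h u‖ ≤ ∫ u in a..a + t, ‖h u‖ :=
          intervalIntegral.norm_integral_le_integral_norm (by linarith)
      _ ≤ ∫ u in a..a + t, (s / 2 * ‖h u‖ ^ 2 + 1 / (2 * s)) := by
          refine intervalIntegral.integral_mono_on (by linarith)
            (intervalIntegrable_coe (integrable_of_memLp_two hh) _ _).norm
            (((hi _ _).const_mul _).add intervalIntegrable_const) fun u _ => ?_
          have h1 : s / 2 * ‖h u‖ ^ 2 + 1 / (2 * s) - ‖h u‖ = (s * ‖h u‖ - 1) ^ 2 / (2 * s) := by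
            field_simp
            ring
          have h2 : 0 ≤ (s * ‖h u‖ - 1) ^ 2 / (2 * s) := by positivity
          linarith
      _ = s / 2 * (∫ u in a..a + t, ‖h u‖ ^ 2) + t * (1 / (2 * s)) := by
          rw [intervalIntegral.integral_add ((hi _ _).const_mul _) intervalIntegrable_const,
            intervalIntegral.integral_const_mul, intervalIntegral.integral_const]
          simp
      _ ≤ s / 2 * C + t * (1 / (2 * s)) := by
          have h3 : ∫ u in a..a + t, ‖h u‖ ^ 2 ≤ ∫ u in a..a + L, ‖h u‖ ^ 2 :=
            intervalIntegral.integral_mono_interval le_rfl (by linarith) (by linarith)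
              (Filter.Eventually.of_forall fun u => by positivity) (hi _ _)
          rw [AddCircle.intervalIntegral_preimage L a (fun x => ‖h x‖ ^ 2)] at h3
          have := h3.trans hC
          gcongr
      _ = (C + 1) / 2 * s := by
          rw [← hss]
          field_simp
  obtain ⟨b, rfl⟩ := QuotientAddGroup.mk_surjective y
  obtain ⟨t, ht, ht'⟩ := exists_coe_eq_abs_eq_norm (x - (b : AddCircle L))
  have hx : x = ((b + t : ℝ) : AddCircle L) := by
    rw [AddCircle.coe_add, ht]
    abel
  have htL : |t| ≤ L := by
    rw [ht']
    have := AddCircle.norm_le_half_period L (x := x - (b : AddCircle L)) hL.ne'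
    rw [abs_of_pos hL] at this
    linarith
  change ‖f x - f (b : AddCircle L)‖ ≤ (C + 1) / 2 * Real.sqrt (dist x (b : AddCircle L))
  rw [dist_eq_norm, ← ht', hx]
  rcases lt_trichotomy t 0 with h0 | h0 | h0
  · have := key (b + t) (-t) (by linarith) (by rw [← abs_of_neg h0]; exact htL)
    rw [abs_of_neg h0, norm_sub_rev]
    simpa using this
  · simp [h0]
  · rw [abs_of_pos h0]
    exact key b t h0 (by rw [← abs_of_pos h0]; exact htL)

variable (𝕜 L) in
/-- `antideriv` as a linear map into the continuous functions. -/
def antiderivLM : L2per 𝕜 L →ₗ[𝕜] BoundedContinuousFunction (AddCircle L) 𝕜 where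
  toFun g := BoundedContinuousFunction.mkOfCompact ⟨antideriv g, continuous_antideriv g⟩
  map_add' g h := by
    ext x
    simp [antideriv_add]
  map_smul' c g := by
    ext x
    simp [antideriv_smul]

theorem antiderivLM_apply (g : L2per 𝕜 L) (x : AddCircle L) :
    antiderivLM 𝕜 L g x = antideriv g x := rfl

theorem integral_norm_sq_eq (g : L2per 𝕜 L) : ∫ x, ‖g x‖ ^ 2 = ‖g‖ ^ 2 := by
  have h := inner_self_eq_norm_sq (𝕜 := 𝕜) g
  rw [← h, L2.inner_def]
  simp only [inner_self_eq_norm_sq_to_K]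
  rw [← integral_re (by
    have := (Lp.memLp g).integrable_norm_pow (p := 2) (by norm_num)
    simpa using this.ofReal (𝕜 := 𝕜))]
  refine integral_congr_ae (Filter.Eventually.of_forall fun x => ?_)
  simp only
  rw [← RCLike.ofReal_pow, RCLike.ofReal_re]

theorem exists_bound_sub_mean : ∃ C : ℝ, ∀ g : L2per 𝕜 L, ‖g‖ ≤ 1 →
    ∫ x, ‖g x - mean g‖ ^ 2 ≤ C := by
  have hL : 0 < L := Fact.out
  set c : ℝ := L⁻¹ * (1 + L) with hc
  refine ⟨2 + 2 * c ^ 2 * L, fun g hg => ?_⟩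
  have hsq : Integrable (fun x => ‖g x‖ ^ 2) volume :=
    (Lp.memLp g).integrable_norm_pow (by norm_num)
  have h1 : ∫ x, ‖g x‖ ^ 2 ≤ 1 := by
    rw [integral_norm_sq_eq]
    nlinarith [norm_nonneg g]
  have hm : ‖mean g‖ ≤ c := by
    rw [mean, norm_mul, norm_inv, RCLike.norm_ofReal, abs_of_pos hL, hc]
    gcongr
    calc ‖∫ x, g x‖ ≤ ∫ x, ‖g x‖ := norm_integral_le_integral_norm _
      _ ≤ ∫ x, (‖g x‖ ^ 2 + 1) := by
          refine integral_mono (integrable_Lp g).norm (hsq.add (integrable_const _)) fun x => ?_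
          simp only
          nlinarith [sq_nonneg (‖g x‖ - 1 / 2)]
      _ ≤ 1 + L := by
          rw [integral_add hsq (integrable_const _), integral_const, volume_real_univ_circle]
          simpa using h1
  have h2 := (memLp_sub_mean g).integrable_norm_pow (p := 2) (by norm_num)
  calc ∫ x, ‖g x - mean g‖ ^ 2 ≤ ∫ x, (2 * ‖g x‖ ^ 2 + 2 * c ^ 2) := by
        refine integral_mono h2 ((hsq.const_mul _).add (integrable_const _)) fun x => ?_
        simp only
        have h3 := norm_sub_le (g x) (mean g)
        have h4 := norm_nonneg (g x - mean g)
        have h5 := norm_nonneg (mean g)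
        have h6 : ‖g x - mean g‖ ^ 2 ≤ (‖g x‖ + ‖mean g‖) ^ 2 := by gcongr
        have h7 : ‖mean g‖ ^ 2 ≤ c ^ 2 := by gcongr
        nlinarith [sq_nonneg (‖g x‖ - ‖mean g‖)]
    _ = 2 * (∫ x, ‖g x‖ ^ 2) + L * (2 * c ^ 2) := by
        rw [integral_add (hsq.const_mul _) (integrable_const _), integral_const_mul,
          integral_const, volume_real_univ_circle, smul_eq_mul]
    _ ≤ 2 + 2 * c ^ 2 * L := by linarith

/-- The primitives of the functions in the unit ball are bounded and equicontinuous. -/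
theorem isCompactOperator_antiderivLM : IsCompactOperator (antiderivLM 𝕜 L) := by
  have hL : 0 < L := Fact.out
  obtain ⟨C, hC⟩ := exists_bound_sub_mean (𝕜 := 𝕜) (L := L)
  have hC0 : 0 ≤ C := by
    refine le_trans ?_ (hC 0 (by simp))
    positivity
  have hmod : ∀ g : L2per 𝕜 L, ‖g‖ ≤ 1 → ∀ x y, dist (antideriv g x) (antideriv g y) ≤
      (C + 1) / 2 * Real.sqrt (dist x y) := fun g hg x y => by
    rw [dist_eq_norm]
    exact (isPrimitive_antideriv g).norm_sub_le (memLp_sub_mean g) (hC g hg) x y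
  rw [isCompactOperator_iff_exists_mem_nhds_image_subset_compact]
  refine ⟨Metric.closedBall 0 1, Metric.closedBall_mem_nhds _ one_pos, _,
    BoundedContinuousFunction.arzela_ascoli
      (Metric.closedBall (0 : 𝕜) ((C + 1) / 2 * Real.sqrt L)) (isCompact_closedBall _ _)
      (antiderivLM 𝕜 L '' Metric.closedBall 0 1) ?_ ?_, subset_closure⟩
  · rintro _ x ⟨g, hg, rfl⟩
    rw [antiderivLM_apply, Metric.mem_closedBall, ← antideriv_zero g]
    refine (hmod g (mem_closedBall_zero_iff.1 hg) x 0).trans ?_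
    have := AddCircle.norm_le_half_period L (x := x) hL.ne'
    rw [abs_of_pos hL] at this
    rw [dist_zero_right]
    gcongr
    linarith
  · refine Metric.equicontinuous_of_continuity_modulus
      (fun d => (C + 1) / 2 * Real.sqrt d) ?_ _ ?_
    · have : Continuous fun d : ℝ => (C + 1) / 2 * Real.sqrt d := by fun_prop
      simpa using this.tendsto 0
    · rintro x y ⟨_, g, hg, rfl⟩
      exact hmod g (mem_closedBall_zero_iff.1 hg) x y

variable (𝕜 L) in
/-- `antideriv` as a bounded operator in `L²_per`. -/
def antiderivL : L2per 𝕜 L →L[𝕜] L2per 𝕜 L :=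
  (BoundedContinuousFunction.toLp 2 (volume : Measure (AddCircle L)) 𝕜).comp
    (ContinuousLinearMap.mkOfIsCompactOperator (isCompactOperator_antiderivLM (𝕜 := 𝕜) (L := L)))

theorem isCompactOperator_antiderivL : IsCompactOperator (antiderivL 𝕜 L) :=
  (isCompactOperator_antiderivLM (𝕜 := 𝕜) (L := L)).clm_comp
    (BoundedContinuousFunction.toLp 2 (volume : Measure (AddCircle L)) 𝕜)

theorem coeFn_antiderivL (g : L2per 𝕜 L) : antiderivL 𝕜 L g =ᵐ[volume] antideriv g :=
  BoundedContinuousFunction.coeFn_toLp _ _ _ _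

theorem hasWeakDeriv_antiderivL (g : L2per 𝕜 L) :
    HasWeakDeriv (antiderivL 𝕜 L g) (fun x => g x - mean g) :=
  ((isPrimitive_antideriv g).hasWeakDeriv (memLp_sub_mean g)).congr (coeFn_antiderivL g).symm
    Filter.EventuallyEq.rfl

end Antiderivative

/-! ### Parity, multiplication operators and Hill operators -/

section Hill

variable {𝕜 : Type*} [RCLike 𝕜] {L : ℝ} [Fact (0 < L)]

theorem ae_comp_neg {p : AddCircle L → Prop} (h : ∀ᵐ x, p x) : ∀ᵐ x, p (-x) :=
  (Measure.measurePreserving_neg volume).quasiMeasurePreserving.ae h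

theorem IsOdd.congr {f g : AddCircle L → 𝕜} (hf : IsOdd f) (e : f =ᵐ[volume] g) : IsOdd g := by
  filter_upwards [hf, e, ae_comp_neg e] with x h1 h2 h3
  rw [← h2, ← h3, h1]

theorem IsOdd.integral_eq_zero {f : AddCircle L → 𝕜} (hf : IsOdd f) : ∫ x, f x = 0 := by
  have h1 := integral_neg_eq_self f volume
  rw [integral_congr_ae hf, integral_neg] at h1
  have h2 : (2 : 𝕜) * ∫ x, f x = 0 := by linear_combination -h1
  exact (mul_eq_zero.1 h2).resolve_left two_ne_zero

/-- An odd continuous function is odd everywhere. -/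
theorem IsOdd.apply_neg {f : AddCircle L → 𝕜} (hf : IsOdd f) (hc : Continuous f)
    (x : AddCircle L) : f (-x) = -f x :=
  congrFun ((hc.comp continuous_neg).ae_eq_iff_eq (μ := volume) hc.neg |>.1 hf) x

/-- The weak derivative of an odd function is even. -/
theorem IsOdd.weakDeriv_even {f g : AddCircle L → 𝕜} (hf : IsOdd f) (hg : MemLp g 2 volume)
    (h : HasWeakDeriv f g) : ∀ᵐ x, g (-x) = g x := by
  have hg' : MemLp (fun x => -g (-x)) 2 volume :=
    (hg.comp_measurePreserving (Measure.measurePreserving_neg volume)).neg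
  have h1 := HasWeakDeriv.unique_congr h.comp_neg (h.const_smul (-1 : 𝕜)) hg'
    (hg.const_smul (-1 : 𝕜)) (by
      filter_upwards [hf] with x hx
      simpa using hx)
  filter_upwards [h1] with x hx
  simpa using hx

/-- The weak derivative of an even function is odd. -/
theorem isOdd_weakDeriv_of_even {f g : AddCircle L → 𝕜} (hf : ∀ᵐ x, f (-x) = f x)
    (hg : MemLp g 2 volume) (h : HasWeakDeriv f g) : IsOdd g := by
  have hg' : MemLp (fun x => -g (-x)) 2 volume :=
    (hg.comp_measurePreserving (Measure.measurePreserving_neg volume)).neg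
  have h1 := HasWeakDeriv.unique_congr h.comp_neg h hg' hg hf
  filter_upwards [h1] with x hx
  rw [← hx, neg_neg]

theorem IsPrimitive.comp_neg {f g : AddCircle L → 𝕜} (h : IsPrimitive f g) :
    IsPrimitive (fun x => f (-x)) (fun x => -g (-x)) := by
  intro x y
  have h1 := h (-x) (-y)
  have h2 := intervalIntegral.integral_comp_neg (a := x) (b := y) (fun t : ℝ => g t)
  rw [intervalIntegral.integral_neg]
  simp only [AddCircle.coe_neg] at h1 h2
  rw [h2, h1, intervalIntegral.integral_symm]

theorem antideriv_neg_of_even {g : L2per 𝕜 L} (hg : ∀ᵐ x, g (-x) = g x) (x : AddCircle L) :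
    antideriv g (-x) = -antideriv g x := by
  have h1 : antideriv g = fun x => -antideriv g (-x) := by
    have hp : IsPrimitive (fun x => -antideriv g (-x)) (fun x => g (-x) - mean g) := by
      intro x y
      have := (isPrimitive_antideriv g).comp_neg.const_smul (-1 : 𝕜) x y
      simpa using this
    refine antideriv_eq hp ?_ (by simp [antideriv_zero])
    filter_upwards [hg] with x hx
    simp [hx]
  rw [congrFun h1 (-x), neg_neg]

theorem antideriv_neg_of_odd {g : L2per 𝕜 L} (hg : IsOdd g) (x : AddCircle L) :
    antideriv g (-x) = antideriv g x := by
  have h1 : antideriv g = fun x => antideriv g (-x) := by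
    refine antideriv_eq ((isPrimitive_antideriv g).comp_neg) ?_ (by simp [antideriv_zero])
    have hm : mean g = 0 := by rw [mean, hg.integral_eq_zero, mul_zero]
    filter_upwards [hg] with x hx
    simp [hx, hm]
  rw [congrFun h1 x]

variable (𝕜 L) in
/-- Minus the twice iterated integration operator. On odd functions this is the inverse of `-∂ₓ²`:
an odd `g` has mean zero, its primitive is even, and the second integration subtracts the mean of
that primitive, so that its result is odd with second derivative `g`. -/
def invLaplacian : L2per 𝕜 L →L[𝕜] L2per 𝕜 L := -(antiderivL 𝕜 L).comp (antiderivL 𝕜 L)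

theorem isCompactOperator_invLaplacian : IsCompactOperator (invLaplacian 𝕜 L) := by
  have := (isCompactOperator_antiderivL (𝕜 := 𝕜) (L := L)).clm_comp (antiderivL 𝕜 L)
  exact this.neg

theorem coeFn_invLaplacian (g : L2per 𝕜 L) :
    invLaplacian 𝕜 L g =ᵐ[volume] fun x => -antideriv (antiderivL 𝕜 L g) x := by
  have h : invLaplacian 𝕜 L g = -antiderivL 𝕜 L (antiderivL 𝕜 L g) := rfl
  rw [h]
  filter_upwards [Lp.coeFn_neg (antiderivL 𝕜 L (antiderivL 𝕜 L g)),
    coeFn_antiderivL (antiderivL 𝕜 L g)] with x h1 h2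
  rw [h1, Pi.neg_apply, h2]

theorem isOdd_invLaplacian {g : L2per 𝕜 L} (hg : IsOdd g) : IsOdd (invLaplacian 𝕜 L g) := by
  have he : ∀ᵐ x, antiderivL 𝕜 L g (-x) = antiderivL 𝕜 L g x := by
    filter_upwards [coeFn_antiderivL g, ae_comp_neg (coeFn_antiderivL g)] with x h1 h2
    rw [h1, h2, antideriv_neg_of_odd hg]
  refine IsOdd.congr (Filter.Eventually.of_forall fun x => ?_) (coeFn_invLaplacian g).symm
  simp only [antideriv_neg_of_even he]

theorem memH2_invLaplacian {g : L2per 𝕜 L} (hg : IsOdd g) :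
    MemH2 (invLaplacian 𝕜 L g) ∧
      weakDeriv (weakDeriv (invLaplacian 𝕜 L g)) =ᵐ[volume] fun x => -g x := by
  set s := antiderivL 𝕜 L g with hs
  have hm : mean g = 0 := by rw [mean, hg.integral_eq_zero, mul_zero]
  have h1 : HasWeakDeriv (invLaplacian 𝕜 L g) (fun x => -(s x - mean s)) := by
    refine ((hasWeakDeriv_antiderivL s).const_smul (-1 : 𝕜)).congr ?_ ?_
    · have h : invLaplacian 𝕜 L g = -antiderivL 𝕜 L s := rfl
      rw [h]
      filter_upwards [Lp.coeFn_neg (antiderivL 𝕜 L s)] with x hx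
      rw [hx]
      simp
    · exact Filter.Eventually.of_forall fun x => by simp
  have hm1 : MemLp (fun x => -(s x - mean s)) 2 volume := (memLp_sub_mean s).neg
  obtain ⟨a1, a2⟩ := weakDeriv_eq (Lp.memLp _) hm1 h1
  have h2 : HasWeakDeriv (fun x => -(s x - mean s)) (fun x => -g x) := by
    have hp : IsPrimitive (fun x => -(antideriv g x - mean s)) (fun x => -g x) := by
      have := ((isPrimitive_antideriv g).add_const (-mean s)).const_smul (-1 : 𝕜)
      rw [hm] at this
      intro x y
      have h := this x y
      simpa [sub_eq_add_neg] using h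
    refine (hp.hasWeakDeriv (Lp.memLp g).neg).congr ?_ Filter.EventuallyEq.rfl
    filter_upwards [coeFn_antiderivL g] with x hx
    rw [hx]
  obtain ⟨b1, b2⟩ := weakDeriv_eq hm1 (Lp.memLp g).neg h2
  obtain ⟨c1, c2⟩ := b1.congr a2.symm
  exact ⟨⟨a1, c1⟩, c2.trans b2⟩

/-- An odd function in `H²_per` is determined by its second derivative. -/
theorem invLaplacian_eq {f g : L2per 𝕜 L} (hf : MemH2 f) (hodd : IsOdd f)
    (hg : g =ᵐ[volume] fun x => -weakDeriv (weakDeriv f) x) : invLaplacian 𝕜 L g = f := by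
  have hf1 := hf.1.hasWeakDeriv
  have hf2 := hf.2.hasWeakDeriv
  have hgodd : IsOdd g := by
    have h1 := isOdd_weakDeriv_of_even (hodd.weakDeriv_even hf.1.memLp_weakDeriv hf1)
      hf.2.memLp_weakDeriv hf2
    refine IsOdd.congr (f := fun x => -weakDeriv (weakDeriv f) x) ?_ hg.symm
    filter_upwards [h1] with x hx
    rw [hx]
  obtain ⟨hK, hK'⟩ := memH2_invLaplacian hgodd
  set F := invLaplacian 𝕜 L g with hF
  have e2 : weakDeriv (weakDeriv F) =ᵐ[volume] weakDeriv (weakDeriv f) := by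
    filter_upwards [hK', hg] with x h1 h2
    rw [h1, h2, neg_neg]
  -- the difference has vanishing second derivative, hence constant derivative, of mean zero
  have hconst : ∀ {u v u' v' : AddCircle L → 𝕜}, MemLp u 2 volume → MemLp v 2 volume →
      MemLp u' 2 volume → MemLp v' 2 volume → HasWeakDeriv u u' → HasWeakDeriv v v' →
      u' =ᵐ[volume] v' → ∃ c : 𝕜, ∀ᵐ x, u x - v x = c := by
    intro u v u' v' hu hv hu' hv' h1 h2 e
    have h3 : HasWeakDeriv (u + (-1 : 𝕜) • v) 0 := by
      refine (h1.add hu (hv.const_smul (-1 : 𝕜)) hu' (hv'.const_smul (-1 : 𝕜))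
        (h2.const_smul (-1 : 𝕜))).congr Filter.EventuallyEq.rfl ?_
      filter_upwards [e] with x hx
      simp [hx]
    obtain ⟨c, hc⟩ := h3.ae_eq_const (hu.add (hv.const_smul (-1 : 𝕜)))
    refine ⟨c, ?_⟩
    filter_upwards [hc] with x hx
    rw [← hx]
    simp [sub_eq_add_neg]
  have hzero : ∀ {w : AddCircle L → 𝕜} {c : 𝕜}, (∀ᵐ x, w x = c) → ∫ x, w x = 0 → c = 0 := by
    intro w c hw h0
    have hL : 0 < L := Fact.out
    rw [integral_congr_ae hw, integral_const_circle] at h0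
    exact (mul_eq_zero.1 h0).resolve_left (RCLike.ofReal_ne_zero.2 hL.ne')
  have hK1 := hK.1.hasWeakDeriv
  obtain ⟨c, hc⟩ := hconst hK.1.memLp_weakDeriv hf.1.memLp_weakDeriv hK.2.memLp_weakDeriv
    hf.2.memLp_weakDeriv hK.2.hasWeakDeriv hf2 e2
  have hc0 : c = 0 := hzero hc (by
    rw [integral_sub (integrable_of_memLp_two hK.1.memLp_weakDeriv)
      (integrable_of_memLp_two hf.1.memLp_weakDeriv), hK1.integral_eq_zero, hf1.integral_eq_zero,
      sub_zero])
  obtain ⟨d, hd⟩ := hconst (Lp.memLp F) (Lp.memLp f) hK.1.memLp_weakDeriv hf.1.memLp_weakDeriv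
    hK1 hf1 (by
      filter_upwards [hc] with x hx
      exact sub_eq_zero.1 (hx.trans hc0))
  have hd0 : d = 0 := hzero hd (by
    rw [integral_sub (integrable_Lp F) (integrable_Lp f), hodd.integral_eq_zero,
      (isOdd_invLaplacian hgodd).integral_eq_zero, sub_zero])
  refine Lp.ext ?_
  filter_upwards [hd] with x hx
  exact sub_eq_zero.1 (hx.trans hd0)

theorem memLp_ofReal_mul {W : AddCircle L → ℝ} (hW : Continuous W) {f : AddCircle L → 𝕜}
    (hf : MemLp f 2 volume) : MemLp (fun x => (W x : 𝕜) * f x) 2 volume :=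
  hf.mul' (memLp_of_continuous (RCLike.continuous_ofReal.comp hW) ⊤)

/-- Multiplication by a continuous real function. -/
def mulL (𝕜 : Type*) [RCLike 𝕜] {W : AddCircle L → ℝ} (hW : Continuous W) :
    L2per 𝕜 L →L[𝕜] L2per 𝕜 L :=
  have hm : ∀ f : L2per 𝕜 L, MemLp (fun x => (W x : 𝕜) * f x) 2 volume := fun f =>
    memLp_ofReal_mul hW (Lp.memLp f)
  have hb : ∃ C : ℝ, ∀ x, ‖(W x : 𝕜)‖ ≤ C :=
    let ⟨C, hC⟩ := isCompact_univ.exists_bound_of_continuousOn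
      (RCLike.continuous_ofReal.comp hW : Continuous fun x => (W x : 𝕜)).continuousOn
    ⟨C, fun x => hC x trivial⟩
  LinearMap.mkContinuousOfExistsBound
    { toFun := fun f => (hm f).toLp _
      map_add' := by
        intro f g
        rw [← MemLp.toLp_add, MemLp.toLp_eq_toLp_iff]
        filter_upwards [Lp.coeFn_add f g] with x hx
        rw [hx]
        simp [mul_add]
      map_smul' := by
        intro c f
        rw [RingHom.id_apply, ← MemLp.toLp_const_smul, MemLp.toLp_eq_toLp_iff]
        filter_upwards [Lp.coeFn_smul c f] with x hx
        rw [hx]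
        simp [mul_left_comm] }
    (by
      obtain ⟨C, hC⟩ := hb
      refine ⟨C, fun f => ?_⟩
      refine Lp.norm_le_mul_norm_of_ae_le_mul ?_
      filter_upwards [(hm f).coeFn_toLp] with x hx
      change ‖(hm f).toLp _ x‖ ≤ _
      rw [hx, norm_mul]
      gcongr
      exact hC x)

theorem coeFn_mulL {W : AddCircle L → ℝ} (hW : Continuous W) (f : L2per 𝕜 L) :
    mulL 𝕜 hW f =ᵐ[volume] fun x => (W x : 𝕜) * f x :=
  (memLp_ofReal_mul hW (Lp.memLp f)).coeFn_toLp

theorem isOdd_mulL {W : AddCircle L → ℝ} (hW : Continuous W) (hWe : ∀ x, W (-x) = W x)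
    {f : L2per 𝕜 L} (hf : IsOdd f) : IsOdd (mulL 𝕜 hW f) := by
  refine IsOdd.congr ?_ (coeFn_mulL hW f).symm
  filter_upwards [hf] with x hx
  rw [hx, hWe, mul_neg]

variable {V W : AddCircle L → ℝ}

theorem mem_hillOp_domain (hW : Continuous W) (e : V =ᵐ[volume] W) {f : L2per 𝕜 L} :
    f ∈ (hillOp 𝕜 V).domain ↔ MemH2 f := by
  refine ⟨fun h => h.1, fun h => ⟨h, ?_⟩⟩
  refine (memLp_congr_ae ?_).1 (Lp.memLp (mulL 𝕜 hW f))
  filter_upwards [coeFn_mulL hW f, e] with x h1 h2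
  rw [h1, h2]

theorem coeFn_hillOp (e : V =ᵐ[volume] W) (f : (hillOp 𝕜 V).domain) :
    hillOp 𝕜 V f =ᵐ[volume]
      fun x => -weakDeriv (weakDeriv (f : L2per 𝕜 L)) x + (W x : 𝕜) * (f : L2per 𝕜 L) x := by
  have h : hillOp 𝕜 V f =ᵐ[volume] fun x => -weakDeriv (weakDeriv (f : L2per 𝕜 L)) x +
      (V x : 𝕜) * (f : L2per 𝕜 L) x := (hillOp_memLp 𝕜 V f).coeFn_toLp
  filter_upwards [h, e] with x h1 h2
  rw [h1, h2]

/-- The sesquilinear form of a Hill operator. -/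
theorem inner_hillOp (hW : Continuous W) (e : V =ᵐ[volume] W) (f : (hillOp 𝕜 V).domain)
    {g : L2per 𝕜 L} (hg : MemH1 g) :
    inner 𝕜 (hillOp 𝕜 V f) g =
      (∫ x, starRingEnd 𝕜 (weakDeriv (f : L2per 𝕜 L) x) * weakDeriv g x) +
      ∫ x, (W x : 𝕜) * (starRingEnd 𝕜 ((f : L2per 𝕜 L) x) * g x) := by
  have hf := f.2.1
  set F : L2per 𝕜 L := (f : L2per 𝕜 L) with hF
  have hconj : ∀ {u : AddCircle L → 𝕜}, MemLp u 2 volume →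
      MemLp (fun x => starRingEnd 𝕜 (u x)) 2 volume := fun hu =>
    (RCLike.conjCLE (K := 𝕜)).toContinuousLinearMap.comp_memLp' hu
  have h2 : HasWeakDeriv (fun x => starRingEnd 𝕜 (weakDeriv F x))
      (fun x => starRingEnd 𝕜 (weakDeriv (weakDeriv F) x)) :=
    hf.2.hasWeakDeriv.comp_clm hf.1.memLp_weakDeriv hf.2.memLp_weakDeriv
      (RCLike.conjCLE (K := 𝕜)).toContinuousLinearMap
  have hibp := h2.integral_mul_add_mul hg.hasWeakDeriv (hconj hf.1.memLp_weakDeriv)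
    (hconj hf.2.memLp_weakDeriv) hg.memLp hg.memLp_weakDeriv
  have hi1 := integrable_mul_of_memLp_two (hconj hf.2.memLp_weakDeriv) hg.memLp
  have hi2 : Integrable (fun x => -(starRingEnd 𝕜 (weakDeriv (weakDeriv F) x) * g x)) volume :=
    hi1.neg
  have hi3 : Integrable (fun x => (W x : 𝕜) * (starRingEnd 𝕜 (F x) * g x)) volume := by
    have := integrable_mul_of_memLp_two (memLp_ofReal_mul hW (hconj (Lp.memLp F))) hg.memLp
    simpa only [mul_assoc] using this
  rw [L2.inner_def]
  have h3 : ∫ x, inner 𝕜 (hillOp 𝕜 V f x) (g x) =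
      ∫ x, (-(starRingEnd 𝕜 (weakDeriv (weakDeriv F) x) * g x) +
        (W x : 𝕜) * (starRingEnd 𝕜 (F x) * g x)) := by
    refine integral_congr_ae ?_
    filter_upwards [coeFn_hillOp e f] with x hx
    rw [hx, RCLike.inner_apply]
    simp only [map_add, map_neg, map_mul, RCLike.conj_ofReal]
    ring
  rw [h3, integral_add hi2 hi3, integral_neg]
  congr 1
  exact neg_eq_of_add_eq_zero_right hibp

theorem isSymm_hillOp (hW : Continuous W) (e : V =ᵐ[volume] W) : IsSymm (hillOp 𝕜 V) := by
  intro f g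
  rw [inner_hillOp hW e f g.2.1.1, ← inner_conj_symm, inner_hillOp hW e g f.2.1.1, map_add,
    ← integral_conj, ← integral_conj]
  congr 1
  · refine integral_congr_ae (Filter.Eventually.of_forall fun x => ?_)
    simp [mul_comm]
  · refine integral_congr_ae (Filter.Eventually.of_forall fun x => ?_)
    simp [mul_comm]

theorem re_inner_hillOp_self (hW : Continuous W) (e : V =ᵐ[volume] W)
    (f : (hillOp 𝕜 V).domain) :
    RCLike.re (inner 𝕜 (hillOp 𝕜 V f) (f : L2per 𝕜 L)) =
      ∫ x, (‖weakDeriv (f : L2per 𝕜 L) x‖ ^ 2 + W x * ‖(f : L2per 𝕜 L) x‖ ^ 2) := by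
  set F : L2per 𝕜 L := (f : L2per 𝕜 L) with hF
  have h1 : Integrable (fun x => ‖weakDeriv F x‖ ^ 2) volume :=
    f.2.1.1.memLp_weakDeriv.integrable_norm_pow (by norm_num)
  have h2 : Integrable (fun x => W x * ‖F x‖ ^ 2) volume := by
    obtain ⟨C, hC⟩ := isCompact_univ.exists_bound_of_continuousOn hW.continuousOn
    exact ((Lp.memLp F).integrable_norm_pow (p := 2) (by norm_num)).bdd_mul
      hW.aestronglyMeasurable (Filter.Eventually.of_forall fun x => hC x trivial)
  rw [inner_hillOp hW e f f.2.1.1, integral_add h1 h2, ← RCLike.ofReal_re (K := 𝕜)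
    ((∫ x, ‖weakDeriv F x‖ ^ 2) + ∫ x, W x * ‖F x‖ ^ 2)]
  congr 1
  rw [RCLike.ofReal_add, ← integral_ofReal, ← integral_ofReal]
  congr 1
  · refine integral_congr_ae (Filter.Eventually.of_forall fun x => ?_)
    simp only [RCLike.conj_mul, hF]
    push_cast
    rfl
  · refine integral_congr_ae (Filter.Eventually.of_forall fun x => ?_)
    simp only [RCLike.conj_mul, hF]
    push_cast
    rfl

end Hill

/-! ### Diagonal Hill operators in the odd sector -/

section OddSector

variable {𝕜 : Type*} [RCLike 𝕜] {L : ℝ} [Fact (0 < L)]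

theorem isOdd_iff_compMeasurePreserving (f : L2per 𝕜 L) :
    IsOdd f ↔ Lp.compMeasurePreserving Neg.neg (Measure.measurePreserving_neg volume) f = -f := by
  have e1 := Lp.coeFn_compMeasurePreserving f
    (Measure.measurePreserving_neg (volume : Measure (AddCircle L)))
  have e2 := Lp.coeFn_neg f
  constructor
  · intro h
    refine Lp.ext ?_
    filter_upwards [e1, e2, h] with x h1 h2 h3
    rw [h1, h2, Pi.neg_apply, ← h3]
    rfl
  · intro h
    rw [h] at e1
    filter_upwards [e1, e2] with x h1 h2
    rw [h2] at h1
    exact h1.symm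

theorem isClosed_oddSector : IsClosed (oddSector 𝕜 L : Set (L2pair 𝕜 L)) := by
  have hc : IsClosed {f : L2per 𝕜 L | IsOdd f} := by
    simp only [isOdd_iff_compMeasurePreserving]
    exact isClosed_eq (Lp.isometry_compMeasurePreserving _).continuous continuous_neg
  exact (hc.preimage (WithLp.fstL 2 𝕜 (L2per 𝕜 L) (L2per 𝕜 L)).continuous).inter
    (hc.preimage (WithLp.sndL 2 𝕜 (L2per 𝕜 L) (L2per 𝕜 L)).continuous)

instance : CompleteSpace (oddSector 𝕜 L) := isClosed_oddSector.completeSpace_coe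

/-- The bounded diagonal operator `(u, v) ↦ (S u, T v)`. -/
def pairL (S T : L2per 𝕜 L →L[𝕜] L2per 𝕜 L) : L2pair 𝕜 L →L[𝕜] L2pair 𝕜 L :=
  ((WithLp.prodContinuousLinearEquiv 2 𝕜 (L2per 𝕜 L) (L2per 𝕜 L)).symm :
      L2per 𝕜 L × L2per 𝕜 L →L[𝕜] L2pair 𝕜 L).comp
    ((S.prodMap T).comp
      (WithLp.prodContinuousLinearEquiv 2 𝕜 (L2per 𝕜 L) (L2per 𝕜 L) :
        L2pair 𝕜 L →L[𝕜] L2per 𝕜 L × L2per 𝕜 L))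

theorem isCompactOperator_pairL {S T : L2per 𝕜 L →L[𝕜] L2per 𝕜 L} (hS : IsCompactOperator S)
    (hT : IsCompactOperator T) : IsCompactOperator (pairL S T) := by
  obtain ⟨C, hC, hCn⟩ := hS
  obtain ⟨D, hD, hDn⟩ := hT
  refine ⟨_, (hC.prod hD).image
    (WithLp.prodContinuousLinearEquiv 2 𝕜 (L2per 𝕜 L) (L2per 𝕜 L)).symm.continuous, ?_⟩
  have h1 := (WithLp.fstL 2 𝕜 (L2per 𝕜 L) (L2per 𝕜 L)).continuous.continuousAt.preimage_mem_nhds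
    (x := 0) (by rw [map_zero]; exact hCn)
  have h2 := (WithLp.sndL 2 𝕜 (L2per 𝕜 L) (L2per 𝕜 L)).continuous.continuousAt.preimage_mem_nhds
    (x := 0) (by rw [map_zero]; exact hDn)
  filter_upwards [h1, h2] with x hx1 hx2
  exact ⟨(S x.fst, T x.snd), ⟨hx1, hx2⟩, rfl⟩

/-- A bounded diagonal operator whose entries preserve oddness, in the odd sector. -/
def oddPairL (S T : L2per 𝕜 L →L[𝕜] L2per 𝕜 L) (hS : ∀ f : L2per 𝕜 L, IsOdd f → IsOdd (S f))
    (hT : ∀ f : L2per 𝕜 L, IsOdd f → IsOdd (T f)) : oddSector 𝕜 L →L[𝕜] oddSector 𝕜 L :=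
  (pairL S T).restrict fun x hx => ⟨hS x.fst hx.1, hT x.snd hx.2⟩

variable {V₁ V₂ W₁ W₂ : AddCircle L → ℝ}

theorem pair_ext {x y : L2pair 𝕜 L} (h1 : x.fst = y.fst) (h2 : x.snd = y.snd) : x = y :=
  (WithLp.equiv 2 _).injective (Prod.ext h1 h2)

/-- A diagonal Hill operator with continuous even potentials, in the odd sector, is a bounded
perturbation of the operator `-∂ₓ²`, whose inverse is compact. -/
theorem exists_isPerturbationOfCompactInverse (hW₁ : Continuous W₁) (hW₂ : Continuous W₂)
    (he₁ : ∀ x, W₁ (-x) = W₁ x) (he₂ : ∀ x, W₂ (-x) = W₂ x) (e₁ : V₁ =ᵐ[volume] W₁)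
    (e₂ : V₂ =ᵐ[volume] W₂) :
    ∃ K B : oddSector 𝕜 L →L[𝕜] oddSector 𝕜 L,
      IsPerturbationOfCompactInverse
        (part (diagOp (hillOp 𝕜 V₁) (hillOp 𝕜 V₂)) (oddSector 𝕜 L)) K B := by
  set K := oddPairL (invLaplacian 𝕜 L) (invLaplacian 𝕜 L) (fun f hf => isOdd_invLaplacian hf)
    (fun f hf => isOdd_invLaplacian hf) with hK
  set B := oddPairL (mulL 𝕜 hW₁) (mulL 𝕜 hW₂) (fun f hf => isOdd_mulL hW₁ he₁ hf)
    (fun f hf => isOdd_mulL hW₂ he₂ hf) with hB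
  have hright : ∀ {V W : AddCircle L → ℝ} (hW : Continuous W) (e : V =ᵐ[volume] W)
      {y : L2per 𝕜 L}, IsOdd y → ∃ h : invLaplacian 𝕜 L y ∈ (hillOp 𝕜 V).domain,
        hillOp 𝕜 V ⟨invLaplacian 𝕜 L y, h⟩ = y + mulL 𝕜 hW (invLaplacian 𝕜 L y) := by
    intro V W hW e y hy
    obtain ⟨h1, h2⟩ := memH2_invLaplacian hy
    refine ⟨(mem_hillOp_domain hW e).2 h1, Lp.ext ?_⟩
    filter_upwards [coeFn_hillOp e ⟨invLaplacian 𝕜 L y, (mem_hillOp_domain hW e).2 h1⟩, h2,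
      coeFn_mulL hW (invLaplacian 𝕜 L y),
      Lp.coeFn_add y (mulL 𝕜 hW (invLaplacian 𝕜 L y))] with x a1 a2 a3 a4
    rw [a1, a4, Pi.add_apply, a3, a2, neg_neg]
  have hleft : ∀ {V W : AddCircle L → ℝ} (hW : Continuous W) (e : V =ᵐ[volume] W)
      (u : (hillOp 𝕜 V).domain), IsOdd (u : L2per 𝕜 L) →
        invLaplacian 𝕜 L (hillOp 𝕜 V u - mulL 𝕜 hW (u : L2per 𝕜 L)) = u := by
    intro V W hW e u hu
    refine invLaplacian_eq u.2.1 hu ?_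
    filter_upwards [coeFn_hillOp e u, coeFn_mulL hW (u : L2per 𝕜 L),
      Lp.coeFn_sub (hillOp 𝕜 V u) (mulL 𝕜 hW (u : L2per 𝕜 L))] with x a1 a2 a3
    rw [a3, Pi.sub_apply, a1, a2]
    ring
  refine ⟨K, B, ?_, fun y => ?_, fun x => ?_⟩
  · have hP : ∀ x ∈ oddSector 𝕜 L,
        (pairL (invLaplacian 𝕜 L) (invLaplacian 𝕜 L)).toLinearMap x ∈ oddSector 𝕜 L :=
      fun x hx => ⟨isOdd_invLaplacian hx.1, isOdd_invLaplacian hx.2⟩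
    exact (isCompactOperator_pairL isCompactOperator_invLaplacian
      isCompactOperator_invLaplacian).restrict' hP
  · obtain ⟨a1, b1⟩ := hright hW₁ e₁ y.2.1
    obtain ⟨a2, b2⟩ := hright hW₂ e₂ y.2.2
    have hd : ((K y : oddSector 𝕜 L) : L2pair 𝕜 L) ∈
        (diagOp (hillOp 𝕜 V₁) (hillOp 𝕜 V₂)).domain := ⟨a1, a2⟩
    have hv : diagOp (hillOp 𝕜 V₁) (hillOp 𝕜 V₂) ⟨_, hd⟩ = ((y + B (K y) : oddSector 𝕜 L) :
        L2pair 𝕜 L) := pair_ext b1 b2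
    exact ⟨⟨hd, hv ▸ (y + B (K y)).2⟩, Subtype.ext hv⟩
  · obtain ⟨hd, -⟩ := x.2
    exact Subtype.ext (pair_ext (hleft hW₁ e₁ ⟨_, hd.1⟩ (x : oddSector 𝕜 L).2.1)
      (hleft hW₂ e₂ ⟨_, hd.2⟩ (x : oddSector 𝕜 L).2.2))

theorem inner_part_diagOp {A B : L2per 𝕜 L →ₗ.[𝕜] L2per 𝕜 L}
    (x : (part (diagOp A B) (oddSector 𝕜 L)).domain) (y : oddSector 𝕜 L) :
    inner 𝕜 (part (diagOp A B) (oddSector 𝕜 L) x) y =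
      inner 𝕜 (A ⟨(x : L2pair 𝕜 L).fst, x.2.1.1⟩) (y : L2pair 𝕜 L).fst +
      inner 𝕜 (B ⟨(x : L2pair 𝕜 L).snd, x.2.1.2⟩) (y : L2pair 𝕜 L).snd := rfl

theorem isSymm_part_diagOp {A B : L2per 𝕜 L →ₗ.[𝕜] L2per 𝕜 L} (hA : IsSymm A) (hB : IsSymm B) :
    IsSymm (part (diagOp A B) (oddSector 𝕜 L)) := by
  intro x y
  rw [inner_part_diagOp, ← inner_conj_symm (x : oddSector 𝕜 L), inner_part_diagOp, map_add,
    inner_conj_symm, inner_conj_symm]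
  exact congrArg₂ (· + ·) (hA ⟨_, x.2.1.1⟩ ⟨_, y.2.1.1⟩) (hB ⟨_, x.2.1.2⟩ ⟨_, y.2.1.2⟩)

theorem mem_eigenspace_part_diagOp {A B : L2per 𝕜 L →ₗ.[𝕜] L2per 𝕜 L} {z : 𝕜}
    {x : oddSector 𝕜 L} :
    x ∈ eigenspace (part (diagOp A B) (oddSector 𝕜 L)) z ↔
      (x : L2pair 𝕜 L).fst ∈ eigenspace A z ∧ (x : L2pair 𝕜 L).snd ∈ eigenspace B z := by
  constructor
  · rintro ⟨⟨hd, hm⟩, e⟩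
    have e' := congrArg Subtype.val e
    exact ⟨⟨hd.1, congrArg WithLp.fst e'⟩, ⟨hd.2, congrArg WithLp.snd e'⟩⟩
  · rintro ⟨⟨h1, e1⟩, h2, e2⟩
    have hd : (x : L2pair 𝕜 L) ∈ (diagOp A B).domain := ⟨h1, h2⟩
    have hv : diagOp A B ⟨_, hd⟩ = ((z • x : oddSector 𝕜 L) : L2pair 𝕜 L) := pair_ext e1 e2
    exact ⟨⟨hd, hv ▸ (z • x).2⟩, Subtype.ext hv⟩

theorem mem_eigenspace_hillOp {V W : AddCircle L → ℝ} (hW : Continuous W) (e : V =ᵐ[volume] W)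
    {z : 𝕜} {f : L2per 𝕜 L} : f ∈ eigenspace (hillOp 𝕜 V) z ↔
      MemH2 f ∧ ∀ᵐ x, -weakDeriv (weakDeriv f) x + (W x : 𝕜) * f x = z * f x := by
  constructor
  · rintro ⟨h, e'⟩
    refine ⟨h.1, ?_⟩
    have h1 := coeFn_hillOp e ⟨f, h⟩
    rw [e'] at h1
    filter_upwards [h1, Lp.coeFn_smul z f] with x a1 a2
    rw [← a1, a2]
    rfl
  · rintro ⟨h, h'⟩
    refine ⟨(mem_hillOp_domain hW e).2 h, Lp.ext ?_⟩
    filter_upwards [coeFn_hillOp e ⟨f, (mem_hillOp_domain hW e).2 h⟩, Lp.coeFn_smul z f, h']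
      with x a1 a2 a3
    rw [a1, a2, a3]
    rfl

/-- The quadratic form of a Hill operator is bounded below. -/
theorem exists_lower_bound_hillOp {V W : AddCircle L → ℝ} (hW : Continuous W)
    (e : V =ᵐ[volume] W) : ∃ M : ℝ, ∀ f : (hillOp 𝕜 V).domain,
      M * ‖(f : L2per 𝕜 L)‖ ^ 2 ≤ RCLike.re (inner 𝕜 (hillOp 𝕜 V f) (f : L2per 𝕜 L)) := by
  obtain ⟨C, hC⟩ := isCompact_univ.exists_bound_of_continuousOn hW.continuousOn
  refine ⟨-C, fun f => ?_⟩
  rw [re_inner_hillOp_self hW e, ← integral_norm_sq_eq, ← integral_const_mul]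
  set F : L2per 𝕜 L := (f : L2per 𝕜 L) with hF
  have h1 : Integrable (fun x => ‖weakDeriv F x‖ ^ 2) volume :=
    f.2.1.1.memLp_weakDeriv.integrable_norm_pow (by norm_num)
  have h2 : Integrable (fun x => ‖F x‖ ^ 2) volume :=
    (Lp.memLp F).integrable_norm_pow (p := 2) (by norm_num)
  have h3 : Integrable (fun x => W x * ‖F x‖ ^ 2) volume :=
    h2.bdd_mul hW.aestronglyMeasurable (Filter.Eventually.of_forall fun x => hC x trivial)
  refine integral_mono (h2.const_mul _) (h1.add h3) fun x => ?_
  have h4 := (abs_le.1 (hC x trivial)).1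
  simp only
  nlinarith [sq_nonneg ‖weakDeriv F x‖, mul_le_mul_of_nonneg_right h4 (sq_nonneg ‖F x‖)]

end OddSector

/-! ### Classical solutions of Hill equations -/

section Classical

variable {L : ℝ} [Fact (0 < L)]

/-- Uniqueness for the Cauchy problem of a linear second order equation. -/
theorem eq_zero_of_second_order_linear {V v v' : ℝ → ℝ} {C : ℝ} (hV : ∀ t, |V t| ≤ C)
    (h1 : ∀ t, HasDerivAt v (v' t) t) (h2 : ∀ t, HasDerivAt v' (V t * v t) t) {c : ℝ}
    (hc : v c = 0) (hc' : v' c = 0) (t : ℝ) : v t = 0 ∧ v' t = 0 := by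
  have hC : 0 ≤ C := (abs_nonneg _).trans (hV 0)
  have hu := ODE_solution_unique_univ (E := ℝ × ℝ) (v := fun t q => (q.2, V t * q.1))
    (s := fun _ => Set.univ) (K := ⟨max 1 C, le_max_of_le_left zero_le_one⟩)
    (f := fun t => (v t, v' t)) (g := fun _ => 0) (t₀ := c) (fun t => by
      refine LipschitzOnWith.of_dist_le_mul fun x _ y _ => ?_
      change dist (x.2, V t * x.1) (y.2, V t * y.1) ≤ max 1 C * dist x y
      simp only [Prod.dist_eq, Real.dist_eq]
      have hm1 : (1 : ℝ) ≤ max 1 C := le_max_left _ _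
      have hm2 : C ≤ max 1 C := le_max_right _ _
      refine max_le ?_ ?_
      · calc |x.2 - y.2| ≤ max |x.1 - y.1| |x.2 - y.2| := le_max_right _ _
          _ ≤ max 1 C * max |x.1 - y.1| |x.2 - y.2| :=
            le_mul_of_one_le_left (le_max_of_le_left (abs_nonneg _)) hm1
      · rw [← mul_sub, abs_mul]
        exact mul_le_mul ((hV t).trans hm2) (le_max_left _ _) (abs_nonneg _)
          (zero_le_one.trans hm1))
    (fun t => ⟨(h1 t).prodMk (h2 t), trivial⟩)
    (fun t => ⟨by
      have h0 : ((0 : ℝ × ℝ).2, V t * (0 : ℝ × ℝ).1) = 0 := by simp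
      rw [h0]
      exact hasDerivAt_const t (0 : ℝ × ℝ), trivial⟩) (by simp [hc, hc'])
  have := congrFun hu t
  exact ⟨congrArg Prod.fst this, congrArg Prod.snd this⟩

/-- `v` is a classical odd periodic solution of `v'' = W v`, with derivative `v'`. -/
structure IsHillSolution (W v v' : AddCircle L → ℝ) : Prop where
  odd : ∀ x, v (-x) = -v x
  deriv : ∀ x : ℝ, HasDerivAt (fun y : ℝ => v y) (v' x) x
  deriv' : ∀ x : ℝ, HasDerivAt (fun y : ℝ => v' y) (W x * v x) x

theorem continuous_of_hasDerivAt {v v' : AddCircle L → ℝ}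
    (h : ∀ x : ℝ, HasDerivAt (fun y : ℝ => v y) (v' x) x) : Continuous v := by
  have hq : Topology.IsQuotientMap (fun x : ℝ => (x : AddCircle L)) := isQuotientMap_quot_mk
  exact hq.continuous_iff.2 (continuous_iff_continuousAt.2 fun x => (h x).continuousAt)

namespace IsHillSolution

variable {W v v' : AddCircle L → ℝ}

theorem continuous (h : IsHillSolution W v v') : Continuous v := continuous_of_hasDerivAt h.deriv

theorem continuous' (h : IsHillSolution W v v') : Continuous v' :=
  continuous_of_hasDerivAt (v' := fun x => W x * v x) h.deriv'

theorem hasWeakDeriv (h : IsHillSolution W v v') : HasWeakDeriv v v' :=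
  (isPrimitive_of_hasDerivAt h.continuous' h.deriv).hasWeakDeriv (memLp_of_continuous h.continuous' 2)

theorem hasWeakDeriv' (h : IsHillSolution W v v') (hW : Continuous W) :
    HasWeakDeriv v' (fun x => W x * v x) :=
  (isPrimitive_of_hasDerivAt (hW.mul h.continuous) h.deriv').hasWeakDeriv
    (memLp_of_continuous (hW.mul h.continuous) 2)

theorem apply_zero (h : IsHillSolution W v v') : v 0 = 0 := by
  have := h.odd 0
  rw [neg_zero] at this
  linarith

theorem apply_half (h : IsHillSolution W v v') : v ((L / 2 : ℝ) : AddCircle L) = 0 := by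
  have h1 := h.odd ((L / 2 : ℝ) : AddCircle L)
  have h2 : -((L / 2 : ℝ) : AddCircle L) = ((L / 2 : ℝ) : AddCircle L) := by
    rw [neg_eq_iff_add_eq_zero, ← AddCircle.coe_add, add_halves, AddCircle.coe_period]
  rw [h2] at h1
  linarith

theorem odd_coe (h : IsHillSolution W v v') (x : ℝ) :
    v ((-x : ℝ) : AddCircle L) = -v (x : AddCircle L) := by
  rw [AddCircle.coe_neg, h.odd]

/-- The derivative of an odd solution is even. -/
theorem even' (h : IsHillSolution W v v') (x : AddCircle L) : v' (-x) = v' x := by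
  induction x using QuotientAddGroup.induction_on with
  | H x =>
    have h1 := HasDerivAt.scomp x (h.deriv (-x)) (hasDerivAt_neg x)
    have e : ((fun y : ℝ => v (y : AddCircle L)) ∘ Neg.neg) =
        fun y : ℝ => -v (y : AddCircle L) := by
      funext y
      exact h.odd_coe y
    have h1' : HasDerivAt (fun y : ℝ => -v (y : AddCircle L))
        ((-1 : ℝ) • v' ((-x : ℝ) : AddCircle L)) x := by
      rw [← e]
      exact h1
    have h2 := h1'.unique (h.deriv x).neg
    rw [AddCircle.coe_neg] at h2
    simpa using h2

/-- A solution with vanishing Cauchy data is zero. -/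
theorem eq_zero (h : IsHillSolution W v v') (hW : Continuous W) {c : ℝ} (hc : v c = 0)
    (hc' : v' c = 0) : v = 0 := by
  obtain ⟨C, hC⟩ := isCompact_univ.exists_bound_of_continuousOn hW.continuousOn
  funext x
  induction x using QuotientAddGroup.induction_on with
  | H x =>
    exact (eq_zero_of_second_order_linear (V := fun t => W t) (fun t => hC t trivial) h.deriv
      h.deriv' hc hc' x).1

theorem const_mul (h : IsHillSolution W v v') (c : ℝ) :
    IsHillSolution W (fun x => c * v x) (fun x => c * v' x) where
  odd x := by rw [h.odd, mul_neg]
  deriv x := (h.deriv x).const_mul c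
  deriv' x := by
    have := (h.deriv' x).const_mul c
    rwa [mul_left_comm] at this

theorem sub {u u' : AddCircle L → ℝ} (h : IsHillSolution W v v') (hu : IsHillSolution W u u') :
    IsHillSolution W (fun x => v x - u x) (fun x => v' x - u' x) where
  odd x := by rw [h.odd, hu.odd]; ring
  deriv x := (h.deriv x).sub (hu.deriv x)
  deriv' x := by
    have := (h.deriv' x).sub (hu.deriv' x)
    rwa [← mul_sub] at this

end IsHillSolution

variable {𝕜 : Type*} [RCLike 𝕜]

/-- Solutions in `H²_per` of an equation with continuous coefficient are classical. -/
theorem MemH2.exists_classical {f : AddCircle L → 𝕜} (hf : MemH2 f) {W : AddCircle L → ℝ}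
    (hW : Continuous W) (e : ∀ᵐ x, weakDeriv (weakDeriv f) x = (W x : 𝕜) * f x) :
    ∃ F G : AddCircle L → 𝕜, Continuous F ∧ f =ᵐ[volume] F ∧ weakDeriv f =ᵐ[volume] G ∧
      (∀ x : ℝ, HasDerivAt (fun y : ℝ => F y) (G x) x) ∧
      (∀ x : ℝ, HasDerivAt (fun y : ℝ => G y) ((W x : 𝕜) * F x) x) := by
  obtain ⟨F, hF, eF⟩ := hf.1.hasWeakDeriv.exists_isPrimitive hf.1.memLp hf.1.memLp_weakDeriv
  obtain ⟨G, hG, eG⟩ := hf.2.hasWeakDeriv.exists_isPrimitive hf.1.memLp_weakDeriv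
    hf.2.memLp_weakDeriv
  have hFc := hF.continuous (integrable_of_memLp_two hf.1.memLp_weakDeriv)
  have hGc := hG.continuous (integrable_of_memLp_two hf.2.memLp_weakDeriv)
  refine ⟨F, G, hFc, eF, eG, (hF.congr eG).hasDerivAt hGc, ?_⟩
  refine (hG.congr (g' := fun x => (W x : 𝕜) * F x) ?_).hasDerivAt
    ((RCLike.continuous_ofReal.comp hW).mul hFc)
  filter_upwards [e, eF] with x h1 h2
  rw [h1, h2]

/-- The real-linear image of an odd solution in `H²_per` agrees with a classical solution. -/
theorem MemH2.exists_isHillSolution {f : AddCircle L → 𝕜} (hf : MemH2 f) (hodd : IsOdd f)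
    {W : AddCircle L → ℝ} (hW : Continuous W)
    (e : ∀ᵐ x, weakDeriv (weakDeriv f) x = (W x : 𝕜) * f x) (T : 𝕜 →L[ℝ] ℝ) :
    ∃ v v' : AddCircle L → ℝ, IsHillSolution W v v' ∧ (fun x => T (f x)) =ᵐ[volume] v ∧
      (fun x => T (weakDeriv f x)) =ᵐ[volume] v' := by
  obtain ⟨F, G, hFc, eF, eG, h1, h2⟩ := hf.exists_classical hW e
  refine ⟨fun x => T (F x), fun x => T (G x), ⟨fun x => ?_, fun x => ?_, fun x => ?_⟩, ?_, ?_⟩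
  · rw [(hodd.congr eF).apply_neg hFc, map_neg]
  · exact T.hasFDerivAt.comp_hasDerivAt x (h1 x)
  · have := T.hasFDerivAt.comp_hasDerivAt x (h2 x)
    rw [← RCLike.real_smul_eq_coe_mul, map_smul, smul_eq_mul] at this
    exact this
  · filter_upwards [eF] with x hx
    rw [hx]
  · filter_upwards [eG] with x hx
    rw [hx]

end Classical

/-! ### The variational inequality satisfied by a minimizing wave -/

section Variation

variable {L : ℝ} [Fact (0 < L)]

/-- The variational characterization of the wave `p` (with `2 k = α + 2`): on odd functions the
Sobolev quotient is minimal at `p`, written in a homogeneous polynomial form. -/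
structure IsMinimizingProfile (ω : ℝ) (k : ℕ) (p p' : AddCircle L → ℝ) : Prop where
  hill : IsHillSolution (fun x => ω - p x ^ (2 * k - 2)) p p'
  mass_pos : 0 < ∫ x, p x ^ (2 * k)
  le : ∀ u u' : AddCircle L → ℂ, MemLp u 2 volume → MemLp u' 2 volume → IsOdd u →
    HasWeakDeriv u u' →
    (∫ x, ‖u x‖ ^ (2 * k)) * (∫ x, p x ^ (2 * k)) ^ k ≤
      (∫ x, (‖u' x‖ ^ 2 + ω * ‖u x‖ ^ 2)) ^ k * ∫ x, p x ^ (2 * k)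

/-- The weak form of `-p'' + ω p = p^(2k-1)`. -/
theorem integral_energy_eq {ω : ℝ} {k : ℕ} (hk : 1 ≤ k) {p p' w w' : AddCircle L → ℝ}
    (hp : IsHillSolution (fun x => ω - p x ^ (2 * k - 2)) p p') (hw : MemLp w 2 volume)
    (hw' : MemLp w' 2 volume) (h : HasWeakDeriv w w') :
    ∫ x, (p' x * w' x + ω * (p x * w x)) = ∫ x, p x ^ (2 * k - 1) * w x := by
  have hW : Continuous fun x => ω - p x ^ (2 * k - 2) := continuous_const.sub (hp.continuous.pow _)
  have hWp := hW.mul hp.continuous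
  have h1 := (hp.hasWeakDeriv' hW).integral_mul_add_mul h (memLp_of_continuous hp.continuous' 2)
    (memLp_of_continuous hWp 2) hw hw'
  have i1 := integrable_mul_of_memLp_two (memLp_of_continuous hp.continuous' 2) hw'
  have i2 := integrable_mul_of_memLp_two (memLp_of_continuous hp.continuous 2) hw
  have i3 : Integrable (fun x => p x ^ (2 * k - 1) * w x) volume := integrable_mul_of_memLp_two
    (memLp_of_continuous (hp.continuous.pow (2 * k - 1)) 2) hw
  have h2 : ∫ x, (ω - p x ^ (2 * k - 2)) * p x * w x =
      ω * (∫ x, p x * w x) - ∫ x, p x ^ (2 * k - 1) * w x := by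
    rw [← integral_const_mul, ← integral_sub (i2.const_mul ω) i3]
    refine integral_congr_ae (Filter.Eventually.of_forall fun x => ?_)
    simp only
    rw [show 2 * k - 1 = (2 * k - 2) + 1 by omega, pow_succ]
    ring
  rw [h2] at h1
  rw [integral_add i1 (i2.const_mul ω), integral_const_mul]
  linarith

/-- A minimizing wave has a classical representative, which is a minimizing profile. -/
theorem IsOddMinimizingWave.exists_profile {ω : ℝ} (hω : 0 < ω) {k : ℕ} (hk : 1 ≤ k)
    {φ : AddCircle L → ℝ} (h : IsOddMinimizingWave L ω (2 * k - 2) φ) (hev : Even (2 * k - 2)) :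
    ∃ p p' : AddCircle L → ℝ, φ =ᵐ[volume] p ∧ IsMinimizingProfile ω k p p' := by
  obtain ⟨hodd, υ, hυ, Ψ, hΨ, hmin, hsol, θ, hθ⟩ := h
  have hk2 : 2 * k - 2 + 2 = 2 * k := by omega
  obtain ⟨hΨ1, hΨodd, hΨm⟩ := hΨ
  rw [hk2] at hΨm
  set c : ℂ := Complex.exp (θ * Complex.I) with hc
  have hcn : ‖c‖ = 1 := Complex.norm_exp_ofReal_mul_I θ
  have hc0 : c ≠ 0 := Complex.exp_ne_zero _
  obtain ⟨F, hF, eF⟩ := hΨ1.hasWeakDeriv.exists_isPrimitive hΨ1.memLp hΨ1.memLp_weakDeriv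
  have hFc := hF.continuous (integrable_of_memLp_two hΨ1.memLp_weakDeriv)
  have hWF : Continuous fun x => ω - ‖F x‖ ^ (2 * k - 2) := continuous_const.sub (hFc.norm.pow _)
  set T : ℂ →L[ℝ] ℝ := Complex.reCLM.comp
    ((ContinuousLinearMap.mul ℝ ℂ) c⁻¹) with hT
  have hTc : ∀ r : ℝ, T (c * r) = r := by
    intro r
    simp [hT, hc0]
  obtain ⟨p, p', hp, e1, e2⟩ := hsol.1.exists_isHillSolution hΨodd hWF (by
    filter_upwards [hsol.2, eF] with x h1 h2
    rw [h2] at h1 ⊢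
    push_cast at h1 ⊢
    linear_combination -h1) T
  have hφp : φ =ᵐ[volume] p := by
    filter_upwards [hθ, e1] with x h1 h2
    rw [← h2, h1, hTc]
  have hFp : F = fun x => c * (p x : ℂ) := by
    refine (hFc.ae_eq_iff_eq (μ := volume) (continuous_const.mul
      (Complex.continuous_ofReal.comp hp.continuous))).1 ?_
    filter_upwards [eF, hθ, hφp] with x h1 h2 h3
    rw [← h1, h2, h3]
    rfl
  have hnorm : ∀ x, ‖F x‖ = |p x| := fun x => by
    rw [hFp]
    simp [hcn]
  have hWp : (fun x => ω - ‖F x‖ ^ (2 * k - 2)) = fun x => ω - p x ^ (2 * k - 2) := by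
    funext x
    rw [hnorm, hev.pow_abs]
  rw [hWp] at hp
  have hΨ' : weakDeriv Ψ =ᵐ[volume] fun x => c * (p' x : ℂ) := by
    have h1 := hp.hasWeakDeriv.comp_clm (memLp_of_continuous hp.continuous 2)
      (memLp_of_continuous hp.continuous' 2) Complex.ofRealCLM
    refine HasWeakDeriv.unique_congr hΨ1.hasWeakDeriv (h1.const_smul c) hΨ1.memLp_weakDeriv
      ((memLp_of_continuous (Complex.continuous_ofReal.comp hp.continuous') 2).const_smul c) ?_
    refine eF.trans (Filter.Eventually.of_forall fun x => ?_)
    rw [hFp]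
    rfl
  have hmass : ∫ x, p x ^ (2 * k) = υ := by
    rw [← hΨm]
    refine integral_congr_ae ?_
    filter_upwards [eF] with x hx
    rw [hx, hnorm, (even_two_mul k).pow_abs]
  have hen : energyB ω Ψ = υ / 2 := by
    have h1 := integral_energy_eq hk hp (memLp_of_continuous hp.continuous 2)
      (memLp_of_continuous hp.continuous' 2) hp.hasWeakDeriv
    have h2 : ∫ x, p x ^ (2 * k - 1) * p x = υ := by
      rw [← hmass]
      refine integral_congr_ae (Filter.Eventually.of_forall fun x => ?_)
      simp only
      rw [← pow_succ, show 2 * k - 1 + 1 = 2 * k by omega]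
    rw [h2] at h1
    rw [energyB, ← h1, one_div, div_eq_inv_mul]
    congr 1
    refine integral_congr_ae ?_
    filter_upwards [eF, hΨ'] with x h3 h4
    rw [h3, h4, hnorm, norm_mul, hcn, one_mul, Complex.norm_real, Real.norm_eq_abs, sq_abs, sq_abs]
    ring
  refine ⟨p, p', hφp, hp, hmass ▸ hυ, fun u u' hu hu' huo hw => ?_⟩
  rw [hmass]
  set N := ∫ x, ‖u x‖ ^ (2 * k) with hN
  set D := ∫ x, (‖u' x‖ ^ 2 + ω * ‖u x‖ ^ 2) with hD
  have hN0 : 0 ≤ N := integral_nonneg fun x => by positivity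
  have main : 0 < N → N * υ ^ k ≤ D ^ k * υ := by
    intro hNpos
    -- rescale `u` to the constraint set
    set s : ℝ := (υ / N) ^ ((2 * k : ℕ) : ℝ)⁻¹ with hs
    have hs0 : 0 ≤ s := by positivity
    have hsk : s ^ (2 * k) = υ / N := Real.rpow_inv_natCast_pow (by positivity) (by omega)
    have hsu := hw.const_smul (s : ℂ)
    obtain ⟨m1, m2⟩ := weakDeriv_eq (hu.const_smul (s : ℂ)) (hu'.const_smul (s : ℂ)) hsu
    have hmem : (s : ℂ) • u ∈ oddConstraint L (2 * k - 2) υ := by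
      refine ⟨m1, ?_, ?_⟩
      · filter_upwards [huo] with x hx
        simp [hx]
      · rw [hk2]
        simp only [Pi.smul_apply, smul_eq_mul, norm_mul, mul_pow, Complex.norm_real,
          Real.norm_eq_abs, abs_of_nonneg hs0]
        rw [integral_const_mul, ← hN, hsk, div_mul_cancel₀ _ hNpos.ne']
    have hle : energyB ω Ψ ≤ energyB ω ((s : ℂ) • u) := hmin hmem
    have hes : energyB ω ((s : ℂ) • u) = s ^ 2 * D / 2 := by
      have h1 : ∫ x, (‖weakDeriv ((s : ℂ) • u) x‖ ^ 2 + ω * ‖((s : ℂ) • u) x‖ ^ 2) =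
          s ^ 2 * D := by
        rw [hD, ← integral_const_mul]
        refine integral_congr_ae ?_
        filter_upwards [m2] with x hx
        rw [hx]
        simp only [Pi.smul_apply, smul_eq_mul, norm_mul, mul_pow, Complex.norm_real,
          Real.norm_eq_abs, sq_abs]
        ring
      rw [energyB, h1]
      ring
    rw [hen, hes] at hle
    have h2 : υ ≤ s ^ 2 * D := by linarith
    have h3 : υ ^ k ≤ (s ^ 2 * D) ^ k := by gcongr
    rw [mul_pow, ← pow_mul, hsk, div_mul_eq_mul_div, le_div_iff₀ hNpos] at h3
    linarith
  rcases hN0.eq_or_lt with h0 | h0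
  · have hDk : 0 ≤ D := integral_nonneg fun x => by positivity
    rw [← h0, zero_mul]
    positivity
  · exact main h0

end Variation

/-! ### The second variation of the constrained minimization problem -/

section SecondVariation

variable {L : ℝ} [Fact (0 < L)]

/-- Bounded measurable functions on the circle, all of whose polynomials are integrable. -/
def IsBddMeas (f : AddCircle L → ℝ) : Prop :=
  AEStronglyMeasurable f volume ∧ ∃ M, ∀ x, |f x| ≤ M

namespace IsBddMeas

variable {f g : AddCircle L → ℝ}

theorem integrable (hf : IsBddMeas f) : Integrable f volume := by
  obtain ⟨hm, M, hM⟩ := hf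
  exact Integrable.of_bound hm M (Filter.Eventually.of_forall hM)

theorem memLp (hf : IsBddMeas f) (p : ENNReal) : MemLp f p volume := by
  obtain ⟨hm, M, hM⟩ := hf
  exact MemLp.of_bound hm M (Filter.Eventually.of_forall hM)

theorem of_continuous (hf : Continuous f) : IsBddMeas f := by
  obtain ⟨C, hC⟩ := isCompact_univ.exists_bound_of_continuousOn hf.continuousOn
  exact ⟨hf.aestronglyMeasurable, C, fun x => hC x trivial⟩

theorem mul (hf : IsBddMeas f) (hg : IsBddMeas g) : IsBddMeas (fun x => f x * g x) := by
  obtain ⟨hm, M, hM⟩ := hf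
  obtain ⟨hm', M', hM'⟩ := hg
  refine ⟨hm.mul hm', M * M', fun x => ?_⟩
  rw [abs_mul]
  exact mul_le_mul (hM x) (hM' x) (abs_nonneg _) ((abs_nonneg _).trans (hM x))

theorem add (hf : IsBddMeas f) (hg : IsBddMeas g) : IsBddMeas (fun x => f x + g x) := by
  obtain ⟨hm, M, hM⟩ := hf
  obtain ⟨hm', M', hM'⟩ := hg
  exact ⟨hm.add hm', M + M', fun x => (abs_add_le _ _).trans (add_le_add (hM x) (hM' x))⟩

theorem const_mul (hf : IsBddMeas f) (c : ℝ) : IsBddMeas (fun x => c * f x) :=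
  (of_continuous continuous_const).mul hf

theorem pow (hf : IsBddMeas f) (n : ℕ) : IsBddMeas (fun x => f x ^ n) := by
  obtain ⟨hm, M, hM⟩ := hf
  refine ⟨hm.pow n, M ^ n, fun x => ?_⟩
  rw [abs_pow]
  exact pow_le_pow_left₀ (abs_nonneg _) (hM x) n

end IsBddMeas

/-- Bounded odd functions in `H¹_per` with a fixed weak derivative: the directions in which the
second variation is computed. -/
structure IsOddVariation (w w' : AddCircle L → ℝ) : Prop where
  odd : IsOdd w
  bdd : IsBddMeas w
  memLp' : MemLp w' 2 volume
  hasWeakDeriv : HasWeakDeriv w w'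

namespace IsOddVariation

variable {v v' w w' : AddCircle L → ℝ}

theorem memLp (h : IsOddVariation w w') : MemLp w 2 volume := h.bdd.memLp 2

theorem add (hv : IsOddVariation v v') (hw : IsOddVariation w w') :
    IsOddVariation (fun x => v x + w x) (fun x => v' x + w' x) where
  odd := by
    filter_upwards [hv.odd, hw.odd] with x h1 h2
    rw [h1, h2]
    ring
  bdd := hv.bdd.add hw.bdd
  memLp' := hv.memLp'.add hw.memLp'
  hasWeakDeriv := hv.hasWeakDeriv.add hv.memLp hw.memLp hv.memLp' hw.memLp' hw.hasWeakDeriv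

theorem const_mul (hw : IsOddVariation w w') (c : ℝ) :
    IsOddVariation (fun x => c * w x) (fun x => c * w' x) where
  odd := by
    filter_upwards [hw.odd] with x h1
    rw [h1, mul_neg]
  bdd := hw.bdd.const_mul c
  memLp' := hw.memLp'.const_mul c
  hasWeakDeriv := hw.hasWeakDeriv.const_smul c

end IsOddVariation

theorem IsHillSolution.isOddVariation {W v v' : AddCircle L → ℝ} (h : IsHillSolution W v v') :
    IsOddVariation v v' where
  odd := Filter.Eventually.of_forall h.odd
  bdd := IsBddMeas.of_continuous h.continuous
  memLp' := memLp_of_continuous h.continuous' 2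
  hasWeakDeriv := h.hasWeakDeriv

/-- A one-sided derivative test along `t = ε²`, with an error of third order in `ε`. -/
theorem nonneg_of_le_comp_sq {g : ℝ → ℝ} {c C : ℝ} (h0 : g 0 = 0) (hd : HasDerivAt g c 0)
    (h : ∀ ε : ℝ, 0 < ε → ε ≤ 1 → -(C * ε ^ 3) ≤ g (ε ^ 2)) : 0 ≤ c := by
  have h1 := hasDerivAt_iff_tendsto_slope_zero.1 hd
  simp only [zero_add, h0, sub_zero, smul_eq_mul] at h1
  have h2 : Filter.Tendsto (fun ε : ℝ => ε ^ 2) (nhdsWithin 0 (Set.Ioi 0))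
      (nhdsWithin 0 {0}ᶜ) := by
    refine tendsto_nhdsWithin_iff.2 ⟨?_, ?_⟩
    · have : Continuous fun ε : ℝ => ε ^ 2 := by fun_prop
      exact (by simpa using this.tendsto 0 : Filter.Tendsto (fun ε : ℝ => ε ^ 2) (nhds 0)
        (nhds 0)).mono_left nhdsWithin_le_nhds
    · filter_upwards [self_mem_nhdsWithin] with ε hε
      have : (0 : ℝ) < ε := hε
      simp [this.ne']
  have h3 : Filter.Tendsto (fun ε : ℝ => -(C * ε)) (nhdsWithin 0 (Set.Ioi 0)) (nhds 0) := by
    have : Continuous fun ε : ℝ => -(C * ε) := by fun_prop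
    exact (by simpa using this.tendsto 0 : Filter.Tendsto (fun ε : ℝ => -(C * ε)) (nhds 0)
      (nhds 0)).mono_left nhdsWithin_le_nhds
  refine le_of_tendsto_of_tendsto h3 (h1.comp h2) ?_
  filter_upwards [Ioc_mem_nhdsGT (zero_lt_one' ℝ)] with ε hε
  have h4 := h ε hε.1 hε.2
  have h5 : 0 < ε ^ 2 := pow_pos hε.1 2
  change -(C * ε) ≤ (ε ^ 2)⁻¹ * g (ε ^ 2)
  rw [inv_mul_eq_div, le_div_iff₀ h5]
  linarith

/-- Comparison of the coefficients of `ε²` in the minimality inequality along a curve. -/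
theorem le_mul_of_variation {υ D a C : ℝ} {k : ℕ} (hυ : 0 < υ)
    (h : ∀ ε : ℝ, 0 < ε → ε ≤ 1 →
      (υ + ε ^ 2 * a - C * ε ^ 3) * υ ^ k ≤ (υ + ε ^ 2 * D) ^ k * υ) : a ≤ k * D := by
  have hd : HasDerivAt (fun t : ℝ => (υ + t * D) ^ k * υ - (υ + t * a) * υ ^ k)
      (υ ^ k * (k * D - a)) 0 := by
    have h1 : HasDerivAt (fun t : ℝ => υ + t * D) (1 * D) 0 :=
      ((hasDerivAt_id 0).mul_const D).const_add υ
    have h2 : HasDerivAt (fun t : ℝ => υ + t * a) (1 * a) 0 :=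
      ((hasDerivAt_id 0).mul_const a).const_add υ
    convert! ((h1.pow k).mul_const υ).sub (h2.mul_const (υ ^ k)) using 1
    rcases k with _ | k
    · simp
    · simp only [zero_mul, add_zero, Nat.add_sub_cancel, one_mul]
      rw [pow_succ]
      ring
  have h3 := nonneg_of_le_comp_sq (C := C * υ ^ k) (by simp; ring) hd fun ε h0 h1 => by
    have := h ε h0 h1
    nlinarith
  have h4 : 0 < υ ^ k := pow_pos hυ k
  have h5 := nonneg_of_mul_nonneg_right h3 h4
  linarith

theorem add_pow_ge {a b : ℝ} (ha : 0 ≤ a) (hb : 0 ≤ b) (m : ℕ) :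
    a ^ (m + 1) + (m + 1) * a ^ m * b ≤ (a + b) ^ (m + 1) := by
  induction m with
  | zero => simp
  | succ m ih =>
    have h1 := mul_le_mul_of_nonneg_left ih (add_nonneg ha hb)
    have h2 : 0 ≤ (m + 1) * a ^ m * b * b := by positivity
    rw [pow_succ' (a + b)]
    push_cast
    rw [pow_succ a (m + 1), pow_succ a m] at *
    nlinarith

/-- The binomial formula up to second order, with continuous remainder. -/
theorem exists_add_pow_eq (n : ℕ) : ∃ r : ℝ → ℝ → ℝ, Continuous (Function.uncurry r) ∧
    ∀ x y : ℝ, (x + y) ^ (n + 2) = x ^ (n + 2) + (n + 2) * x ^ (n + 1) * y +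
      (n + 2) * (n + 1) / 2 * x ^ n * y ^ 2 + y ^ 3 * r x y := by
  induction n with
  | zero => exact ⟨fun _ _ => 0, continuous_const, fun x y => by simp; ring⟩
  | succ n ih =>
    obtain ⟨r, hr, h⟩ := ih
    refine ⟨fun x y => (n + 2) * (n + 1) / 2 * x ^ n + (x + y) * r x y, ?_, fun x y => ?_⟩
    · have h1 : Continuous fun q : ℝ × ℝ => r q.1 q.2 := hr
      exact (continuous_const.mul (continuous_fst.pow n)).add
        ((continuous_fst.add continuous_snd).mul h1)
    · rw [show n + 1 + 2 = (n + 2) + 1 by ring, pow_succ', h]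
      push_cast
      ring

theorem exists_add_pow_ge (n : ℕ) (M : ℝ) : ∃ C : ℝ, ∀ a b ε : ℝ, |a| ≤ M → |b| ≤ M →
    0 < ε → ε ≤ 1 → a ^ (n + 2) + ε * ((n + 2) * (a ^ (n + 1) * b)) +
      ε ^ 2 * ((n + 2) * (n + 1) / 2 * (a ^ n * b ^ 2)) - C * ε ^ 3 ≤ (a + ε * b) ^ (n + 2) := by
  obtain ⟨r, hr, h⟩ := exists_add_pow_eq n
  obtain ⟨C, hC⟩ := (isCompact_Icc (a := ((-M, -M) : ℝ × ℝ))
    (b := (M, M))).exists_bound_of_continuousOn hr.continuousOn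
  refine ⟨M ^ 3 * C, fun a b ε ha hb h0 h1 => ?_⟩
  have hM : 0 ≤ M := (abs_nonneg _).trans ha
  have hεb : |ε * b| ≤ M := by
    rw [abs_mul, abs_of_pos h0]
    nlinarith [abs_nonneg b]
  have h2 : |r a (ε * b)| ≤ C := hC (a, ε * b)
    ⟨⟨(abs_le.1 ha).1, (abs_le.1 hεb).1⟩, ⟨(abs_le.1 ha).2, (abs_le.1 hεb).2⟩⟩
  have h3 : |b ^ 3 * r a (ε * b)| ≤ M ^ 3 * C := by
    rw [abs_mul, abs_pow]
    exact mul_le_mul (pow_le_pow_left₀ (abs_nonneg _) hb 3) h2 (abs_nonneg _) (by positivity)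
  have h4 := (abs_le.1 h3).1
  have h5 : 0 < ε ^ 3 := by positivity
  rw [h]
  nlinarith

variable {ω : ℝ} {k : ℕ} {p p' : AddCircle L → ℝ}

theorem IsMinimizingProfile.energy_eq_mass (hk : 1 ≤ k) (h : IsMinimizingProfile ω k p p') :
    ∫ x, (p' x * p' x + ω * (p x * p x)) = ∫ x, p x ^ (2 * k) := by
  rw [integral_energy_eq hk h.hill h.hill.isOddVariation.memLp h.hill.isOddVariation.memLp'
    h.hill.hasWeakDeriv]
  refine integral_congr_ae (Filter.Eventually.of_forall fun x => ?_)
  simp only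
  rw [← pow_succ, show 2 * k - 1 + 1 = 2 * k by omega]

/-- The minimality inequality for the competitor `p + c v`. -/
theorem IsMinimizingProfile.le_add (h : IsMinimizingProfile ω k p p') {v v' : AddCircle L → ℝ}
    (hv : IsOddVariation v v') (c : ℂ) :
    (∫ x, ‖(p x : ℂ) + c * v x‖ ^ (2 * k)) * (∫ x, p x ^ (2 * k)) ^ k ≤
      (∫ x, (‖(p' x : ℂ) + c * v' x‖ ^ 2 + ω * ‖(p x : ℂ) + c * v x‖ ^ 2)) ^ k *
        ∫ x, p x ^ (2 * k) := by
  have hp := h.hill.isOddVariation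
  have m1 : MemLp (fun x => (p x : ℂ)) 2 volume := hp.memLp.ofReal
  have m2 : MemLp (fun x => (p' x : ℂ)) 2 volume := hp.memLp'.ofReal
  have m3 : MemLp (fun x => (v x : ℂ)) 2 volume := hv.memLp.ofReal
  have m4 : MemLp (fun x => (v' x : ℂ)) 2 volume := hv.memLp'.ofReal
  have d1 : HasWeakDeriv (fun x => (p x : ℂ)) (fun x => (p' x : ℂ)) :=
    hp.hasWeakDeriv.comp_clm hp.memLp hp.memLp' Complex.ofRealCLM
  have d2 : HasWeakDeriv (fun x => (v x : ℂ)) (fun x => (v' x : ℂ)) :=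
    hv.hasWeakDeriv.comp_clm hv.memLp hv.memLp' Complex.ofRealCLM
  refine h.le _ _ (m1.add (m3.const_smul c)) (m2.add (m4.const_smul c)) ?_
    (d1.add m1 (m3.const_smul c) m2 (m4.const_smul c) (d2.const_smul c))
  filter_upwards [hp.odd, hv.odd] with x h1 h2
  simp only [h1, h2]
  push_cast
  ring

/-- The second variation in imaginary directions: `𝓛₂ ≥ 0` on odd functions. -/
theorem IsMinimizingProfile.nonneg_form₂ (hk : 1 ≤ k) (h : IsMinimizingProfile ω k p p')
    {v v' : AddCircle L → ℝ} (hv : IsOddVariation v v') :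
    0 ≤ ∫ x, (v' x * v' x + (ω - p x ^ (2 * k - 2)) * (v x * v x)) := by
  have hp := h.hill.isOddVariation
  have hkp : (0 : ℝ) < k := by exact_mod_cast hk
  have i1 := integrable_mul_of_memLp_two hp.memLp' hp.memLp'
  have i2 := ((hp.bdd.mul hp.bdd).const_mul ω).integrable
  have i3 := integrable_mul_of_memLp_two hv.memLp' hv.memLp'
  have i4 := ((hv.bdd.mul hv.bdd).const_mul ω).integrable
  have i12 : Integrable (fun x => p' x * p' x + ω * (p x * p x)) volume := i1.add i2
  have i34 : Integrable (fun x => v' x * v' x + ω * (v x * v x)) volume := i3.add i4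
  have b5 := ((hp.bdd.pow (2 * k - 2)).mul (hv.bdd.mul hv.bdd))
  set D := ∫ x, (v' x * v' x + ω * (v x * v x)) with hD
  set J := ∫ x, p x ^ (2 * k - 2) * (v x * v x) with hJ
  have key := le_mul_of_variation (k := k) (D := D) (a := k * J) (C := 0) h.mass_pos
    fun ε h0 h1 => by
      have h2 := h.le_add hv (ε * Complex.I)
      have hn : ∀ a b : ℝ, ‖(a : ℂ) + ε * Complex.I * b‖ ^ 2 = a * a + ε ^ 2 * (b * b) := by
        intro a b
        rw [← Complex.normSq_eq_norm_sq, Complex.normSq_apply]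
        simp
        ring
      have hen : ∫ x, (‖(p' x : ℂ) + ε * Complex.I * v' x‖ ^ 2 +
          ω * ‖(p x : ℂ) + ε * Complex.I * v x‖ ^ 2) = (∫ x, p x ^ (2 * k)) + ε ^ 2 * D := by
        rw [← h.energy_eq_mass hk, hD, ← integral_const_mul,
          ← integral_add i12 (i34.const_mul _)]
        refine integral_congr_ae (Filter.Eventually.of_forall fun x => ?_)
        simp only [hn]
        ring
      have hma : (∫ x, p x ^ (2 * k)) + ε ^ 2 * (k * J) - 0 * ε ^ 3 ≤
          ∫ x, ‖(p x : ℂ) + ε * Complex.I * v x‖ ^ (2 * k) := by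
        rw [zero_mul, sub_zero, hJ, ← mul_assoc, ← integral_const_mul,
          ← integral_add (hp.bdd.pow _).integrable (b5.integrable.const_mul _)]
        have b6 : IsBddMeas fun x => ‖(p x : ℂ) + ε * Complex.I * v x‖ ^ (2 * k) := by
          simp only [pow_mul, hn]
          exact ((hp.bdd.mul hp.bdd).add ((hv.bdd.mul hv.bdd).const_mul _)).pow k
        refine integral_mono ((hp.bdd.pow _).integrable.add (b5.integrable.const_mul _))
          b6.integrable fun x => ?_
        simp only [pow_mul _ 2 k, hn]
        obtain ⟨m, rfl⟩ : ∃ m, k = m + 1 := ⟨k - 1, by omega⟩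
        have h3 := add_pow_ge (mul_self_nonneg (p x))
          (mul_nonneg (sq_nonneg ε) (mul_self_nonneg (v x))) m
        rw [show 2 * (m + 1) - 2 = 2 * m by omega, pow_mul, sq (p x)]
        push_cast
        nlinarith
      rw [hen] at h2
      refine le_trans (mul_le_mul_of_nonneg_right hma ?_) h2
      exact pow_nonneg h.mass_pos.le k
  have h4 : J ≤ D := le_of_mul_le_mul_left key hkp
  have h5 : ∫ x, (v' x * v' x + (ω - p x ^ (2 * k - 2)) * (v x * v x)) = D - J := by
    rw [hD, hJ, ← integral_sub i34 b5.integrable]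
    refine integral_congr_ae (Filter.Eventually.of_forall fun x => ?_)
    ring
  rw [h5]
  linarith

/-- The second variation in real directions: `𝓛₁ ≥ 0` on the odd functions which are tangent to
the constraint. -/
theorem IsMinimizingProfile.nonneg_form₁ (hk : 1 ≤ k) (h : IsMinimizingProfile ω k p p')
    {w w' : AddCircle L → ℝ} (hw : IsOddVariation w w')
    (hort : ∫ x, p x ^ (2 * k - 1) * w x = 0) :
    0 ≤ ∫ x, (w' x * w' x + (ω - (2 * k - 1) * p x ^ (2 * k - 2)) * (w x * w x)) := by
  have hp := h.hill.isOddVariation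
  have hkp : (0 : ℝ) < k := by exact_mod_cast hk
  have i1 := integrable_mul_of_memLp_two hp.memLp' hp.memLp'
  have i2 := ((hp.bdd.mul hp.bdd).const_mul ω).integrable
  have i3 := integrable_mul_of_memLp_two hw.memLp' hw.memLp'
  have i4 := ((hw.bdd.mul hw.bdd).const_mul ω).integrable
  have i12 : Integrable (fun x => p' x * p' x + ω * (p x * p x)) volume := i1.add i2
  have i34 : Integrable (fun x => w' x * w' x + ω * (w x * w x)) volume := i3.add i4
  have i5 := integrable_mul_of_memLp_two hp.memLp' hw.memLp'
  have i6 := ((hp.bdd.mul hw.bdd).const_mul ω).integrable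
  have i56 : Integrable (fun x => p' x * w' x + ω * (p x * w x)) volume := i5.add i6
  have b5 := (hp.bdd.pow (2 * k - 2)).mul (hw.bdd.pow 2)
  have b7 := (hp.bdd.pow (2 * k - 1)).mul hw.bdd
  set D := ∫ x, (w' x * w' x + ω * (w x * w x)) with hD
  set J := ∫ x, p x ^ (2 * k - 2) * w x ^ 2 with hJ
  have hcross : ∫ x, (p' x * w' x + ω * (p x * w x)) = 0 := by
    rw [integral_energy_eq hk h.hill hw.memLp hw.memLp' hw.hasWeakDeriv, hort]
  obtain ⟨M₁, hM₁⟩ := hp.bdd.2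
  obtain ⟨M₂, hM₂⟩ := hw.bdd.2
  obtain ⟨C, hC⟩ := exists_add_pow_ge (2 * k - 2) (max M₁ M₂)
  have hL : 0 < L := Fact.out
  have key := le_mul_of_variation (k := k) (D := D) (a := k * ((2 * k - 1) * J)) (C := L * C)
    h.mass_pos fun ε h0 h1 => by
      have h2 := h.le_add hw (ε : ℂ)
      have hn : ∀ a b : ℝ, ‖(a : ℂ) + ε * b‖ ^ 2 = (a + ε * b) ^ 2 := by
        intro a b
        rw [← Complex.ofReal_mul, ← Complex.ofReal_add, Complex.norm_real, Real.norm_eq_abs, sq_abs]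
      have hen : ∫ x, (‖(p' x : ℂ) + ε * w' x‖ ^ 2 + ω * ‖(p x : ℂ) + ε * w x‖ ^ 2) =
          (∫ x, p x ^ (2 * k)) + ε ^ 2 * D := by
        have i1256 : Integrable (fun x => p' x * p' x + ω * (p x * p x) +
            2 * ε * (p' x * w' x + ω * (p x * w x))) volume := i12.add (i56.const_mul _)
        have h3 : (∫ x, p x ^ (2 * k)) + ε ^ 2 * D =
            (∫ x, (p' x * p' x + ω * (p x * p x))) +
              (2 * ε) * (∫ x, (p' x * w' x + ω * (p x * w x))) + ε ^ 2 * D := by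
          rw [hcross, h.energy_eq_mass hk, mul_zero, add_zero]
        rw [h3, hD, ← integral_const_mul, ← integral_const_mul,
          ← integral_add i12 (i56.const_mul _),
          ← integral_add i1256 (i34.const_mul _)]
        refine integral_congr_ae (Filter.Eventually.of_forall fun x => ?_)
        simp only [hn]
        ring
      have hma : (∫ x, p x ^ (2 * k)) + ε ^ 2 * (k * ((2 * k - 1) * J)) - L * C * ε ^ 3 ≤
          ∫ x, ‖(p x : ℂ) + ε * w x‖ ^ (2 * k) := by
        have h3 : (∫ x, p x ^ (2 * k)) + ε ^ 2 * (k * ((2 * k - 1) * J)) - L * C * ε ^ 3 =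
            (∫ x, p x ^ (2 * k)) + (ε * (2 * k)) * (∫ x, p x ^ (2 * k - 1) * w x) +
              (ε ^ 2 * (k * (2 * k - 1))) * J - ∫ _ : AddCircle L, C * ε ^ 3 := by
          rw [hort, integral_const, volume_real_univ_circle, smul_eq_mul]
          ring
        have b8 : IsBddMeas fun x => ‖(p x : ℂ) + ε * w x‖ ^ (2 * k) := by
          simp only [pow_mul, hn]
          exact ((hp.bdd.add (hw.bdd.const_mul _)).pow 2).pow k
        have i7 : Integrable (fun x => p x ^ (2 * k) + (ε * (2 * k)) * (p x ^ (2 * k - 1) * w x) +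
            (ε ^ 2 * (k * (2 * k - 1))) * (p x ^ (2 * k - 2) * w x ^ 2)) volume :=
          (((hp.bdd.pow _).add (b7.const_mul _)).add (b5.const_mul _)).integrable
        rw [h3, hJ, ← integral_const_mul, ← integral_const_mul,
          ← integral_add (hp.bdd.pow _).integrable (b7.const_mul _).integrable,
          ← integral_add ((hp.bdd.pow _).add (b7.const_mul _)).integrable
            (b5.const_mul _).integrable,
          ← integral_sub i7 (integrable_const _)]
        refine integral_mono (i7.sub (integrable_const _)) b8.integrable fun x => ?_
        simp only [pow_mul _ 2 k, hn]
        have h4 := hC (p x) (w x) ε ((hM₁ x).trans (le_max_left _ _))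
          ((hM₂ x).trans (le_max_right _ _)) h0 h1
        rw [← pow_mul _ 2 k, ← pow_mul _ 2 k]
        have e1 : 2 * k - 2 + 2 = 2 * k := by omega
        have e2 : 2 * k - 2 + 1 = 2 * k - 1 := by omega
        have e3 : ((2 * k - 2 : ℕ) : ℝ) = 2 * k - 2 := by
          rw [Nat.cast_sub (by omega)]
          push_cast
          ring
        rw [e1, e2, e3] at h4
        refine le_trans (le_of_eq ?_) h4
        ring
      rw [hen] at h2
      exact le_trans (mul_le_mul_of_nonneg_right hma (pow_nonneg h.mass_pos.le k)) h2
  have h4 : (2 * k - 1) * J ≤ D := le_of_mul_le_mul_left key hkp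
  have h5 : ∫ x, (w' x * w' x + (ω - (2 * k - 1) * p x ^ (2 * k - 2)) * (w x * w x)) =
      D - (2 * k - 1) * J := by
    rw [hD, hJ, ← integral_const_mul, ← integral_sub i34 (b5.const_mul _).integrable]
    refine integral_congr_ae (Filter.Eventually.of_forall fun x => ?_)
    ring
  rw [h5]
  linarith

end SecondVariation

/-! ### Quadratic forms of Hill operators and truncations -/

section Forms

variable {L : ℝ} [Fact (0 < L)]

/-- The bilinear form of `-∂ₓ² + W`, evaluated at functions with given derivatives. -/
def hillForm (W u u' w w' : AddCircle L → ℝ) : ℝ := ∫ x, (u' x * w' x + W x * (u x * w x))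

variable {W u u' v v' w w' : AddCircle L → ℝ}

theorem hillForm_comm : hillForm W u u' w w' = hillForm W w w' u u' := by
  refine integral_congr_ae (Filter.Eventually.of_forall fun x => ?_)
  simp only
  ring

theorem integrable_hillForm (hW : Continuous W) (hu : IsOddVariation u u')
    (hw : IsOddVariation w w') : Integrable (fun x => u' x * w' x + W x * (u x * w x)) volume :=
  (integrable_mul_of_memLp_two hu.memLp' hw.memLp').add
    ((IsBddMeas.of_continuous hW).mul (hu.bdd.mul hw.bdd)).integrable

theorem hillForm_add_left (hW : Continuous W) (hu : IsOddVariation u u')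
    (hv : IsOddVariation v v') (hw : IsOddVariation w w') :
    hillForm W (fun x => u x + v x) (fun x => u' x + v' x) w w' =
      hillForm W u u' w w' + hillForm W v v' w w' := by
  rw [hillForm, hillForm, hillForm,
    ← integral_add (integrable_hillForm hW hu hw) (integrable_hillForm hW hv hw)]
  refine integral_congr_ae (Filter.Eventually.of_forall fun x => ?_)
  simp only
  ring

theorem hillForm_const_mul_left (c : ℝ) :
    hillForm W (fun x => c * u x) (fun x => c * u' x) w w' = c * hillForm W u u' w w' := by
  rw [hillForm, hillForm, ← integral_const_mul]
  refine integral_congr_ae (Filter.Eventually.of_forall fun x => ?_)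
  simp only
  ring

theorem hillForm_add_self (hW : Continuous W) (hu : IsOddVariation u u')
    (hv : IsOddVariation v v') :
    hillForm W (fun x => u x + v x) (fun x => u' x + v' x) (fun x => u x + v x)
      (fun x => u' x + v' x) =
      hillForm W u u' u u' + 2 * hillForm W u u' v v' + hillForm W v v' v v' := by
  rw [hillForm_add_left hW hu hv (hu.add hv), hillForm_comm, hillForm_add_left hW hu hv hu,
    hillForm_comm (u := v) (w := fun x => u x + v x), hillForm_add_left hW hu hv hv,
    hillForm_comm (u := v) (w := u)]
  ring

/-- A null vector of a semidefinite form lies in its radical. -/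
theorem hillForm_eq_zero_of_nonneg (hW : Continuous W) (hu : IsOddVariation u u')
    (hv : IsOddVariation v v') (h0 : hillForm W u u' u u' = 0)
    (h : ∀ t : ℝ, 0 ≤ hillForm W (fun x => u x + t * v x) (fun x => u' x + t * v' x)
      (fun x => u x + t * v x) (fun x => u' x + t * v' x)) : hillForm W u u' v v' = 0 := by
  set β := hillForm W u u' v v' with hβ
  set γ := hillForm W v v' v v' with hγ
  have h1 : ∀ t : ℝ, 0 ≤ 2 * (t * β) + t * (t * γ) := by
    intro t
    have h2 := h t
    rw [hillForm_add_self hW hu (hv.const_mul t), h0, zero_add,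
      hillForm_comm (u := u) (w := fun x => t * v x), hillForm_const_mul_left,
      hillForm_const_mul_left, hillForm_comm (u := v) (w := fun x => t * v x),
      hillForm_const_mul_left, hillForm_comm (u := v) (w := u)] at h2
    exact h2
  by_contra hne
  have hg : 0 < |γ| + 1 := by positivity
  have h3 := h1 (-(β / (|γ| + 1)))
  have h4 : 0 < β ^ 2 := by positivity
  have h5 : 2 * (-(β / (|γ| + 1)) * β) + -(β / (|γ| + 1)) * (-(β / (|γ| + 1)) * γ) =
      β ^ 2 * (γ - 2 * (|γ| + 1)) / (|γ| + 1) ^ 2 := by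
    field_simp
    ring
  rw [h5] at h3
  have h6 : β ^ 2 * (γ - 2 * (|γ| + 1)) < 0 :=
    mul_neg_of_pos_of_neg h4 (by linarith [le_abs_self γ, abs_nonneg γ])
  exact absurd h3 (not_le.2 (div_neg_of_neg_of_pos h6 (by positivity)))

variable (L) in
/-- The set of the points at distance between `a` and `b` from the origin. -/
def shell (a b : ℝ) : Set (AddCircle L) := {x | a ≤ ‖x‖ ∧ ‖x‖ ≤ b}

theorem measurableSet_shell (a b : ℝ) : MeasurableSet (shell L a b) :=
  ((isClosed_le continuous_const continuous_norm).inter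
    (isClosed_le continuous_norm continuous_const)).measurableSet

theorem neg_mem_shell {a b : ℝ} {x : AddCircle L} : -x ∈ shell L a b ↔ x ∈ shell L a b := by
  simp [shell]

theorem norm_coe_of_mem_Icc {t : ℝ} (ht : t ∈ Set.Icc 0 (L / 2)) : ‖(t : AddCircle L)‖ = t := by
  have hL : 0 < L := Fact.out
  rw [(AddCircle.norm_coe_eq_abs_iff (p := L) hL.ne').2, abs_of_nonneg ht.1]
  rw [abs_of_nonneg ht.1, abs_of_pos hL]
  exact ht.2

theorem integral_indicator_shell {F : AddCircle L → ℝ} (hF : Continuous F) {a b : ℝ}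
    (ha : 0 ≤ a) (hab : a ≤ b) (hb : b ≤ L / 2) :
    ∫ x, (shell L a b).indicator F x = ∫ t in a..b, (F t + F ((-t : ℝ) : AddCircle L)) := by
  have hL : 0 < L := Fact.out
  have hi : Integrable ((shell L a b).indicator F) volume :=
    (IsBddMeas.of_continuous hF).integrable.indicator (measurableSet_shell a b)
  have hii := fun c d => intervalIntegrable_coe hi c d
  have hii' : ∀ c d, IntervalIntegrable
      (fun t : ℝ => (shell L a b).indicator F ((-t : ℝ) : AddCircle L)) volume c d := by
    intro c d
    have := (intervalIntegrable_coe hi (-c) (-d)).comp_mul_left (c := -1)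
    simpa using this
  rw [← AddCircle.intervalIntegral_preimage L (-(L / 2)), show -(L / 2) + L = L / 2 by ring,
    ← intervalIntegral.integral_add_adjacent_intervals (hii _ 0) (hii 0 _)]
  have h1 := intervalIntegral.integral_comp_neg (a := 0) (b := L / 2)
    (fun t : ℝ => (shell L a b).indicator F (t : AddCircle L))
  rw [neg_zero] at h1
  rw [← h1, ← intervalIntegral.integral_add (hii' _ _) (hii _ _),
    intervalIntegral.integral_of_le (by linarith), intervalIntegral.integral_of_le hab,
    ← integral_Icc_eq_integral_Ioc, ← integral_Icc_eq_integral_Ioc]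
  have h2 : ∀ t ∈ Set.Icc 0 (L / 2), (shell L a b).indicator F ((-t : ℝ) : AddCircle L) +
      (shell L a b).indicator F (t : AddCircle L) =
      (Set.Icc a b).indicator (fun t : ℝ => F t + F ((-t : ℝ) : AddCircle L)) t := by
    intro t ht
    have hn := norm_coe_of_mem_Icc ht
    have hm : (t : AddCircle L) ∈ shell L a b ↔ t ∈ Set.Icc a b := by
      simp only [shell, Set.mem_ofPred_eq, hn, Set.mem_Icc]
    have hm' : ((-t : ℝ) : AddCircle L) ∈ shell L a b ↔ t ∈ Set.Icc a b := by
      rw [AddCircle.coe_neg, neg_mem_shell, hm]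
    by_cases h : t ∈ Set.Icc a b
    · rw [Set.indicator_of_mem h, Set.indicator_of_mem (hm.2 h), Set.indicator_of_mem (hm'.2 h),
        add_comm]
    · rw [Set.indicator_of_notMem h, Set.indicator_of_notMem (fun h' => h (hm.1 h')),
        Set.indicator_of_notMem (fun h' => h (hm'.1 h')), add_zero]
  rw [setIntegral_congr_fun measurableSet_Icc h2, setIntegral_indicator measurableSet_Icc,
    Set.inter_eq_right.2 (Set.Icc_subset_Icc ha hb)]

/-- The integral of a derivative over a shell. -/
theorem integral_indicator_shell_of_hasDerivAt {F G : AddCircle L → ℝ} (hF : Continuous F)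
    (hG : ∀ x : ℝ, HasDerivAt (fun y : ℝ => G y) (F x) x) {a b : ℝ}
    (ha : 0 ≤ a) (hab : a ≤ b) (hb : b ≤ L / 2) :
    ∫ x, (shell L a b).indicator F x =
      (G b - G ((-b : ℝ) : AddCircle L)) - (G a - G ((-a : ℝ) : AddCircle L)) := by
  rw [integral_indicator_shell hF ha hab hb]
  have hd : ∀ t : ℝ, HasDerivAt (fun y : ℝ => G y - G ((-y : ℝ) : AddCircle L))
      (F t + F ((-t : ℝ) : AddCircle L)) t := by
    intro t
    have h1 := HasDerivAt.scomp t (hG (-t)) (hasDerivAt_neg t)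
    have h2 := (hG t).sub h1
    simp only [neg_smul, one_smul, sub_neg_eq_add] at h2
    exact h2
  have hc : Continuous fun t : ℝ => F t + F ((-t : ℝ) : AddCircle L) :=
    (hF.comp (AddCircle.continuous_mk' L)).add
      (hF.comp ((AddCircle.continuous_mk' L).comp continuous_neg))
  exact intervalIntegral.integral_eq_sub_of_hasDerivAt (fun t _ => hd t)
    (hc.intervalIntegrable _ _)

/-- The truncation of an odd solution between two of its zeros is in `H¹_per`. -/
theorem IsHillSolution.isOddVariation_indicator (h : IsHillSolution W v v') {a b : ℝ}
    (ha : 0 ≤ a) (hab : a ≤ b) (hb : b ≤ L / 2) (hva : v a = 0) (hvb : v b = 0) :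
    IsOddVariation ((shell L a b).indicator v) ((shell L a b).indicator v') where
  odd := by
    refine Filter.Eventually.of_forall fun x => ?_
    by_cases hx : x ∈ shell L a b
    · rw [Set.indicator_of_mem hx, Set.indicator_of_mem (neg_mem_shell.2 hx), h.odd]
    · rw [Set.indicator_of_notMem hx, Set.indicator_of_notMem (fun h' => hx (neg_mem_shell.1 h')),
        neg_zero]
  bdd := by
    obtain ⟨hm, M, hM⟩ := IsBddMeas.of_continuous h.continuous
    refine ⟨hm.indicator (measurableSet_shell a b), M, fun x => ?_⟩
    exact (norm_indicator_le_norm_self v x).trans (hM x)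
  memLp' := (memLp_of_continuous h.continuous' 2).indicator (measurableSet_shell a b)
  hasWeakDeriv := by
    intro ψ ψ' hψ
    have hc := hψ.continuous
    have hi1 : Integrable (fun x => ψ' x * (shell L a b).indicator v x) volume :=
      integrable_mul (𝕜 := ℝ) hc.2
        ((memLp_of_continuous h.continuous 2).indicator (measurableSet_shell a b))
    have hi2 : Integrable (fun x => ψ x * (shell L a b).indicator v' x) volume :=
      integrable_mul (𝕜 := ℝ) hc.1
        ((memLp_of_continuous h.continuous' 2).indicator (measurableSet_shell a b))
    have h1 := integral_indicator_shell_of_hasDerivAt (F := fun x => ψ' x * v x + ψ x * v' x)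
      (G := fun x => ψ x * v x) ((hc.2.mul h.continuous).add (hc.1.mul h.continuous'))
      (fun x => (hψ.2 x).mul (h.deriv x)) ha hab hb
    rw [h.odd_coe, h.odd_coe, hva, hvb] at h1
    simp only [neg_zero, mul_zero, sub_zero] at h1
    change ∫ x, ψ' x * (shell L a b).indicator v x =
      -∫ x, ψ x * (shell L a b).indicator v' x
    rw [eq_neg_iff_add_eq_zero, ← integral_add hi1 hi2, ← h1]
    refine integral_congr_ae (Filter.Eventually.of_forall fun x => ?_)
    by_cases hx : x ∈ shell L a b
    · simp only [Set.indicator_of_mem hx]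
    · simp only [Set.indicator_of_notMem hx, mul_zero, add_zero]

/-- The form at a truncated solution only sees the end points. -/
theorem IsHillSolution.hillForm_indicator (h : IsHillSolution W v v') (hW : Continuous W)
    {η η' : AddCircle L → ℝ} (hη : ∀ x : ℝ, HasDerivAt (fun y : ℝ => η y) (η' x) x)
    (hη' : Continuous η') (hodd : ∀ x, η (-x) = -η x) {a b : ℝ}
    (ha : 0 ≤ a) (hab : a ≤ b) (hb : b ≤ L / 2) :
    hillForm W ((shell L a b).indicator v) ((shell L a b).indicator v') η η' =
      2 * (v' b * η b - v' a * η a) := by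
  have hηc := continuous_of_hasDerivAt hη
  have h1 := integral_indicator_shell_of_hasDerivAt (F := fun x => W x * v x * η x + v' x * η' x)
    (G := fun x => v' x * η x)
    (((hW.mul h.continuous).mul hηc).add (h.continuous'.mul hη'))
    (fun x => (h.deriv' x).mul (hη x)) ha hab hb
  rw [AddCircle.coe_neg, AddCircle.coe_neg, h.even', h.even', hodd, hodd] at h1
  have h2 : hillForm W ((shell L a b).indicator v) ((shell L a b).indicator v') η η' =
      ∫ x, (shell L a b).indicator (fun x => W x * v x * η x + v' x * η' x) x := by
    refine integral_congr_ae (Filter.Eventually.of_forall fun x => ?_)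
    by_cases hx : x ∈ shell L a b
    · simp only [Set.indicator_of_mem hx]
      ring
    · simp only [Set.indicator_of_notMem hx, zero_mul, mul_zero, add_zero]
  rw [h2, h1]
  ring

theorem IsHillSolution.hillForm_indicator_self (h : IsHillSolution W v v') (hW : Continuous W)
    {a b : ℝ} (ha : 0 ≤ a) (hab : a ≤ b) (hb : b ≤ L / 2) (hva : v a = 0) (hvb : v b = 0) :
    hillForm W ((shell L a b).indicator v) ((shell L a b).indicator v')
      ((shell L a b).indicator v) ((shell L a b).indicator v') = 0 := by
  have h1 := h.hillForm_indicator hW h.deriv h.continuous' h.odd ha hab hb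
  rw [hva, hvb, mul_zero, mul_zero, sub_zero, mul_zero] at h1
  rw [← h1]
  refine integral_congr_ae (Filter.Eventually.of_forall fun x => ?_)
  by_cases hx : x ∈ shell L a b
  · simp only [Set.indicator_of_mem hx]
  · simp only [Set.indicator_of_notMem hx, zero_mul, mul_zero]

theorem hillForm_indicator_of_disjoint {a b c d : ℝ} (hbc : b < c) :
    hillForm W ((shell L a b).indicator u) ((shell L a b).indicator u')
      ((shell L c d).indicator v) ((shell L c d).indicator v') = 0 := by
  rw [hillForm, ← integral_zero (AddCircle L) ℝ]
  refine integral_congr_ae (Filter.Eventually.of_forall fun x => ?_)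
  by_cases hx : x ∈ shell L a b
  · have hx' : x ∉ shell L c d := fun h' => by linarith [hx.2, h'.1]
    simp only [Set.indicator_of_notMem hx', mul_zero, add_zero]
  · simp only [Set.indicator_of_notMem hx, zero_mul, mul_zero, add_zero]

/-- The odd test functions `sin (2 π n x / L)`. -/
theorem exists_sin (L : ℝ) [Fact (0 < L)] (n : ℤ) : ∃ η η' : AddCircle L → ℝ,
    (∀ x : ℝ, η x = Real.sin (2 * Real.pi * n * x / L)) ∧
    (∀ x : ℝ, HasDerivAt (fun y : ℝ => η y) (η' x) x) ∧ Continuous η' ∧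
    (∀ x, η (-x) = -η x) ∧ IsOddVariation η η' := by
  obtain ⟨η', h⟩ := isTestPair_im_fourier (L := L) n
  have hv : ∀ x : ℝ, (fourier n (x : AddCircle L)).im = Real.sin (2 * Real.pi * n * x / L) := by
    intro x
    rw [fourier_coe_apply, show (2 * Real.pi * Complex.I * n * x / L : ℂ) =
      ((2 * Real.pi * n * x / L : ℝ) : ℂ) * Complex.I by push_cast; ring, Complex.exp_ofReal_mul_I_im]
  have hodd : ∀ x : AddCircle L, (fourier n (-x)).im = -(fourier n x).im := by
    intro x
    induction x using QuotientAddGroup.induction_on with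
    | H x =>
      have h1 := hv (-x)
      rw [AddCircle.coe_neg] at h1
      change (fourier n (-(x : AddCircle L))).im = -(fourier n (x : AddCircle L)).im
      rw [h1, hv, ← Real.sin_neg]
      congr 1
      ring
  refine ⟨fun x => (fourier n x).im, η', hv, h.2, h.continuous.2, hodd, ?_⟩
  exact ⟨Filter.Eventually.of_forall hodd, IsBddMeas.of_continuous h.continuous.1,
    memLp_of_continuous h.continuous.2 2,
    (isPrimitive_of_hasDerivAt h.continuous.2 h.2).hasWeakDeriv
      (memLp_of_continuous h.continuous.2 2)⟩

end Forms

/-! ### Sign of the profile and kernels of the two Hill operators in the odd sector -/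

section Sturm

theorem nonneg_of_hasDerivAt_of_nonneg_right {f : ℝ → ℝ} {f' a b : ℝ} (hab : a < b)
    (hd : HasDerivAt f f' a) (h0 : f a = 0) (h : ∀ x ∈ Set.Ioo a b, 0 ≤ f x) : 0 ≤ f' := by
  have h1 := (hasDerivAt_iff_tendsto_slope.1 hd).mono_left
    (nhdsWithin_mono a (fun x (hx : x ∈ Set.Ioi a) => ne_of_gt hx))
  refine ge_of_tendsto h1 ?_
  filter_upwards [Ioo_mem_nhdsGT hab] with x hx
  rw [slope_def_field, h0, sub_zero]
  exact div_nonneg (h x hx) (sub_nonneg.2 hx.1.le)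

theorem nonpos_of_hasDerivAt_of_nonneg_left {f : ℝ → ℝ} {f' a b : ℝ} (hab : a < b)
    (hd : HasDerivAt f f' b) (h0 : f b = 0) (h : ∀ x ∈ Set.Ioo a b, 0 ≤ f x) : f' ≤ 0 := by
  have h1 := (hasDerivAt_iff_tendsto_slope.1 hd).mono_left
    (nhdsWithin_mono b (fun x (hx : x ∈ Set.Iio b) => ne_of_lt hx))
  refine le_of_tendsto h1 ?_
  filter_upwards [Ioo_mem_nhdsLT hab] with x hx
  rw [slope_def_field, h0, sub_zero]
  exact div_nonpos_of_nonneg_of_nonpos (h x hx) (sub_nonpos.2 hx.2.le)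

theorem sin_two_pi_mul_pos {L c : ℝ} (hc : 0 < c) (hc' : c < L / 2) :
    0 < Real.sin (2 * Real.pi * c / L) := by
  have hL : 0 < L := by linarith
  refine Real.sin_pos_of_pos_of_lt_pi (by positivity) ?_
  rw [div_lt_iff₀ hL]
  nlinarith [Real.pi_pos]

variable {L : ℝ} [Fact (0 < L)]

/-- The potential of `𝓛₁`, for the exponent `α = 2k - 2` and the profile `p`. -/
abbrev potential₁ (ω : ℝ) (k : ℕ) (p : AddCircle L → ℝ) (x : AddCircle L) : ℝ :=
  ω - (2 * (k : ℝ) - 1) * p x ^ (2 * k - 2)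

/-- The potential of `𝓛₂`, for the exponent `α = 2k - 2` and the profile `p`. -/
abbrev potential₂ (ω : ℝ) (k : ℕ) (p : AddCircle L → ℝ) (x : AddCircle L) : ℝ :=
  ω - p x ^ (2 * k - 2)

theorem continuous_potential₁ {p : AddCircle L → ℝ} (hp : Continuous p) (ω : ℝ) (k : ℕ) :
    Continuous (potential₁ ω k p) :=
  continuous_const.sub (continuous_const.mul (hp.pow _))

theorem continuous_potential₂ {p : AddCircle L → ℝ} (hp : Continuous p) (ω : ℝ) (k : ℕ) :
    Continuous (potential₂ ω k p) :=
  continuous_const.sub (hp.pow _)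

theorem IsHillSolution.hillForm_eq_zero {W v v' η η' : AddCircle L → ℝ}
    (h : IsHillSolution W v v') (hW : Continuous W) (hη : IsOddVariation η η') :
    hillForm W v v' η η' = 0 := by
  have hWv : MemLp (fun x => W x * v x) 2 volume := memLp_of_continuous (hW.mul h.continuous) 2
  have hv' := memLp_of_continuous h.continuous' 2
  have h1 := (h.hasWeakDeriv' hW).integral_mul_add_mul hη.hasWeakDeriv hv' hWv hη.memLp hη.memLp'
  rw [← integral_add (integrable_mul_of_memLp_two hWv hη.memLp)
    (integrable_mul_of_memLp_two hv' hη.memLp')] at h1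
  rw [← h1]
  refine integral_congr_ae (Filter.Eventually.of_forall fun x => ?_)
  simp only
  ring

namespace IsMinimizingProfile

variable {ω : ℝ} {k : ℕ} {p p' : AddCircle L → ℝ}

theorem ne_zero (hk : 1 ≤ k) (h : IsMinimizingProfile ω k p p') : p ≠ 0 := by
  rintro rfl
  have h1 := h.mass_pos
  simp [show k ≠ 0 by omega] at h1

theorem deriv_ne_zero (hk : 1 ≤ k) (h : IsMinimizingProfile ω k p p') {c : ℝ} (hc : p c = 0) :
    p' c ≠ 0 := fun hc' =>
  h.ne_zero hk (h.hill.eq_zero (continuous_potential₂ h.hill.continuous ω k) hc hc')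

/-- A zero of `p` inside a half period would make the truncation of `p` at it a null vector of the
nonnegative form of `𝓛₂`, hence a solution, although it has a corner. -/
theorem apply_ne_zero (hk : 1 ≤ k) (h : IsMinimizingProfile ω k p p') {c : ℝ} (hc : 0 < c)
    (hc' : c < L / 2) : p c ≠ 0 := by
  intro h0
  have hW := continuous_potential₂ h.hill.continuous ω k
  have hp0 : p ((0 : ℝ) : AddCircle L) = 0 := h.hill.apply_zero
  obtain ⟨η, η', hs, hd, hη', hodd, hη⟩ := exists_sin L 1
  have hw := h.hill.isOddVariation_indicator le_rfl hc.le hc'.le hp0 h0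
  have h1 := h.hill.hillForm_indicator_self hW le_rfl hc.le hc'.le hp0 h0
  have h2 := hillForm_eq_zero_of_nonneg hW hw hη h1
    (fun t => h.nonneg_form₂ hk (hw.add (hη.const_mul t)))
  rw [h.hill.hillForm_indicator hW hd hη' hodd le_rfl hc.le hc'.le, hs, hs] at h2
  have h3 := sin_two_pi_mul_pos hc hc'
  simp only [Int.cast_one, mul_one, mul_zero, zero_div, Real.sin_zero, sub_zero, mul_eq_zero,
    OfNat.ofNat_ne_zero, false_or, h3.ne', or_false] at h2
  exact h.deriv_ne_zero hk h0 h2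

protected theorem neg (h : IsMinimizingProfile ω k p p') :
    IsMinimizingProfile ω k (fun x => -p x) (fun x => -p' x) := by
  have e1 : ∀ x, (-p x) ^ (2 * k) = p x ^ (2 * k) := fun x => (even_two_mul k).neg_pow _
  have e2 : ∀ x, (-p x) ^ (2 * k - 2) = p x ^ (2 * k - 2) := fun x =>
    Even.neg_pow ⟨k - 1, by omega⟩ _
  refine ⟨?_, ?_, ?_⟩
  · have := h.hill.const_mul (-1)
    simpa only [e2, neg_mul, one_mul] using this
  · simpa only [e1] using h.mass_pos
  · simpa only [e1] using h.le

theorem pos_or_neg (hk : 1 ≤ k) (h : IsMinimizingProfile ω k p p') :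
    (∀ c : ℝ, 0 < c → c < L / 2 → 0 < p c) ∨ ∀ c : ℝ, 0 < c → c < L / 2 → p c < 0 := by
  have hc : ContinuousOn (fun x : ℝ => p x) (Set.Ioo 0 (L / 2)) :=
    (h.hill.continuous.comp (AddCircle.continuous_mk' L)).continuousOn
  by_contra hcon
  push Not at hcon
  obtain ⟨⟨a, ha, ha', hpa⟩, b, hb, hb', hpb⟩ := hcon
  obtain ⟨c, hc1, hc2⟩ := isPreconnected_Ioo.intermediate_value ⟨ha, ha'⟩ ⟨hb, hb'⟩ hc ⟨hpa, hpb⟩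
  exact h.apply_ne_zero hk hc1.1 hc1.2 hc2

/-- The weak form of `𝓛₁ p = -(2k-2) p^(2k-1)`. -/
theorem hillForm₁_profile (hk : 1 ≤ k) (h : IsMinimizingProfile ω k p p') {w w' : AddCircle L → ℝ}
    (hw : IsOddVariation w w') :
    hillForm (potential₁ ω k p) p p' w w' = -(2 * k - 2) * ∫ x, p x ^ (2 * k - 1) * w x := by
  have hp := h.hill.isOddVariation
  have i1 : Integrable (fun x => p' x * w' x + ω * (p x * w x)) volume :=
    (integrable_mul_of_memLp_two hp.memLp' hw.memLp').add ((hp.bdd.mul hw.bdd).const_mul ω).integrable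
  have i2 := ((hp.bdd.pow (2 * k - 1)).mul hw.bdd).integrable
  have h1 := integral_energy_eq hk h.hill hw.memLp hw.memLp' hw.hasWeakDeriv
  have h2 : hillForm (potential₁ ω k p) p p' w w' =
      ∫ x, ((p' x * w' x + ω * (p x * w x)) - (2 * (k : ℝ) - 1) * (p x ^ (2 * k - 1) * w x)) := by
    refine integral_congr_ae (Filter.Eventually.of_forall fun x => ?_)
    simp only
    rw [show 2 * k - 1 = 2 * k - 2 + 1 by omega, pow_succ]
    ring
  rw [h2, integral_sub i1 (i2.const_mul _), h1, integral_const_mul]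
  ring

/-- A null vector of the form of `𝓛₁` satisfying the constraint lies in the radical of the form. -/
theorem hillForm₁_eq_zero (hk : 1 ≤ k) (h : IsMinimizingProfile ω k p p')
    {w w' η η' : AddCircle L → ℝ} (hw : IsOddVariation w w') (hη : IsOddVariation η η')
    (hort : ∫ x, p x ^ (2 * k - 1) * w x = 0) (h0 : hillForm (potential₁ ω k p) w w' w w' = 0) :
    hillForm (potential₁ ω k p) w w' η η' = 0 := by
  have hW := continuous_potential₁ h.hill.continuous ω k
  have hp := h.hill.isOddVariation
  have hpk := hp.bdd.pow (2 * k - 1)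
  -- `η - c p` satisfies the constraint, and the form vanishes at `(w, p)`
  set c : ℝ := (∫ x, p x ^ (2 * k - 1) * η x) / ∫ x, p x ^ (2 * k) with hc
  have hmass : ∫ x, p x ^ (2 * k - 1) * p x = ∫ x, p x ^ (2 * k) := by
    refine integral_congr_ae (Filter.Eventually.of_forall fun x => ?_)
    simp only
    rw [← pow_succ, show 2 * k - 1 + 1 = 2 * k by omega]
  have hort' : ∀ t : ℝ, ∫ x, p x ^ (2 * k - 1) * (w x + t * (η x + -c * p x)) = 0 := by
    intro t
    have e : ∀ x, p x ^ (2 * k - 1) * (w x + t * (η x + -c * p x)) = p x ^ (2 * k - 1) * w x +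
        (t * (p x ^ (2 * k - 1) * η x) + -(t * c) * (p x ^ (2 * k - 1) * p x)) := fun x => by ring
    simp only [e]
    rw [integral_add (hpk.mul hw.bdd).integrable
        (((hpk.mul hη.bdd).const_mul _).add ((hpk.mul hp.bdd).const_mul _)).integrable,
      integral_add ((hpk.mul hη.bdd).integrable.const_mul _)
        ((hpk.mul hp.bdd).integrable.const_mul _),
      integral_const_mul, integral_const_mul, hort, hmass, hc]
    field_simp [h.mass_pos.ne']
    ring
  have hζ := hη.add (hp.const_mul (-c))
  have h1 := hillForm_eq_zero_of_nonneg hW hw hζ h0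
    (fun t => h.nonneg_form₁ hk (hw.add (hζ.const_mul t)) (hort' t))
  rw [hillForm_comm, hillForm_add_left hW hη (hp.const_mul (-c)) hw, hillForm_const_mul_left,
    h.hillForm₁_profile hk hw, hort, mul_zero, mul_zero, add_zero, hillForm_comm] at h1
  exact h1

/-- The kernel of `𝓛₂` in the odd sector is spanned by `p`. -/
theorem eq_const_mul_of_isHillSolution₂ (hk : 1 ≤ k) (h : IsMinimizingProfile ω k p p')
    {v v' : AddCircle L → ℝ} (hv : IsHillSolution (potential₂ ω k p) v v') :
    ∃ c : ℝ, ∀ x, v x = c * p x := by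
  have hp0 : p ((0 : ℝ) : AddCircle L) = 0 := h.hill.apply_zero
  have hd := h.deriv_ne_zero hk hp0
  refine ⟨v' ((0 : ℝ) : AddCircle L) / p' ((0 : ℝ) : AddCircle L), fun x => ?_⟩
  have h1 := (hv.sub (h.hill.const_mul (v' ((0 : ℝ) : AddCircle L) /
    p' ((0 : ℝ) : AddCircle L)))).eq_zero (continuous_potential₂ h.hill.continuous ω k) (c := 0)
    (by rw [hp0, mul_zero, sub_zero]; exact hv.apply_zero) (by field_simp; ring)
  exact sub_eq_zero.1 (congrFun h1 x)

/-- The derivative of `p` solves the same equation as the solutions of `𝓛₁ v = 0`, so the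
Wronskian of the two is constant. -/
theorem wronskian (hk : 1 ≤ k) (h : IsMinimizingProfile ω k p p') {v v' : AddCircle L → ℝ}
    (hv : IsHillSolution (potential₁ ω k p) v v') :
    v' ((0 : ℝ) : AddCircle L) * p' ((0 : ℝ) : AddCircle L) =
      v' ((L / 2 : ℝ) : AddCircle L) * p' ((L / 2 : ℝ) : AddCircle L) := by
  have hk' : ((2 * k - 2 : ℕ) : ℝ) + 1 = 2 * k - 1 := by
    rw [Nat.cast_sub (by omega)]
    push_cast
    ring
  have hd : ∀ x : ℝ, HasDerivAt
      (fun y : ℝ => v y * (ω * p y - p y ^ (2 * k - 2 + 1)) - v' y * p' y) 0 x := by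
    intro x
    have h1 := (((h.hill.deriv x).const_mul ω).sub ((h.hill.deriv x).pow (2 * k - 2 + 1)))
    have h2 := ((hv.deriv x).mul h1).sub ((hv.deriv' x).mul (h.hill.deriv' x))
    refine h2.congr_deriv ?_
    simp only [Pi.sub_apply, Pi.pow_apply, Nat.add_sub_cancel]
    push_cast
    rw [hk', pow_succ]
    ring
  have h1 := is_const_of_deriv_eq_zero (fun x => (hd x).differentiableAt) (fun x => (hd x).deriv)
    0 (L / 2)
  have h0 : v ((0 : ℝ) : AddCircle L) = 0 := hv.apply_zero
  simp only [h0, hv.apply_half, zero_mul, zero_sub, neg_inj] at h1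
  exact h1

/-- Two cut-offs of a solution of `𝓛₁ v = 0` combine to a null vector of the form satisfying the
constraint; this bounds the number of zeros of `v`. -/
theorem not_two_zeros (hk : 1 ≤ k) (h : IsMinimizingProfile ω k p p') {v v' : AddCircle L → ℝ}
    (hv : IsHillSolution (potential₁ ω k p) v v') {a b : ℝ} (ha : 0 < a) (hab : a < b)
    (hb : b < L / 2) (hva : v a = 0) (hvb : v b = 0) : v = 0 := by
  have hL : 0 < L := Fact.out
  have hW := continuous_potential₁ h.hill.continuous ω k
  have hp := h.hill.isOddVariation
  have hv0 : v ((0 : ℝ) : AddCircle L) = 0 := hv.apply_zero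
  by_contra hne
  have hda : v' a ≠ 0 := fun e => hne (hv.eq_zero hW hva e)
  have hdb : v' b ≠ 0 := fun e => hne (hv.eq_zero hW hvb e)
  have haL : a ≤ L / 2 := by linarith
  have hb0 : 0 ≤ b := by linarith
  have w1 := hv.isOddVariation_indicator le_rfl ha.le haL hv0 hva
  have w2 := hv.isOddVariation_indicator hb0 hb.le le_rfl hvb hv.apply_half
  have hpk := hp.bdd.pow (2 * k - 1)
  set I₁ : ℝ := ∫ x, p x ^ (2 * k - 1) * (shell L 0 a).indicator v x with hI₁
  set I₂ : ℝ := ∫ x, p x ^ (2 * k - 1) * (shell L b (L / 2)).indicator v x with hI₂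
  -- the coefficients are chosen to satisfy the constraint
  obtain ⟨A, B, hAB, hI⟩ : ∃ A B : ℝ, (A ≠ 0 ∨ B ≠ 0) ∧ A * I₁ + B * I₂ = 0 := by
    by_cases hz : I₂ = 0
    · by_cases hz' : I₁ = 0
      · exact ⟨1, 0, Or.inl one_ne_zero, by rw [hz']; ring⟩
      · exact ⟨0, 1, Or.inr one_ne_zero, by rw [hz]; ring⟩
    · exact ⟨I₂, -I₁, Or.inl hz, by ring⟩
  have hw := (w1.const_mul A).add (w2.const_mul B)
  have hort : ∫ x, p x ^ (2 * k - 1) * (A * (shell L 0 a).indicator v x +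
      B * (shell L b (L / 2)).indicator v x) = 0 := by
    refine Eq.trans ?_ hI
    rw [hI₁, hI₂, ← integral_const_mul, ← integral_const_mul,
      ← integral_add ((hpk.mul w1.bdd).integrable.const_mul _)
        ((hpk.mul w2.bdd).integrable.const_mul _)]
    refine integral_congr_ae (Filter.Eventually.of_forall fun x => ?_)
    simp only
    ring
  have hnull := hillForm_add_self hW (w1.const_mul A) (w2.const_mul B)
  rw [hillForm_const_mul_left, hillForm_comm (u := (shell L 0 a).indicator v),
    hillForm_const_mul_left, hv.hillForm_indicator_self hW le_rfl ha.le haL hv0 hva,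
    hillForm_const_mul_left, hillForm_comm (u := (shell L 0 a).indicator v),
    hillForm_const_mul_left, hillForm_comm (u := (shell L b (L / 2)).indicator v),
    hillForm_indicator_of_disjoint hab, hillForm_const_mul_left,
    hillForm_comm (u := (shell L b (L / 2)).indicator v), hillForm_const_mul_left,
    hv.hillForm_indicator_self hW hb0 hb.le le_rfl hvb hv.apply_half] at hnull
  simp only [mul_zero, add_zero] at hnull
  -- the value of the form at `sin (2 π n x / L)` only sees the corners at `a` and at `b`, because
  -- this function vanishes at `0` and at `L / 2`
  have hcorner : ∀ n : ℤ, A * v' a * Real.sin (2 * Real.pi * n * a / L) =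
      B * v' b * Real.sin (2 * Real.pi * n * b / L) := by
    intro n
    obtain ⟨η, η', hs, hd, hη', hodd, hη⟩ := exists_sin L n
    have h1 := h.hillForm₁_eq_zero hk hw hη hort hnull
    have hs0 : η ((0 : ℝ) : AddCircle L) = 0 := by
      rw [hs, mul_zero, zero_div, Real.sin_zero]
    have hsL : η ((L / 2 : ℝ) : AddCircle L) = 0 := by
      rw [hs, show 2 * Real.pi * n * (L / 2) / L = n * Real.pi by field_simp, Real.sin_int_mul_pi]
    rw [hillForm_add_left hW (w1.const_mul A) (w2.const_mul B) hη, hillForm_const_mul_left,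
      hillForm_const_mul_left, hv.hillForm_indicator hW hd hη' hodd le_rfl ha.le haL,
      hv.hillForm_indicator hW hd hη' hodd hb0 hb.le le_rfl, hs0, hsL, hs, hs] at h1
    linarith
  have h1 := hcorner 1
  have h2 := hcorner 2
  have e : ∀ x : ℝ, 2 * Real.pi * ((2 : ℤ) : ℝ) * x / L = 2 * (2 * Real.pi * x / L) := by
    intro x
    push_cast
    ring
  rw [e, e, Real.sin_two_mul, Real.sin_two_mul] at h2
  simp only [Int.cast_one, mul_one] at h1
  have hsa := sin_two_pi_mul_pos (L := L) ha (by linarith)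
  have hsb := sin_two_pi_mul_pos (L := L) (ha.trans hab) hb
  have hcos : Real.cos (2 * Real.pi * b / L) < Real.cos (2 * Real.pi * a / L) := by
    refine Real.cos_lt_cos_of_nonneg_of_le_pi (by positivity) ?_ (by gcongr)
    rw [div_le_iff₀ hL]
    nlinarith [Real.pi_pos]
  have h3 : A * v' a * Real.sin (2 * Real.pi * a / L) *
      (Real.cos (2 * Real.pi * a / L) - Real.cos (2 * Real.pi * b / L)) = 0 := by
    linear_combination h2 / 2 - Real.cos (2 * Real.pi * b / L) * h1
  have h4 : A = 0 := by
    simpa [hsa.ne', hda, (sub_pos.2 hcos).ne'] using h3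
  have h5 : B = 0 := by
    rw [h4] at h1
    simpa [hsb.ne', hdb] using h1.symm
  exact hAB.elim (fun h => h h4) (fun h => h h5)

/-- The kernel of `𝓛₁` in the odd sector contains no `v` with `v' 0 > 0`, for positive `p`. -/
theorem not_isHillSolution₁_of_pos (hk : 2 ≤ k) (h : IsMinimizingProfile ω k p p')
    (hpos : ∀ c : ℝ, 0 < c → c < L / 2 → 0 < p c) {v v' : AddCircle L → ℝ}
    (hv : IsHillSolution (potential₁ ω k p) v v') (hv0 : 0 < v' ((0 : ℝ) : AddCircle L)) :
    False := by
  have hL : 0 < L := Fact.out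
  have hk1 : 1 ≤ k := by omega
  have hL2 : 0 < L / 2 := by linarith
  have hW := continuous_potential₁ h.hill.continuous ω k
  have hp0 : p ((0 : ℝ) : AddCircle L) = 0 := h.hill.apply_zero
  have hz0 : v ((0 : ℝ) : AddCircle L) = 0 := hv.apply_zero
  have hort : ∫ x, p x ^ (2 * k - 1) * v x = 0 := by
    have h1 := h.hillForm₁_profile hk1 hv.isOddVariation
    rw [hillForm_comm, hv.hillForm_eq_zero hW h.hill.isOddVariation] at h1
    have h2 : (2 : ℝ) ≤ k := by exact_mod_cast hk
    exact (mul_eq_zero.1 h1.symm).resolve_left (by linarith)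
  have hd0 : 0 < p' ((0 : ℝ) : AddCircle L) :=
    (nonneg_of_hasDerivAt_of_nonneg_right hL2 (h.hill.deriv 0) hp0
      fun x hx => (hpos x hx.1 hx.2).le).lt_of_ne' (h.deriv_ne_zero hk1 hp0)
  have hdL : p' ((L / 2 : ℝ) : AddCircle L) < 0 :=
    (nonpos_of_hasDerivAt_of_nonneg_left hL2 (h.hill.deriv (L / 2)) h.hill.apply_half
      fun x hx => (hpos x hx.1 hx.2).le).lt_of_ne (h.deriv_ne_zero hk1 h.hill.apply_half)
  have hvL : v' ((L / 2 : ℝ) : AddCircle L) < 0 := by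
    have h1 := h.wronskian hk1 hv
    by_contra hcon
    nlinarith [mul_pos hv0 hd0, mul_nonneg (not_lt.1 hcon) (neg_pos.2 hdL).le]
  have hpos_left : ∀ q : ℝ, 0 < q → ∃ r ∈ Set.Ioo 0 q, 0 < v (r : AddCircle L) := by
    intro q hq
    by_contra! hcon
    have := nonneg_of_hasDerivAt_of_nonneg_right hq (hv.deriv 0).neg
      (by simpa using hv.apply_zero) fun x hx => neg_nonneg.2 (hcon x hx)
    linarith
  -- either `v` keeps its sign, against the orthogonality, or it has two zeros in `(0, L / 2)`
  by_cases hs : ∀ q : ℝ, 0 < q → q < L / 2 → 0 ≤ v q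
  · obtain ⟨r, hr, hvr⟩ := hpos_left (L / 2) hL2
    have hF : Continuous fun x => p x ^ (2 * k - 1) * v x :=
      (h.hill.continuous.pow _).mul hv.continuous
    have h1 := integral_indicator_shell hF le_rfl hL2.le le_rfl
    have huniv : shell L 0 (L / 2) = Set.univ := by
      refine Set.eq_univ_of_forall fun x => ⟨norm_nonneg x, ?_⟩
      have := AddCircle.norm_le_half_period L hL.ne' (x := x)
      rwa [abs_of_pos hL] at this
    have e : ∀ t : ℝ, p ((-t : ℝ) : AddCircle L) ^ (2 * k - 1) * v ((-t : ℝ) : AddCircle L) =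
        p t ^ (2 * k - 1) * v t := by
      intro t
      rw [h.hill.odd_coe, hv.odd_coe, Odd.neg_pow ⟨k - 1, by omega⟩]
      ring
    simp only [huniv, Set.indicator_univ, hort, e] at h1
    have hc : Continuous fun t : ℝ => p t ^ (2 * k - 1) * v t + p t ^ (2 * k - 1) * v t :=
      (hF.add hF).comp (AddCircle.continuous_mk' L)
    refine (intervalIntegral.integral_pos hL2 hc.continuousOn (fun t ht => ?_)
      ⟨r, ⟨hr.1.le, hr.2.le⟩, ?_⟩).ne h1
    · rcases ht.2.eq_or_lt with he | hlt
      · rw [he, hv.apply_half]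
        simp
      · have h2 := hpos t ht.1 hlt
        have h3 := hs t ht.1 hlt
        positivity
    · have h2 := hpos r hr.1 hr.2
      positivity
  · push Not at hs
    obtain ⟨q, hq0, hqL, hvq⟩ := hs
    have hcv : Continuous fun x : ℝ => v x := hv.continuous.comp (AddCircle.continuous_mk' L)
    obtain ⟨r, hr, hvr⟩ := hpos_left q hq0
    obtain ⟨r', hr', hvr'⟩ : ∃ r ∈ Set.Ioo q (L / 2), 0 < v (r : AddCircle L) := by
      by_contra! hcon
      have := nonpos_of_hasDerivAt_of_nonneg_left hqL (hv.deriv (L / 2)).neg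
        (by simpa using hv.apply_half) fun x hx => neg_nonneg.2 (hcon x hx)
      linarith
    obtain ⟨a, ha, hva⟩ := intermediate_value_Ioo' hr.2.le hcv.continuousOn ⟨hvq, hvr⟩
    obtain ⟨b, hb, hvb⟩ := intermediate_value_Ioo hr'.1.le hcv.continuousOn ⟨hvq, hvr'⟩
    have h1 := h.not_two_zeros hk1 hv (hr.1.trans ha.1) (ha.2.trans hb.1) (hb.2.trans hr'.2) hva hvb
    rw [h1] at hvr
    exact lt_irrefl _ hvr

/-- The kernel of `𝓛₁` in the odd sector is trivial. -/
theorem eq_zero_of_isHillSolution₁ (hk : 2 ≤ k) (h : IsMinimizingProfile ω k p p')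
    {v v' : AddCircle L → ℝ} (hv : IsHillSolution (potential₁ ω k p) v v') : v = 0 := by
  wlog hpos : ∀ c : ℝ, 0 < c → c < L / 2 → 0 < p c generalizing p p'
  · have hneg := (h.pos_or_neg (by omega)).resolve_left hpos
    refine this h.neg ?_ fun c h1 h2 => neg_pos.2 (hneg c h1 h2)
    have e : ∀ x, (-p x) ^ (2 * k - 2) = p x ^ (2 * k - 2) := fun x =>
      Even.neg_pow ⟨k - 1, by omega⟩ _
    have e' : potential₁ ω k (fun x => -p x) = potential₁ ω k p := by
      funext x
      simp only [potential₁, e]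
    rw [e']
    exact hv
  · have hW := continuous_potential₁ h.hill.continuous ω k
    refine hv.eq_zero hW (c := 0) hv.apply_zero ?_
    rcases lt_trichotomy (v' ((0 : ℝ) : AddCircle L)) 0 with hlt | heq | hgt
    · exact (h.not_isHillSolution₁_of_pos hk hpos (hv.const_mul (-1)) (by linarith)).elim
    · exact heq
    · exact (h.not_isHillSolution₁_of_pos hk hpos hv hgt).elim

end IsMinimizingProfile

end Sturm

/-! ### Forms and kernels of the Hill operators on odd classes -/

section OddClasses

variable {𝕜 : Type*} [RCLike 𝕜] {L : ℝ} [Fact (0 < L)]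

theorem MemH1.exists_isOddVariation {f : AddCircle L → 𝕜} (hf : MemH1 f) (hodd : IsOdd f)
    (T : 𝕜 →L[ℝ] ℝ) : ∃ w w' : AddCircle L → ℝ, IsOddVariation w w' ∧
      (fun x => T (f x)) =ᵐ[volume] w ∧ (fun x => T (weakDeriv f x)) =ᵐ[volume] w' := by
  obtain ⟨F, hF, eF⟩ := hf.hasWeakDeriv.exists_isPrimitive hf.memLp hf.memLp_weakDeriv
  have hc : Continuous fun x => T (F x) :=
    T.continuous.comp (hF.continuous (integrable_of_memLp_two hf.memLp_weakDeriv))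
  have e : (fun x => T (f x)) =ᵐ[volume] fun x => T (F x) := by
    filter_upwards [eF] with x hx
    rw [hx]
  refine ⟨fun x => T (F x), fun x => T (weakDeriv f x), ⟨?_, IsBddMeas.of_continuous hc,
    T.comp_memLp' hf.memLp_weakDeriv, ?_⟩, e, Filter.EventuallyEq.rfl⟩
  · filter_upwards [hodd.congr eF] with x hx
    rw [hx, map_neg]
  · exact (hf.hasWeakDeriv.comp_clm hf.memLp hf.memLp_weakDeriv T).congr e
      Filter.EventuallyEq.rfl

variable {V W : AddCircle L → ℝ}

/-- The quadratic form of a Hill operator at an odd function splits into its values at the real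
and at the imaginary part. -/
theorem exists_re_inner_hillOp_eq (hW : Continuous W) (e : V =ᵐ[volume] W)
    (f : (hillOp 𝕜 V).domain) (hodd : IsOdd (f : L2per 𝕜 L)) :
    ∃ u u' v v' : AddCircle L → ℝ, IsOddVariation u u' ∧ IsOddVariation v v' ∧
      (fun x => RCLike.re ((f : L2per 𝕜 L) x)) =ᵐ[volume] u ∧
      (fun x => RCLike.im ((f : L2per 𝕜 L) x)) =ᵐ[volume] v ∧
      RCLike.re (inner 𝕜 (hillOp 𝕜 V f) (f : L2per 𝕜 L)) =
        hillForm W u u' u u' + hillForm W v v' v v' := by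
  obtain ⟨u, u', hu, e1, e1'⟩ := f.2.1.1.exists_isOddVariation hodd RCLike.reCLM
  obtain ⟨v, v', hv, e2, e2'⟩ := f.2.1.1.exists_isOddVariation hodd RCLike.imCLM
  refine ⟨u, u', v, v', hu, hv, e1, e2, ?_⟩
  rw [re_inner_hillOp_self hW e, hillForm, hillForm,
    ← integral_add (integrable_hillForm hW hu hu) (integrable_hillForm hW hv hv)]
  refine integral_congr_ae ?_
  filter_upwards [e1, e1', e2, e2'] with x a1 a2 a3 a4
  simp only [RCLike.reCLM_apply, RCLike.imCLM_apply] at a1 a2 a3 a4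
  rw [RCLike.norm_sq_eq_def, RCLike.norm_sq_eq_def, a1, a2, a3, a4]
  ring

theorem isOdd_hillOp (hWe : ∀ x, W (-x) = W x) (e : V =ᵐ[volume] W)
    (f : (hillOp 𝕜 V).domain) (hodd : IsOdd (f : L2per 𝕜 L)) : IsOdd (hillOp 𝕜 V f) := by
  have hf := f.2.1
  have h1 := isOdd_weakDeriv_of_even (hodd.weakDeriv_even hf.1.memLp_weakDeriv hf.1.hasWeakDeriv)
    hf.2.memLp_weakDeriv hf.2.hasWeakDeriv
  refine IsOdd.congr ?_ (coeFn_hillOp e f).symm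
  filter_upwards [h1, hodd] with x a1 a2
  rw [a1, a2, hWe]
  ring

theorem IsHillSolution.memH2_ofReal {v v' : AddCircle L → ℝ} (h : IsHillSolution W v v')
    (hW : Continuous W) : MemH2 (fun x => (v x : 𝕜)) ∧
      weakDeriv (fun x => (v x : 𝕜)) =ᵐ[volume] (fun x => (v' x : 𝕜)) ∧
      weakDeriv (weakDeriv fun x => (v x : 𝕜)) =ᵐ[volume] fun x => ((W x * v x : ℝ) : 𝕜) := by
  have m0 := memLp_of_continuous h.continuous 2
  have m1 := memLp_of_continuous h.continuous' 2
  have m2 := memLp_of_continuous (hW.mul h.continuous) 2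
  obtain ⟨a1, e1⟩ := weakDeriv_eq m0.ofReal m1.ofReal
    (h.hasWeakDeriv.comp_clm m0 m1 (RCLike.ofRealCLM (K := 𝕜)))
  obtain ⟨a2, e2⟩ := weakDeriv_eq m1.ofReal m2.ofReal
    ((h.hasWeakDeriv' hW).comp_clm m1 m2 (RCLike.ofRealCLM (K := 𝕜)))
  obtain ⟨a3, e3⟩ := a2.congr e1.symm
  exact ⟨⟨a1, a3⟩, e1, e3.trans e2⟩

namespace IsMinimizingProfile

variable {ω : ℝ} {k : ℕ} {p p' : AddCircle L → ℝ}

theorem re_inner_hillOp₂_nonneg (hk : 1 ≤ k) (h : IsMinimizingProfile ω k p p')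
    (e : V =ᵐ[volume] potential₂ ω k p) (f : (hillOp 𝕜 V).domain)
    (hodd : IsOdd (f : L2per 𝕜 L)) :
    0 ≤ RCLike.re (inner 𝕜 (hillOp 𝕜 V f) (f : L2per 𝕜 L)) := by
  obtain ⟨u, u', v, v', hu, hv, -, -, heq⟩ :=
    exists_re_inner_hillOp_eq (continuous_potential₂ h.hill.continuous ω k) e f hodd
  rw [heq]
  exact add_nonneg (h.nonneg_form₂ hk hu) (h.nonneg_form₂ hk hv)

theorem re_inner_hillOp₁_nonneg (hk : 1 ≤ k) (h : IsMinimizingProfile ω k p p')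
    (e : V =ᵐ[volume] potential₁ ω k p) (f : (hillOp 𝕜 V).domain)
    (hodd : IsOdd (f : L2per 𝕜 L))
    (hort : ∫ x, ((p x ^ (2 * k - 1) : ℝ) : 𝕜) * (f : L2per 𝕜 L) x = 0) :
    0 ≤ RCLike.re (inner 𝕜 (hillOp 𝕜 V f) (f : L2per 𝕜 L)) := by
  obtain ⟨u, u', v, v', hu, hv, eu, ev, heq⟩ :=
    exists_re_inner_hillOp_eq (continuous_potential₁ h.hill.continuous ω k) e f hodd
  have hi := integrable_mul (h.hill.continuous.pow (2 * k - 1)) (Lp.memLp (f : L2per 𝕜 L))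
  have h1 := integral_re (𝕜 := 𝕜) hi
  have h2 := integral_im (𝕜 := 𝕜) hi
  simp only [Pi.pow_apply, hort, map_zero, RCLike.re_ofReal_mul, RCLike.im_ofReal_mul] at h1 h2
  rw [heq]
  refine add_nonneg (h.nonneg_form₁ hk hu ?_) (h.nonneg_form₁ hk hv ?_)
  · rw [← h1]
    refine integral_congr_ae ?_
    filter_upwards [eu] with x hx
    simp only [hx]
  · rw [← h2]
    refine integral_congr_ae ?_
    filter_upwards [ev] with x hx
    simp only [hx]

theorem eq_zero_of_mem_eigenspace_hillOp₁ (hk : 2 ≤ k) (h : IsMinimizingProfile ω k p p')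
    (e : V =ᵐ[volume] potential₁ ω k p) {f : L2per 𝕜 L} (hodd : IsOdd f)
    (hf : f ∈ eigenspace (hillOp 𝕜 V) 0) : f = 0 := by
  have hW := continuous_potential₁ h.hill.continuous ω k
  obtain ⟨hm, hf⟩ := (mem_eigenspace_hillOp hW e).1 hf
  have hf' : ∀ᵐ x, weakDeriv (weakDeriv f) x = (potential₁ ω k p x : 𝕜) * f x := by
    filter_upwards [hf] with x hx
    linear_combination -hx
  obtain ⟨u, u', hu, eu, -⟩ := hm.exists_isHillSolution hodd hW hf' RCLike.reCLM
  obtain ⟨v, v', hv, ev, -⟩ := hm.exists_isHillSolution hodd hW hf' RCLike.imCLM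
  have hu0 := h.eq_zero_of_isHillSolution₁ hk hu
  have hv0 := h.eq_zero_of_isHillSolution₁ hk hv
  refine Lp.ext ?_
  filter_upwards [eu, ev, Lp.coeFn_zero 𝕜 2 (volume : Measure (AddCircle L))] with x a1 a2 a3
  rw [hu0] at a1
  rw [hv0] at a2
  rw [a3]
  refine RCLike.ext ?_ ?_
  · simpa using a1
  · simpa using a2

theorem exists_eq_smul_of_mem_eigenspace_hillOp₂ (hk : 1 ≤ k) (h : IsMinimizingProfile ω k p p')
    (e : V =ᵐ[volume] potential₂ ω k p) {P f : L2per 𝕜 L} (hP : P =ᵐ[volume] fun x => (p x : 𝕜))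
    (hodd : IsOdd f) (hf : f ∈ eigenspace (hillOp 𝕜 V) 0) : ∃ c : 𝕜, c • P = f := by
  have hW := continuous_potential₂ h.hill.continuous ω k
  obtain ⟨hm, hf⟩ := (mem_eigenspace_hillOp hW e).1 hf
  have hf' : ∀ᵐ x, weakDeriv (weakDeriv f) x = (potential₂ ω k p x : 𝕜) * f x := by
    filter_upwards [hf] with x hx
    linear_combination -hx
  obtain ⟨u, u', hu, eu, -⟩ := hm.exists_isHillSolution hodd hW hf' RCLike.reCLM
  obtain ⟨v, v', hv, ev, -⟩ := hm.exists_isHillSolution hodd hW hf' RCLike.imCLM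
  obtain ⟨a, ha⟩ := h.eq_const_mul_of_isHillSolution₂ hk hu
  obtain ⟨b, hb⟩ := h.eq_const_mul_of_isHillSolution₂ hk hv
  refine ⟨(a : 𝕜) + b * RCLike.I, Lp.ext ?_⟩
  filter_upwards [eu, ev, Lp.coeFn_smul ((a : 𝕜) + b * RCLike.I) P, hP] with x a1 a2 a3 a4
  simp only [RCLike.reCLM_apply, RCLike.imCLM_apply] at a1 a2
  rw [a3, Pi.smul_apply, a4, smul_eq_mul, ← RCLike.re_add_im (f x), a1, a2, ha, hb]
  push_cast
  ring

end IsMinimizingProfile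

end OddClasses

/-! ### The linearized operator in the odd sector -/

section Spectrum

variable {𝕜 : Type*} [RCLike 𝕜] {L : ℝ} [Fact (0 < L)] {V₁ V₂ W₁ W₂ : AddCircle L → ℝ}

theorem mem_part_diagOp_domain (hW₁ : Continuous W₁) (hW₂ : Continuous W₂)
    (he₁ : ∀ x, W₁ (-x) = W₁ x) (he₂ : ∀ x, W₂ (-x) = W₂ x) (e₁ : V₁ =ᵐ[volume] W₁)
    (e₂ : V₂ =ᵐ[volume] W₂) (x : oddSector 𝕜 L) (h₁ : MemH2 (x : L2pair 𝕜 L).fst)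
    (h₂ : MemH2 (x : L2pair 𝕜 L).snd) :
    x ∈ (part (diagOp (hillOp 𝕜 V₁) (hillOp 𝕜 V₂)) (oddSector 𝕜 L)).domain :=
  ⟨⟨(mem_hillOp_domain hW₁ e₁).2 h₁, (mem_hillOp_domain hW₂ e₂).2 h₂⟩,
    isOdd_hillOp he₁ e₁ ⟨_, (mem_hillOp_domain hW₁ e₁).2 h₁⟩ x.2.1,
    isOdd_hillOp he₂ e₂ ⟨_, (mem_hillOp_domain hW₂ e₂).2 h₂⟩ x.2.2⟩

theorem exists_lower_bound_part_diagOp (hW₁ : Continuous W₁) (hW₂ : Continuous W₂)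
    (e₁ : V₁ =ᵐ[volume] W₁) (e₂ : V₂ =ᵐ[volume] W₂) : ∃ M : ℝ,
      ∀ x : (part (diagOp (hillOp 𝕜 V₁) (hillOp 𝕜 V₂)) (oddSector 𝕜 L)).domain,
        M * ‖(x : oddSector 𝕜 L)‖ ^ 2 ≤ RCLike.re (inner 𝕜
          (part (diagOp (hillOp 𝕜 V₁) (hillOp 𝕜 V₂)) (oddSector 𝕜 L) x) (x : oddSector 𝕜 L)) := by
  obtain ⟨M₁, h₁⟩ := exists_lower_bound_hillOp (𝕜 := 𝕜) hW₁ e₁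
  obtain ⟨M₂, h₂⟩ := exists_lower_bound_hillOp (𝕜 := 𝕜) hW₂ e₂
  refine ⟨min M₁ M₂, fun x => ?_⟩
  have h3 := h₁ ⟨_, x.2.1.1⟩
  have h4 := h₂ ⟨_, x.2.1.2⟩
  have h5 := mul_le_mul_of_nonneg_right (min_le_left M₁ M₂)
    (sq_nonneg ‖((x : oddSector 𝕜 L) : L2pair 𝕜 L).fst‖)
  have h6 := mul_le_mul_of_nonneg_right (min_le_right M₁ M₂)
    (sq_nonneg ‖((x : oddSector 𝕜 L) : L2pair 𝕜 L).snd‖)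
  have hn : ‖(x : oddSector 𝕜 L)‖ ^ 2 = ‖((x : oddSector 𝕜 L) : L2pair 𝕜 L).fst‖ ^ 2 +
      ‖((x : oddSector 𝕜 L) : L2pair 𝕜 L).snd‖ ^ 2 :=
    WithLp.prod_norm_sq_eq_of_L2 ((x : oddSector 𝕜 L) : L2pair 𝕜 L)
  rw [inner_part_diagOp, map_add, hn, mul_add]
  exact add_le_add (h5.trans h3) (h6.trans h4)

namespace IsMinimizingProfile

variable {ω : ℝ} {k : ℕ} {p p' : AddCircle L → ℝ}

theorem potential₁_neg (h : IsMinimizingProfile ω k p p') (x : AddCircle L) :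
    potential₁ ω k p (-x) = potential₁ ω k p x := by
  rw [potential₁, potential₁, h.hill.odd, Even.neg_pow ⟨k - 1, by omega⟩]

theorem potential₂_neg (h : IsMinimizingProfile ω k p p') (x : AddCircle L) :
    potential₂ ω k p (-x) = potential₂ ω k p x := by
  rw [potential₂, potential₂, h.hill.odd, Even.neg_pow ⟨k - 1, by omega⟩]

/-- The class of the profile in `L²_per`, with its weak derivatives. -/
theorem exists_class (𝕜 : Type*) [RCLike 𝕜] (h : IsMinimizingProfile ω k p p') :
    ∃ P : L2per 𝕜 L, P =ᵐ[volume] (fun x => (p x : 𝕜)) ∧ IsOdd P ∧ MemH2 P ∧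
      weakDeriv P =ᵐ[volume] (fun x => (p' x : 𝕜)) ∧
      weakDeriv (weakDeriv P) =ᵐ[volume]
        fun x => ((potential₂ ω k p x * p x : ℝ) : 𝕜) := by
  obtain ⟨h1, h2, h3⟩ := h.hill.memH2_ofReal (𝕜 := 𝕜)
    (continuous_potential₂ h.hill.continuous ω k)
  have e := h1.1.memLp.coeFn_toLp
  obtain ⟨h4, h5⟩ := h1.congr e.symm
  refine ⟨h1.1.memLp.toLp _, e, ?_, h4, (h1.1.congr e.symm).2.trans h2, h5.trans h3⟩
  refine IsOdd.congr (Filter.Eventually.of_forall fun x => ?_) e.symm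
  simp only [h.hill.odd, RCLike.ofReal_neg]

/-- The linearized operator is negative at `(p, 0)`. -/
theorem exists_neg_direction (hk : 2 ≤ k) (h : IsMinimizingProfile ω k p p')
    (e₁ : V₁ =ᵐ[volume] potential₁ ω k p) (e₂ : V₂ =ᵐ[volume] potential₂ ω k p) :
    ∃ x : (part (diagOp (hillOp 𝕜 V₁) (hillOp 𝕜 V₂)) (oddSector 𝕜 L)).domain,
      RCLike.re (inner 𝕜 (part (diagOp (hillOp 𝕜 V₁) (hillOp 𝕜 V₂)) (oddSector 𝕜 L) x)
        (x : oddSector 𝕜 L)) < 0 := by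
  have hW₁ := continuous_potential₁ h.hill.continuous ω k
  have hW₂ := continuous_potential₂ h.hill.continuous ω k
  obtain ⟨P, hP, hPodd, hP2, hP', -⟩ := h.exists_class 𝕜
  set x₀ : oddSector 𝕜 L := ⟨WithLp.toLp 2 (P, 0), hPodd, (oddSector 𝕜 L).zero_mem.2⟩
  have hx₀ := mem_part_diagOp_domain (V₁ := V₁) (V₂ := V₂) hW₁ hW₂ h.potential₁_neg
    h.potential₂_neg e₁ e₂ x₀ hP2
    (memH2_zero.congr (Lp.coeFn_zero 𝕜 2 (volume : Measure (AddCircle L))).symm).1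
  refine ⟨⟨x₀, hx₀⟩, ?_⟩
  have h1 := h.hillForm₁_profile (by omega) h.hill.isOddVariation
  have h2 : RCLike.re (inner 𝕜 (hillOp 𝕜 V₁ ⟨P, hx₀.1.1⟩) P) =
      hillForm (potential₁ ω k p) p p' p p' := by
    refine (re_inner_hillOp_self hW₁ e₁ ⟨P, hx₀.1.1⟩).trans (integral_congr_ae ?_)
    filter_upwards [hP, hP'] with x a1 a2
    rw [a1, a2, RCLike.norm_ofReal, RCLike.norm_ofReal, sq_abs, sq_abs]
    ring
  have h3 : ∫ x, p x ^ (2 * k - 1) * p x = ∫ x, p x ^ (2 * k) := by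
    refine integral_congr_ae (Filter.Eventually.of_forall fun x => ?_)
    simp only
    rw [← pow_succ, show 2 * k - 1 + 1 = 2 * k by omega]
  rw [inner_part_diagOp, map_add]
  have h4 : RCLike.re (inner 𝕜 (hillOp 𝕜 V₂ ⟨(0 : L2per 𝕜 L), hx₀.1.2⟩) (0 : L2per 𝕜 L)) = 0 := by
    rw [inner_zero_right, map_zero]
  have h5 : (2 : ℝ) ≤ k := by exact_mod_cast hk
  have h6 : hillForm (potential₁ ω k p) p p' p p' < 0 := by
    rw [h1, h3]
    exact mul_neg_of_neg_of_pos (by linarith) h.mass_pos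
  calc _ = hillForm (potential₁ ω k p) p p' p p' + 0 := congrArg₂ (· + ·) h2 h4
    _ < 0 := by rwa [add_zero]

/-- The linearized operator is nonnegative on the pairs whose first component is orthogonal to
`p ^ (2 * k - 1)`. -/
theorem exists_functional (hk : 1 ≤ k) (h : IsMinimizingProfile ω k p p')
    (e₁ : V₁ =ᵐ[volume] potential₁ ω k p) (e₂ : V₂ =ᵐ[volume] potential₂ ω k p) :
    ∃ ℓ : oddSector 𝕜 L →ₗ[𝕜] 𝕜,
      ∀ x : (part (diagOp (hillOp 𝕜 V₁) (hillOp 𝕜 V₂)) (oddSector 𝕜 L)).domain,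
        ℓ x = 0 → 0 ≤ RCLike.re (inner 𝕜
          (part (diagOp (hillOp 𝕜 V₁) (hillOp 𝕜 V₂)) (oddSector 𝕜 L) x)
            (x : oddSector 𝕜 L)) := by
  have hm : MemLp (fun x => ((p x ^ (2 * k - 1) : ℝ) : 𝕜)) 2 (volume : Measure (AddCircle L)) :=
    (memLp_of_continuous (h.hill.continuous.pow (2 * k - 1)) 2).ofReal
  refine ⟨(innerSL 𝕜 (hm.toLp _)).toLinearMap ∘ₗ
    (WithLp.fstL 2 𝕜 (L2per 𝕜 L) (L2per 𝕜 L)).toLinearMap ∘ₗ (oddSector 𝕜 L).subtype,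
    fun x hx => ?_⟩
  rw [inner_part_diagOp, map_add]
  refine add_nonneg (h.re_inner_hillOp₁_nonneg hk e₁ ⟨_, x.2.1.1⟩ x.1.2.1 ?_)
    (h.re_inner_hillOp₂_nonneg hk e₂ ⟨_, x.2.1.2⟩ x.1.2.2)
  have h1 : inner 𝕜 (hm.toLp _) ((x : oddSector 𝕜 L) : L2pair 𝕜 L).fst = 0 := hx
  rw [L2.inner_def] at h1
  rw [← h1]
  refine integral_congr_ae ?_
  filter_upwards [hm.coeFn_toLp] with y hy
  rw [RCLike.inner_apply, hy, RCLike.conj_ofReal, mul_comm]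

/-- The kernel of the linearized operator is spanned by `(0, p)`. -/
theorem exists_kernel (hk : 2 ≤ k) (h : IsMinimizingProfile ω k p p')
    (e₁ : V₁ =ᵐ[volume] potential₁ ω k p) (e₂ : V₂ =ᵐ[volume] potential₂ ω k p) :
    Module.finrank 𝕜
      (eigenspace (part (diagOp (hillOp 𝕜 V₁) (hillOp 𝕜 V₂)) (oddSector 𝕜 L)) 0) = 1 ∧
    ∃ Φ : oddSector 𝕜 L, (Φ : L2pair 𝕜 L).fst = 0 ∧
      (∀ᵐ x : AddCircle L, (Φ : L2pair 𝕜 L).snd x = (p x : 𝕜)) ∧ Φ ≠ 0 ∧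
      Φ ∈ eigenspace (part (diagOp (hillOp 𝕜 V₁) (hillOp 𝕜 V₂)) (oddSector 𝕜 L)) 0 := by
  have hW₂ := continuous_potential₂ h.hill.continuous ω k
  obtain ⟨P, hP, hPodd, hP2, -, hP''⟩ := h.exists_class 𝕜
  have hP0 : P ≠ 0 := by
    rintro rfl
    refine h.ne_zero (by omega) ((h.hill.continuous.ae_eq_iff_eq (μ := volume)
      continuous_const).1 ?_)
    filter_upwards [hP, Lp.coeFn_zero 𝕜 2 (volume : Measure (AddCircle L))] with x a1 a2
    rw [a2] at a1
    exact RCLike.ofReal_eq_zero.1 a1.symm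
  set Φ : oddSector 𝕜 L := ⟨WithLp.toLp 2 (0, P), (oddSector 𝕜 L).zero_mem.1, hPodd⟩ with hΦ
  have hΦ0 : Φ ≠ 0 := fun e => hP0 (congrArg (fun y : oddSector 𝕜 L => (y : L2pair 𝕜 L).snd) e)
  have hmem : Φ ∈ eigenspace (part (diagOp (hillOp 𝕜 V₁) (hillOp 𝕜 V₂)) (oddSector 𝕜 L)) 0 := by
    refine mem_eigenspace_part_diagOp.2 ⟨Submodule.zero_mem _,
      (mem_eigenspace_hillOp hW₂ e₂).2 ⟨hP2, ?_⟩⟩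
    filter_upwards [hP, hP''] with x a1 a2
    change -weakDeriv (weakDeriv P) x + (potential₂ ω k p x : 𝕜) * P x = 0 * P x
    rw [a1, a2]
    push_cast
    ring
  refine ⟨?_, Φ, rfl, hP, hΦ0, hmem⟩
  refine finrank_eq_one ⟨Φ, hmem⟩ (fun e => hΦ0 (congrArg Subtype.val e)) fun x => ?_
  obtain ⟨h1, h2⟩ := mem_eigenspace_part_diagOp.1 x.2
  have h3 := h.eq_zero_of_mem_eigenspace_hillOp₁ hk e₁ x.1.2.1 h1
  obtain ⟨c, hc⟩ := h.exists_eq_smul_of_mem_eigenspace_hillOp₂ (by omega) e₂ hP x.1.2.2 h2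
  refine ⟨c, Subtype.ext (Subtype.ext (pair_ext ?_ hc))⟩
  rw [h3]
  exact smul_zero c

end IsMinimizingProfile

end Spectrum

end PeriodicNLS

open PeriodicNLS

theorem proposition3p4 (𝕜 : Type*) [RCLike 𝕜] (L : ℝ) [Fact (0 < L)] (ω : ℝ) (hω : 0 < ω)
    (α : ℕ) (hα : 0 < α) (hα_even : Even α) (φ : AddCircle L → ℝ)
    (hφ : PeriodicNLS.IsOddMinimizingWave L ω α φ) :
    ∃ lam : ℝ, lam < 0 ∧
      -- `lam` is a simple eigenvalue
      Module.finrank 𝕜 (PeriodicNLS.eigenspace (PeriodicNLS.opLodd 𝕜 ω α φ) (lam : 𝕜)) = 1 ∧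
      -- and the only negative one
      (∀ r : ℝ, r < 0 →
        PeriodicNLS.IsEigenvalue (PeriodicNLS.opLodd 𝕜 ω α φ) (r : 𝕜) → r = lam) ∧
      -- zero is a simple eigenvalue with eigenfunction `(0, φ)`
      Module.finrank 𝕜 (PeriodicNLS.eigenspace (PeriodicNLS.opLodd 𝕜 ω α φ) 0) = 1 ∧
      (∃ Φ : PeriodicNLS.oddSector 𝕜 L,
        (Φ : PeriodicNLS.L2pair 𝕜 L).fst = 0 ∧
        (∀ᵐ x : AddCircle L, (Φ : PeriodicNLS.L2pair 𝕜 L).snd x = (φ x : 𝕜)) ∧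
        Φ ≠ 0 ∧ Φ ∈ PeriodicNLS.eigenspace (PeriodicNLS.opLodd 𝕜 ω α φ) 0) ∧
      -- the remainder of the spectrum consists of positive eigenvalues of finite multiplicity
      (∀ z ∈ PeriodicNLS.opSpectrum (PeriodicNLS.opLodd 𝕜 ω α φ), z ≠ (lam : 𝕜) → z ≠ 0 →
        (∃ r : ℝ, 0 < r ∧ z = (r : 𝕜)) ∧
        PeriodicNLS.IsEigenvalue (PeriodicNLS.opLodd 𝕜 ω α φ) z ∧
        FiniteDimensional 𝕜 (PeriodicNLS.eigenspace (PeriodicNLS.opLodd 𝕜 ω α φ) z)) ∧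
      -- and the spectrum is discrete: only finitely many points in each bounded set
      (∀ R : ℝ, (PeriodicNLS.opSpectrum (PeriodicNLS.opLodd 𝕜 ω α φ) ∩
        Metric.closedBall 0 R).Finite) := by
  obtain ⟨k, hk, rfl⟩ : ∃ k, 2 ≤ k ∧ α = 2 * k - 2 := by
    obtain ⟨m, hm⟩ := hα_even
    exact ⟨m + 1, by omega, by omega⟩
  obtain ⟨p, p', hφp, h⟩ := hφ.exists_profile hω (by omega) hα_even
  have hW₁ := continuous_potential₁ h.hill.continuous ω k
  have hW₂ := continuous_potential₂ h.hill.continuous ω k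
  have e₁ : (fun x => ω - (((2 * k - 2 : ℕ) : ℝ) + 1) * |φ x| ^ (2 * k - 2)) =ᵐ[volume]
      potential₁ ω k p := by
    filter_upwards [hφp] with x hx
    rw [hx, hα_even.pow_abs, Nat.cast_sub (by omega)]
    push_cast
    ring
  have e₂ : (fun x => ω - |φ x| ^ (2 * k - 2)) =ᵐ[volume] potential₂ ω k p := by
    filter_upwards [hφp] with x hx
    rw [hx, hα_even.pow_abs]
  obtain ⟨K, B, hA⟩ := exists_isPerturbationOfCompactInverse (𝕜 := 𝕜) hW₁ hW₂ h.potential₁_neg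
    h.potential₂_neg e₁ e₂
  have hs := isSymm_part_diagOp (isSymm_hillOp (𝕜 := 𝕜) hW₁ e₁) (isSymm_hillOp hW₂ e₂)
  obtain ⟨M, hM⟩ := exists_lower_bound_part_diagOp (𝕜 := 𝕜) hW₁ hW₂ e₁ e₂
  obtain ⟨x₀, hx₀⟩ := h.exists_neg_direction (𝕜 := 𝕜) hk e₁ e₂
  obtain ⟨lam, hlam, hev⟩ := exists_neg_eigenvalue hA hs hM hx₀
  obtain ⟨ℓ, hℓ⟩ := h.exists_functional (𝕜 := 𝕜) (by omega) e₁ e₂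
  obtain ⟨hsimple, hunique⟩ := finrank_eq_one_and_unique_of_nonneg_on_ker hs ℓ hℓ hlam hev
  obtain ⟨hker, Φ, hΦ1, hΦ2, hΦ0, hΦ⟩ := h.exists_kernel (𝕜 := 𝕜) hk e₁ e₂
  refine ⟨lam, hlam, hsimple, hunique, hker, ⟨Φ, hΦ1, ?_, hΦ0, hΦ⟩, fun z hz hz1 hz0 => ?_,
    finite_opSpectrum_inter_closedBall hA hs⟩
  · filter_upwards [hΦ2, hφp] with x a1 a2
    rw [a1, a2]
  · have hzev := isEigenvalue_of_mem_opSpectrum hA hz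
    have hzre := hs.eigenvalue_eq_re hzev
    refine ⟨⟨RCLike.re z, ?_, hzre⟩, hzev, finiteDimensional_eigenspace hA z⟩
    rcases lt_trichotomy (RCLike.re z) 0 with hlt | heq | hgt
    · rw [hzre] at hzev
      exact absurd (hzre.trans (congrArg _ (hunique _ hlt hzev))) hz1
    · exact absurd (hzre.trans (by rw [heq, RCLike.ofReal_zero])) hz0
    · exact hgt

end
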